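/- **Conventions.** Let $t=(t_1,t_2)$ be the coordinates of $(\mathbb{C}^2,0)$, and let $\mathbb{C}\{t,z]]$ be the ring of formal power series $\sum_{n\ge 0}a_n(t)z^n$ whose coefficients $a_n$ are all holomorphic on one common neighbourhood of $0\in\mathbb{C}^2$. For a matrix $M$ over this ring write $M=\sum_{n\ge0}M^{(n)}z^n$. A *formal $(TE)$-structure* (of rank $2$ over $(\mathbb{C}^2,0)$) is a triple $\nabla=(A_1,A_2,B)$ of $2\times2$ matrices over $\mathbb{C}\{t,z]]$ (the connection form being $z^{-1}A_1dt_1+z^{-1}A_2dt_2+z^{-2}B\,dz$) satisfying, for all $i,j$, $$z\partial_iA_j-z\partial_jA_i+[A_i,A_j]=0,\qquad z\partial_iB-z^2\partial_zA_i+zA_i+[A_i,B]=0 .$$ For a vector field $X=X_1\partial_1+X_2\partial_2$ put $C_X:=X_1A_1^{(0)}+X_2A_2^{(0)}$. The globally nilpotent $F$-manifold germ $\mathcal N_2$ is $(\mathbb{C}^2,0)$ with the multiplication $\partial_1\circ\partial_1=\partial_1$, $\partial_1\circ\partial_2=\partial_2\circ\partial_1=\partial_2$, $\partial_2\circ\partial_2=0$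 and unit field $\partial_1$. The structure $\nabla$ is *over $\mathcal N_2$* if there is a holomorphic germ $\zeta:(\mathbb{C}^2,0)\to\mathbb{C}^2$ such that $X\mapsto C_X\zeta$ is an isomorphism near $0$, and $C_{X\circ Y}=C_XC_Y$ for all $X,Y$, $C_{\partial_1}=\mathrm{Id}$. Two formal $(TE)$-structures $(A_1,A_2,B)$ and $(\tilde A_1,\tilde A_2,\tilde B)$ are *formally isomorphic* if there are a biholomorphic germ $h=(h^1,h^2):(\mathbb{C}^2,0)\to(\mathbb{C}^2,0)$ and a matrix $T$ over $\mathbb{C}\{t,z]]$ with $T^{(0)}$ invertible such that, with $\tilde T:=T\circ h$, $$z\partial_i\tilde T+\sum_{j}(\partial_ih^j)(A_j\circ h)\tilde T-\tilde T\tilde A_i=0\ (i=1,2),\qquad z^2\partial_z\tilde T+(B\circ h)\tilde T-\tilde T\tilde B=0 .$$ Let $$C_1=\begin{pmatrix}1&0\\0&1\end{pmatrix},\quad C_2=\begin{pmatrix}0&0\\1&0\end{pmatrix},\quad D=\begin{pmatrix}1&0\\0&-1\end{pmatrix},\quad E=\begin{pmatrix}0&1\\0&0\end{pmatrix}.$$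 **Theorem.** Any formal $(TE)$-structure over $\mathcal N_2$ is formally isomorphic to a $(TE)$-structure over $\mathcal N_2$ of one of the following forms. i) For $c,\alpha,c_0\in\mathbb{C}$: $A_1=C_1$, $A_2=C_2+zE$ and $$B=(-t_1+c+\alpha z)C_1+\left(-\tfrac{t_2}{2}+c_0\right)C_2-\tfrac z4D+z\left(-\tfrac{t_2}{2}+c_0\right)E.$$ ii) For $c,\alpha\in\mathbb{C}$ and $r\in\mathbb{Z}_{\ge1}$: $A_1=C_1$, $A_2=C_2+zt_2^rE$ and $$B=(-t_1+c+\alpha z)C_1-\tfrac{t_2}{r+2}C_2-\tfrac{z(r+1)}{2(r+2)}D-\tfrac{zt_2^{r+1}}{r+2}E.$$ iii) $A_1=C_1$, $A_2=C_2$ and, for some $c,\alpha,\gamma\in\mathbb{C}$, $B$ is one of 1. $(-t_1+c+\alpha z)C_1-\frac z2D$; 2. $(-t_1+c+\alpha z)C_1+t_2^2C_2-z(t_2+\frac12)D-z^2E$; 3. $(-t_1+c+\alpha z)C_1+\lambda t_2C_2-\frac z2(\lambda+1)D$, with $\lambda\in\mathbb{C}$, $\lambda\notin\mathbb{Z}\setminus\{0\}$;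 4. $(-t_1+c+\alpha z)C_1+(\lambda t_2+1)C_2-\frac z2(\lambda+1)D$, with $\lambda\in\mathbb{C}$, $\lambda\notin\mathbb{Z}\setminus\{0\}$; 5. $(-t_1+c+\alpha z)C_1+(\lambda t_2+1+\gamma t_2^2z^\lambda)C_2-\frac z2(\lambda+1+2\gamma t_2z^\lambda)D-\gamma z^{\lambda+2}E$, with $\lambda\in\mathbb{Z}_{\ge1}$; 6. $(-t_1+c+\alpha z)C_1+t_2(\lambda+t_2z^\lambda)C_2-\frac z2(\lambda+1+2t_2z^\lambda)D-z^{\lambda+2}E$, with $\lambda\in\mathbb{Z}_{\ge1}$; 7. $(-t_1+c+\alpha z)C_1+\lambda t_2C_2-\frac z2(\lambda+1)D$, with $\lambda\in\mathbb{Z}_{\ge1}$; 8. $(-t_1+c+\alpha z)C_1+(\lambda t_2+z^{-\lambda})C_2-\frac z2(\lambda+1)D$, with $\lambda\in\mathbb{Z}_{\le-1}$; 9. $(-t_1+c+\alpha z)C_1+\lambda t_2C_2-\frac z2(\lambda+1)D$, with $\lambda\in\mathbb{Z}_{\le-1}$. -/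

import Mathlib

open scoped Topology
open Filter

noncomputable section

namespace TEStructure

/-- Coordinates `(t₁, …, t_m)` of the germ `(ℂ^m, 0)`; `t i` is the `(i+1)`-st coordinate. -/
abbrev Base (m : ℕ) : Type := Fin m → ℂ

/-- Square matrices whose entries are formal power series in `z` over `ℂ`. -/
abbrev ZMat (r : ℕ) : Type := Matrix (Fin r) (Fin r) (PowerSeries ℂ)

/-- The variable `z`. -/
abbrev z : PowerSeries ℂ := PowerSeries.X

/-- A complex number as a constant power series in `z`. -/
abbrev k (a : ℂ) : PowerSeries ℂ := PowerSeries.C a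

/-- `t ↦ f t ∈ ℂ⟦z⟧` represents an element of `ℂ{t, z]]`: all coefficients of `f = ∑ aₙ(t) zⁿ`
are holomorphic on one and the same neighbourhood of the origin. -/
def IsFormalHolo {m : ℕ} (f : Base m → PowerSeries ℂ) : Prop :=
  ∃ U ∈ 𝓝 (0 : Base m), ∀ n : ℕ, AnalyticOnNhd ℂ (fun t => PowerSeries.coeff n (f t)) U

/-- A matrix all of whose entries belong to `ℂ{t, z]]`. -/
def IsFormalHoloMat {m r : ℕ} (M : Base m → ZMat r) : Prop :=
  ∀ a b : Fin r, IsFormalHolo (fun t => M t a b)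

/-- The partial derivative `∂ᵢ` of a complex function of `t`. -/
def pd {m : ℕ} (i : Fin m) (f : Base m → ℂ) (t : Base m) : ℂ :=
  fderiv ℂ f t (Pi.single i 1)

/-- The partial derivative `∂ᵢ` of a matrix over `ℂ{t, z]]`: entry by entry and coefficient by
coefficient. -/
def pdMat {m r : ℕ} (i : Fin m) (M : Base m → ZMat r) (t : Base m) : ZMat r :=
  Matrix.of fun a b => PowerSeries.mk fun n => pd i (fun s => PowerSeries.coeff n (M s a b)) t

/-- The derivative `∂_z` of a matrix of power series, entry by entry. -/
def dz {r : ℕ} (M : ZMat r) : ZMat r :=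
  M.map (PowerSeries.derivative ℂ)

/-- The coefficient `M^{(0)}` of `z⁰`. -/
def coeffZero {r : ℕ} (M : ZMat r) : Matrix (Fin r) (Fin r) ℂ :=
  M.map PowerSeries.constantCoeff

/-- A formal (TE)-structure of rank `r` over `(ℂ^m, 0)`, given by its connection form
`∑ z⁻¹ Aᵢ dtᵢ + z⁻² B dz`, with `Aᵢ`, `B` over `ℂ{t, z]]`, subject to flatness. -/
structure FormalTE (m r : ℕ) where
  A : Fin m → Base m → ZMat r
  B : Base m → ZMat r
  holoA : ∀ i, IsFormalHoloMat (A i)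
  holoB : IsFormalHoloMat B
  flatA : ∀ i j, ∀ᶠ t in 𝓝 (0 : Base m),
    z • pdMat i (A j) t - z • pdMat j (A i) t + (A i t * A j t - A j t * A i t) = 0
  flatB : ∀ i, ∀ᶠ t in 𝓝 (0 : Base m),
    z • pdMat i B t - z ^ 2 • dz (A i t) + z • A i t + (A i t * B t - B t * A i t) = 0

/-- The Higgs field `C_X = [z ∇_X]` on the restriction to `z = 0`, at the point `t`. -/
def higgs {m r : ℕ} (S : FormalTE m r) (t X : Base m) : Matrix (Fin r) (Fin r) ℂ :=
  ∑ i, X i • coeffZero (S.A i t)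

/-- The unfolding condition on the germ: there is a local primitive section `ζ`, i.e. a holomorphic
section for which `X ↦ C_X ζ` is an isomorphism near the origin. -/
def Unfolding {m r : ℕ} (S : FormalTE m r) : Prop :=
  ∃ ζ : Base m → Fin r → ℂ, AnalyticAt ℂ ζ 0 ∧
    ∀ᶠ t in 𝓝 (0 : Base m), Function.Bijective fun X : Base m => (higgs S t X).mulVec (ζ t)

/-- The multiplication of the F-manifold germ `𝒩₂` on each tangent space of `(ℂ², 0)`, in the
frame `∂₁, ∂₂`: `∂₁ ∘ ∂₁ = ∂₁`, `∂₁ ∘ ∂₂ = ∂₂ ∘ ∂₁ = ∂₂`, `∂₂ ∘ ∂₂ = 0`. -/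
def n2Mul (X Y : Base 2) : Base 2 := ![X 0 * Y 0, X 0 * Y 1 + X 1 * Y 0]

/-- The unit field `∂₁` of `𝒩₂`. -/
def n2Unit : Base 2 := ![1, 0]

/-- The structure lies over `𝒩₂`: it satisfies the unfolding condition and the multiplication and
unit field that it induces, `C_{X ∘ Y} = C_X C_Y` and `C_e = Id`, are those of `𝒩₂`. -/
def LiesOverN2 {r : ℕ} (S : FormalTE 2 r) : Prop :=
  Unfolding S ∧
    ∀ᶠ t in 𝓝 (0 : Base 2),
      (∀ X Y, higgs S t (n2Mul X Y) = higgs S t X * higgs S t Y) ∧ higgs S t n2Unit = 1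

/-- `h` represents a biholomorphic germ `(ℂ^m, 0) → (ℂ^m, 0)`. -/
def IsBiholoGerm {m : ℕ} (h : Base m → Base m) : Prop :=
  AnalyticAt ℂ h 0 ∧ h 0 = 0 ∧
    ∃ g : Base m → Base m, AnalyticAt ℂ g 0 ∧ g 0 = 0 ∧
      (∀ᶠ t in 𝓝 (0 : Base m), g (h t) = t) ∧ (∀ᶠ t in 𝓝 (0 : Base m), h (g t) = t)

/-- `T` is a formal isomorphism between `S` and `S'` which covers `h`. -/
structure IsFormalIso {m r : ℕ} (S S' : FormalTE m r) (h : Base m → Base m)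
    (T : Base m → ZMat r) : Prop where
  biholo : IsBiholoGerm h
  holo : IsFormalHoloMat T
  invertible : IsUnit (coeffZero (T 0))
  compatA : ∀ i, ∀ᶠ t in 𝓝 (0 : Base m),
    z • pdMat i (T ∘ h) t + (∑ j, k (pd i (fun s => h s j) t) • S.A j (h t)) * T (h t)
      - T (h t) * S'.A i t = 0
  compatB : ∀ᶠ t in 𝓝 (0 : Base m),
    z ^ 2 • dz (T (h t)) + S.B (h t) * T (h t) - T (h t) * S'.B t = 0

/-- Formally isomorphic formal (TE)-structures. -/
def FormallyIsomorphic {m r : ℕ} (S S' : FormalTE m r) : Prop :=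
  ∃ h T, IsFormalIso S S' h T

/-- `C₁ = Id`. -/
def C₁ : ZMat 2 := 1

/-- `C₂`, the lower triangular nilpotent matrix. -/
def C₂ : ZMat 2 := !![0, 0; 1, 0]

/-- `D = diag(1, -1)`. -/
def D : ZMat 2 := !![1, 0; 0, -1]

/-- `E`, the upper triangular nilpotent matrix. -/
def E : ZMat 2 := !![0, 1; 0, 0]

/-- The summand `(-t₁ + c + α z) C₁` common to all normal forms. -/
def scalarPart (c α : ℂ) (t : Base 2) : ZMat 2 := (k (-(t 0) + c) + k α * z) • C₁

/-- The list of normal forms, as triples `(A₁, A₂, B)`; here `t 0 = t₁` and `t 1 = t₂`.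
The cases `iii1`, …, `iii9` all have `A₁ = C₁` and `A₂ = C₂`. In `iii5`, `iii6`, `iii7` the integer
`λ ≥ 1` is `n`; in `iii8`, `iii9` the integer `λ ≤ -1` is `-n`. -/
inductive NormalForm : (Base 2 → ZMat 2) → (Base 2 → ZMat 2) → (Base 2 → ZMat 2) → Prop
  | i (c α c₀ : ℂ) :
      NormalForm (fun _ => C₁) (fun _ => C₂ + z • E) fun t =>
        scalarPart c α t + k (-(t 1) / 2 + c₀) • C₂ - (z * k (1 / 4)) • D
          + (z * k (-(t 1) / 2 + c₀)) • E
  | ii (c α : ℂ) (r : ℕ) (hr : 1 ≤ r) :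
      NormalForm (fun _ => C₁) (fun t => C₂ + (z * k (t 1 ^ r)) • E) fun t =>
        scalarPart c α t - k (t 1 / (r + 2)) • C₂ - (z * k ((r + 1) / (2 * (r + 2)))) • D
          - (z * k (t 1 ^ (r + 1) / (r + 2))) • E
  | iii1 (c α : ℂ) :
      NormalForm (fun _ => C₁) (fun _ => C₂) fun t =>
        scalarPart c α t - (z * k (1 / 2)) • D
  | iii2 (c α : ℂ) :
      NormalForm (fun _ => C₁) (fun _ => C₂) fun t =>
        scalarPart c α t + k (t 1 ^ 2) • C₂ - (z * k (t 1 + 1 / 2)) • D - z ^ 2 • E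
  | iii3 (c α lam : ℂ) (hlam : ∀ n : ℤ, n ≠ 0 → lam ≠ n) :
      NormalForm (fun _ => C₁) (fun _ => C₂) fun t =>
        scalarPart c α t + k (lam * t 1) • C₂ - (z * k ((lam + 1) / 2)) • D
  | iii4 (c α lam : ℂ) (hlam : ∀ n : ℤ, n ≠ 0 → lam ≠ n) :
      NormalForm (fun _ => C₁) (fun _ => C₂) fun t =>
        scalarPart c α t + k (lam * t 1 + 1) • C₂ - (z * k ((lam + 1) / 2)) • D
  | iii5 (c α γ : ℂ) (n : ℕ) (hn : 1 ≤ n) :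
      NormalForm (fun _ => C₁) (fun _ => C₂) fun t =>
        scalarPart c α t + (k (n * t 1 + 1) + k (γ * t 1 ^ 2) * z ^ n) • C₂
          - (z * k (1 / 2) * (k (n + 1) + k (2 * γ * t 1) * z ^ n)) • D
          - (k γ * z ^ (n + 2)) • E
  | iii6 (c α : ℂ) (n : ℕ) (hn : 1 ≤ n) :
      NormalForm (fun _ => C₁) (fun _ => C₂) fun t =>
        scalarPart c α t + (k (t 1) * (k n + k (t 1) * z ^ n)) • C₂
          - (z * k (1 / 2) * (k (n + 1) + k (2 * t 1) * z ^ n)) • D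
          - z ^ (n + 2) • E
  | iii7 (c α : ℂ) (n : ℕ) (hn : 1 ≤ n) :
      NormalForm (fun _ => C₁) (fun _ => C₂) fun t =>
        scalarPart c α t + k (t 1 * n) • C₂ - (z * k ((n + 1) / 2)) • D
  | iii8 (c α : ℂ) (n : ℕ) (hn : 1 ≤ n) :
      NormalForm (fun _ => C₁) (fun _ => C₂) fun t =>
        scalarPart c α t + (k (-n * t 1) + z ^ n) • C₂ - (z * k ((-n + 1) / 2)) • D
  | iii9 (c α : ℂ) (n : ℕ) (hn : 1 ≤ n) :
      NormalForm (fun _ => C₁) (fun _ => C₂) fun t =>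
        scalarPart c α t + k (-n * t 1) • C₂ - (z * k ((-n + 1) / 2)) • D

/-- A formal (TE)-structure in formal normal form. -/
def IsNormalForm (N : FormalTE 2 2) : Prop := NormalForm (N.A 0) (N.A 1) N.B

end TEStructure

end

/-! Reduction to one variable. The unfolding condition provides a vector e for which e, C_{∂₂}e is a
frame, so A₁ and A₂ may be assumed to begin with C₁ and C₂. Flatness forces the z-coefficient of A₁
to commute with C₂, and this allows it to be gauged away; the remaining part of A₁ - C₁ is O(z²) and
is removed by a linear equation solved order by order in z. Once A₁ = C₁, flatness says that A₂ and
B + t₁C₁ do not depend on t₁, and a problem in t = t₂ remains (`LiesOverN2.exists_hasForm`). A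
suitably scaled cyclic vector brings A₂ into the companion form C₂ + zfE. Then B is determined by a
scalar series s(z) and its lower left entry b, and flatness becomes the single equation f - z ∂_z f
+ f_t b + 2 f b_t = (z/2) b_ttt (`eq_companionB_of_isFlat`). A scalar gauge cuts s down to c + αz.

The pair (f, b) behaves like a projective connection together with a vector field: a coordinate
change h turns f into h'² f∘h - (z/2){h, t}, with {h, t} the Schwarzian derivative, and b into b∘h /
h' (`pullback_companion`). Let f₀ be the z⁰-coefficient of f.

If f₀ ≠ 0, it is a quadratic differential and becomes tʳ in a suitable coordinate. For r = 0 a gauge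
gives f = 1, the equation forces b = -t/2 + g(z), and g is reduced to its value at z = 0: form i.
For r ≥ 1 the leading term of b is forced to be -t/(r+2), and the pair can be gauged to (tʳ,
-t/(r+2)): form ii (`exists_gauge_of_coeff_zero_eq_pow`).

If f₀ = 0, a coordinate change kills the z-coefficient of f and a gauge kills the rest. Then b_ttt =
0, so b is quadratic in t with coefficients in ℂ⟦z⟧. Möbius transformations fixing 0 bring its
leading term to λt, 1 + λt or t², and further gauges remove all higher terms in z except those at
which an index n + 1 ± λ vanishes (`exists_gauge_linear`, `exists_gauge_square`). These resonances
are responsible for forms iii.5, 6 and 8.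

Equations in z are solved formally, as fixed points of z-adic contractions (`exists_fixedPoint`).
The coefficients stay holomorphic on a common neighbourhood because the work takes place over `Holo
U` for a fixed disc or bidisc U, on which primitives and solutions of κg + tg' = f exist without
shrinking U. Only the finitely many coordinate changes shrink the disc. -/

noncomputable section

namespace TEStructure

open TopologicalSpace (Opens)

/-! ### Rings of holomorphic functions and power series over them -/

section HoloRing

variable {V : Type*} [NormedAddCommGroup V] [NormedSpace ℂ V]

/-- The holomorphic functions on an open set, as a subalgebra of all functions. -/
def holoSubalgebra (U : Opens V) : Subalgebra ℂ (U → ℂ) where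
  carrier := {f | ∃ g : V → ℂ, AnalyticOnNhd ℂ g U ∧ ∀ x : U, f x = g x}
  mul_mem' := by
    rintro a b ⟨f, hf, hf'⟩ ⟨g, hg, hg'⟩
    exact ⟨fun x => f x * g x, hf.mul hg, fun x => by simp [hf', hg']⟩
  add_mem' := by
    rintro a b ⟨f, hf, hf'⟩ ⟨g, hg, hg'⟩
    exact ⟨fun x => f x + g x, hf.add hg, fun x => by simp [hf', hg']⟩
  algebraMap_mem' := fun r => ⟨fun _ => r, analyticOnNhd_const, fun x => rfl⟩

/-- The algebra of holomorphic functions on an open set. -/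
def Holo (U : Opens V) : Type _ := holoSubalgebra U

instance (U : Opens V) : CommRing (Holo U) := inferInstanceAs (CommRing (holoSubalgebra U))

instance (U : Opens V) : Algebra ℂ (Holo U) := inferInstanceAs (Algebra ℂ (holoSubalgebra U))

namespace Holo

variable {U : Opens V}

/-- The holomorphic function on `U` given by a function which is analytic on `U`. -/
def mk (g : V → ℂ) (hg : AnalyticOnNhd ℂ g U) : Holo U :=
  ⟨fun x => g x, g, hg, fun _ => rfl⟩

/-- Extension by zero. -/
def fn (f : Holo U) (x : V) : ℂ :=
  open scoped Classical in if h : x ∈ U then f.1 ⟨x, h⟩ else 0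

lemma fn_of_mem (f : Holo U) {x : V} (h : x ∈ U) : f.fn x = f.1 ⟨x, h⟩ := by
  simp [fn, h]

lemma fn_of_notMem (f : Holo U) {x : V} (h : x ∉ U) : f.fn x = 0 := by
  simp [fn, h]

lemma fn_mk (g : V → ℂ) (hg : AnalyticOnNhd ℂ g U) {x : V} (h : x ∈ U) :
    (mk g hg).fn x = g x := by
  rw [fn_of_mem _ h]; rfl

lemma analytic_fn (f : Holo U) : AnalyticOnNhd ℂ f.fn U := by
  obtain ⟨g, hg, h⟩ := f.2
  refine hg.congr U.isOpen fun x hx => ?_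
  rw [f.fn_of_mem hx, h]

lemma eq_of_fn {f g : Holo U} (h : ∀ x ∈ U, f.fn x = g.fn x) : f = g := by
  apply Subtype.ext
  funext x
  have := h x x.2
  rwa [f.fn_of_mem x.2, g.fn_of_mem x.2] at this

lemma fn_add (f g : Holo U) (x : V) : (f + g).fn x = f.fn x + g.fn x := by
  by_cases h : x ∈ U
  · simp only [fn_of_mem _ h]; rfl
  · simp [fn, h]

lemma fn_neg (f : Holo U) (x : V) : (-f).fn x = -f.fn x := by
  by_cases h : x ∈ U
  · simp only [fn_of_mem _ h]; rfl
  · simp [fn, h]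

lemma fn_sub (f g : Holo U) (x : V) : (f - g).fn x = f.fn x - g.fn x := by
  by_cases h : x ∈ U
  · simp only [fn_of_mem _ h]; rfl
  · simp [fn, h]

lemma fn_mul (f g : Holo U) (x : V) : (f * g).fn x = f.fn x * g.fn x := by
  by_cases h : x ∈ U
  · simp only [fn_of_mem _ h]; rfl
  · simp [fn, h]

lemma fn_smul (c : ℂ) (f : Holo U) (x : V) : (c • f).fn x = c * f.fn x := by
  by_cases h : x ∈ U
  · simp only [fn_of_mem _ h]; rfl
  · simp [fn, h]

lemma fn_one {x : V} (h : x ∈ U) : (1 : Holo U).fn x = 1 := by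
  rw [fn_of_mem _ h]; rfl

lemma fn_zero (x : V) : (0 : Holo U).fn x = 0 := by
  by_cases h : x ∈ U
  · simp only [fn_of_mem _ h]; rfl
  · simp [fn, h]

lemma fn_algebraMap (c : ℂ) {x : V} (h : x ∈ U) : (algebraMap ℂ (Holo U) c).fn x = c := by
  rw [fn_of_mem _ h]; rfl

lemma differentiableAt_fn (f : Holo U) {x : V} (hx : x ∈ U) : DifferentiableAt ℂ f.fn x :=
  (f.analytic_fn x hx).differentiableAt

/-- Evaluation at a point. -/
def eval (x : U) : Holo U →ₐ[ℂ] ℂ :=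
  (Pi.evalAlgHom ℂ (fun _ : U => ℂ) x).comp (holoSubalgebra U).val

lemma eval_eq_fn (f : Holo U) (x : U) : eval x f = f.fn x := by
  rw [fn_of_mem _ x.2]; rfl

lemma analyticOnNhd_fderiv_apply (f : Holo U) (v : V) :
    AnalyticOnNhd ℂ (fun x => fderiv ℂ f.fn x v) U := fun x hx =>
  ((ContinuousLinearMap.apply ℂ ℂ v).analyticAt _).comp (f.analytic_fn x hx).fderiv

/-- The directional derivative of holomorphic functions. -/
def pd (v : V) : Derivation ℂ (Holo U) (Holo U) :=
  Derivation.mk'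
    { toFun := fun f => mk (fun x => fderiv ℂ f.fn x v) (f.analyticOnNhd_fderiv_apply v)
      map_add' := fun f g => by
        refine eq_of_fn fun x hx => ?_
        rw [fn_add, fn_mk _ _ hx, fn_mk _ _ hx, fn_mk _ _ hx, funext (fn_add f g),
          fderiv_fun_add (f.differentiableAt_fn hx) (g.differentiableAt_fn hx)]
        rfl
      map_smul' := fun c f => by
        refine eq_of_fn fun x hx => ?_
        rw [RingHom.id_apply, fn_smul, fn_mk _ _ hx, fn_mk _ _ hx, funext (fn_smul c f),
          fderiv_const_mul (f.differentiableAt_fn hx)]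
        rfl }
    (fun f g => by
      refine eq_of_fn fun x hx => ?_
      simp only [LinearMap.coe_mk, AddHom.coe_mk, smul_eq_mul]
      rw [fn_mk _ _ hx, funext (fn_mul f g), fderiv_fun_mul (f.differentiableAt_fn hx)
        (g.differentiableAt_fn hx), fn_add, fn_mul, fn_mul, fn_mk _ _ hx, fn_mk _ _ hx]
      simp)

lemma fn_pd (v : V) (f : Holo U) {x : V} (hx : x ∈ U) :
    (pd v f).fn x = fderiv ℂ f.fn x v :=
  fn_mk (fun x => fderiv ℂ f.fn x v) (f.analyticOnNhd_fderiv_apply v) hx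

lemma pd_comm (v w : V) (f : Holo U) : pd v (pd w f) = pd w (pd v f) := by
  have key : ∀ v w : V, ∀ x ∈ U, (pd v (pd w f)).fn x = fderiv ℂ (fderiv ℂ f.fn) x v w := by
    intro v w x hx
    rw [fn_pd _ _ hx]
    have h : (pd w f).fn =ᶠ[𝓝 x] fun y => fderiv ℂ f.fn y w := by
      filter_upwards [U.isOpen.mem_nhds hx] with y hy using fn_pd _ _ hy
    rw [h.fderiv_eq, fderiv_clm_apply ((f.analytic_fn x hx).fderiv.differentiableAt)
      (differentiableAt_const _)]
    simp
  apply eq_of_fn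
  intro x hx
  rw [key v w x hx, key w v x hx]
  have : IsSymmSndFDerivAt ℂ f.fn x :=
    ContDiffAt.isSymmSndFDerivAt (n := ⊤) (f.analytic_fn x hx).contDiffAt (by simp)
  exact this v w

lemma analyticOnNhd_exp_fn (f : Holo U) : AnalyticOnNhd ℂ (fun x => Complex.exp (f.fn x)) U :=
  f.analytic_fn.cexp

/-- Postcomposition with the exponential function. -/
def exp (f : Holo U) : Holo U :=
  mk (fun x => Complex.exp (f.fn x)) f.analyticOnNhd_exp_fn

lemma exp_mul_exp_neg (f : Holo U) : exp f * exp (-f) = 1 := by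
  apply eq_of_fn
  intro x hx
  rw [fn_mul, fn_one hx, exp, exp, fn_mk _ _ hx, fn_mk _ _ hx, fn_neg, ← Complex.exp_add]
  simp

lemma isUnit_exp (f : Holo U) : IsUnit (exp f) := .of_mul_eq_one _ (exp_mul_exp_neg f)

lemma pd_exp (v : V) (f : Holo U) : pd v (exp f) = pd v f * exp f := by
  apply eq_of_fn
  intro x hx
  have h : (exp f).fn =ᶠ[𝓝 x] fun y => Complex.exp (f.fn y) := by
    filter_upwards [U.isOpen.mem_nhds hx] with y hy using fn_mk _ _ hy
  rw [fn_pd _ _ hx, h.fderiv_eq, fn_mul, fn_pd _ _ hx, exp, fn_mk _ _ hx,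
    ((f.differentiableAt_fn hx).hasFDerivAt.cexp).fderiv]
  simp [mul_comm]

lemma analyticOnNhd_fn_comp {V' : Type*} [NormedAddCommGroup V'] [NormedSpace ℂ V'] {U' : Opens V'}
    {h : V' → V} (hh : AnalyticOnNhd ℂ h U') (hU : ∀ x ∈ U', h x ∈ U) (f : Holo U) :
    AnalyticOnNhd ℂ (fun x => f.fn (h x)) U' := fun x hx =>
  (f.analytic_fn _ (hU x hx)).comp (hh x hx)

/-- Composition with a holomorphic map. -/
def comp {V' : Type*} [NormedAddCommGroup V'] [NormedSpace ℂ V'] {U' : Opens V'} (h : V' → V)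
    (hh : AnalyticOnNhd ℂ h U') (hU : ∀ x ∈ U', h x ∈ U) : Holo U →ₐ[ℂ] Holo U' where
  toFun f := mk (fun x => f.fn (h x)) (analyticOnNhd_fn_comp hh hU f)
  map_one' := eq_of_fn fun x hx => by rw [fn_mk _ _ hx, fn_one hx, fn_one (hU x hx)]
  map_zero' := eq_of_fn fun x hx => by rw [fn_mk _ _ hx, fn_zero, fn_zero]
  map_mul' f g := eq_of_fn fun x hx => by
    rw [fn_mk _ _ hx, fn_mul, fn_mul, fn_mk _ _ hx, fn_mk _ _ hx]
  map_add' f g := eq_of_fn fun x hx => by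
    rw [fn_mk _ _ hx, fn_add, fn_add, fn_mk _ _ hx, fn_mk _ _ hx]
  commutes' c := eq_of_fn fun x hx => by
    rw [fn_mk _ _ hx, fn_algebraMap c hx, fn_algebraMap c (hU x hx)]

section

variable {V' : Type*} [NormedAddCommGroup V'] [NormedSpace ℂ V'] {U' : Opens V'} {h : V' → V}
  (hh : AnalyticOnNhd ℂ h U') (hU : ∀ x ∈ U', h x ∈ U)

lemma fn_comp (f : Holo U) {x : V'} (hx : x ∈ U') : (comp h hh hU f).fn x = f.fn (h x) :=
  fn_mk (fun x => f.fn (h x)) (analyticOnNhd_fn_comp hh hU f) hx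

lemma fn_pd_comp (f : Holo U) (v : V') {x : V'} (hx : x ∈ U') :
    (pd v (comp h hh hU f)).fn x = fderiv ℂ f.fn (h x) (fderiv ℂ h x v) := by
  have e : (comp h hh hU f).fn =ᶠ[𝓝 x] f.fn ∘ h := by
    filter_upwards [U'.isOpen.mem_nhds hx] with y hy using fn_comp hh hU f hy
  rw [fn_pd _ _ hx, e.fderiv_eq, fderiv_comp _ (f.differentiableAt_fn (hU x hx))
    (hh x hx).differentiableAt]
  rfl

end

lemma isUnit_of_ne_zero (f : Holo U) (h : ∀ x ∈ U, f.fn x ≠ 0) : IsUnit f := by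
  have hi : AnalyticOnNhd ℂ (fun x => (f.fn x)⁻¹) U := f.analytic_fn.inv h
  refine .of_mul_eq_one (mk _ hi) ?_
  apply eq_of_fn
  intro x hx
  rw [fn_mul, fn_mk _ _ hx, fn_one hx, mul_inv_cancel₀ (h x hx)]

end Holo

end HoloRing

section LiftDerivation

open PowerSeries

variable {R : Type*} [CommRing R] [Algebra ℂ R]

/-- The coefficientwise extension of a derivation to power series. -/
def liftD (d : Derivation ℂ R R) : Derivation ℂ R⟦X⟧ R⟦X⟧ :=
  Derivation.mk'
    { toFun := fun f => PowerSeries.mk fun n => d (coeff n f)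
      map_add' := fun f g => by ext n; simp
      map_smul' := fun c f => by ext n; simp }
    (fun f g => by
      ext n
      simp only [LinearMap.coe_mk, AddHom.coe_mk, coeff_mk, smul_eq_mul, map_add, coeff_mul,
        map_sum, Derivation.leibniz]
      rw [Finset.sum_add_distrib]
      congr 1
      rw [← Finset.Nat.sum_antidiagonal_swap]
      rfl)

@[simp] lemma coeff_liftD (d : Derivation ℂ R R) (f : R⟦X⟧) (n : ℕ) :
    coeff n (liftD d f) = d (coeff n f) := by
  simp [liftD]

@[simp] lemma liftD_X (d : Derivation ℂ R R) : liftD d (X : R⟦X⟧) = 0 := by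
  ext n
  rw [coeff_liftD, coeff_X]
  split_ifs <;> simp

@[simp] lemma liftD_C (d : Derivation ℂ R R) (r : R) : liftD d (C r) = C (d r) := by
  ext n
  rw [coeff_liftD, coeff_C, coeff_C]
  split_ifs <;> simp

lemma liftD_derivative (d : Derivation ℂ R R) (f : R⟦X⟧) :
    liftD d (derivative R f) = derivative R (liftD d f) := by
  ext n
  have : d ((n : R) + 1) = 0 := by simp
  simp [coeff_derivative, this, mul_comm]

lemma liftD_X_mul (d : Derivation ℂ R R) (f : R⟦X⟧) : liftD d (X * f) = X * liftD d f := by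
  simp

lemma liftD_comm {d d' : Derivation ℂ R R} (h : ∀ r, d (d' r) = d' (d r)) (f : R⟦X⟧) :
    liftD d (liftD d' f) = liftD d' (liftD d f) := by
  ext n
  simp [h]

end LiftDerivation

end TEStructure

end

noncomputable section

namespace TEStructure

open TopologicalSpace (Opens)

/-! ### Existence and uniqueness by z-adic contraction -/

section FixedPoint

open PowerSeries

variable {R : Type*} [CommRing R]

/-- Two power series agree modulo `X ^ k`. -/
def Cong (k : ℕ) (x y : R⟦X⟧) : Prop := ∀ n < k, coeff n x = coeff n y

lemma Cong.refl (k : ℕ) (x : R⟦X⟧) : Cong k x x := fun _ _ => rfl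

lemma Cong.add {k : ℕ} {x x' y y' : R⟦X⟧} (h : Cong k x x') (h' : Cong k y y') :
    Cong k (x + y) (x' + y') := fun n hn => by
  rw [map_add, map_add, h n hn, h' n hn]

lemma Cong.sub {k : ℕ} {x x' y y' : R⟦X⟧} (h : Cong k x x') (h' : Cong k y y') :
    Cong k (x - y) (x' - y') := fun n hn => by
  rw [map_sub, map_sub, h n hn, h' n hn]

lemma Cong.neg {k : ℕ} {x x' : R⟦X⟧} (h : Cong k x x') : Cong k (-x) (-x') := fun n hn => by
  rw [map_neg, map_neg, h n hn]

lemma Cong.mul {k : ℕ} {x x' y y' : R⟦X⟧} (h : Cong k x x') (h' : Cong k y y') :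
    Cong k (x * y) (x' * y') := fun n hn => by
  rw [coeff_mul, coeff_mul]
  refine Finset.sum_congr rfl fun p hp => ?_
  have := Finset.HasAntidiagonal.mem_antidiagonal.1 hp
  rw [h _ (by omega), h' _ (by omega)]

lemma Cong.const_mul {k : ℕ} {y y' : R⟦X⟧} (x : R⟦X⟧) (h : Cong k y y') :
    Cong k (x * y) (x * y') := (Cong.refl k x).mul h

lemma Cong.X_mul {k : ℕ} {x x' : R⟦X⟧} (h : Cong k x x') : Cong (k + 1) (X * x) (X * x') := by
  rintro (_ | n) hn
  · simp
  · rw [coeff_succ_X_mul, coeff_succ_X_mul, h n (by omega)]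

/-- A coefficientwise operator on power series. -/
def coeffwise {S : Type*} [CommRing S] (φ : ℕ → R → S) (x : R⟦X⟧) : S⟦X⟧ :=
  PowerSeries.mk fun n => φ n (coeff n x)

@[simp] lemma coeff_coeffwise {S : Type*} [CommRing S] (φ : ℕ → R → S) (x : R⟦X⟧) (n : ℕ) :
    coeff n (coeffwise φ x) = φ n (coeff n x) := coeff_mk _ _

/-- No order in X is lost, so primitives in t and divisions by the degree in z may enter a
fixed-point equation freely; contraction has to come from an explicit factor X. -/
lemma Cong.coeffwise {k : ℕ} {x x' : R⟦X⟧} {S : Type*} [CommRing S] (φ : ℕ → R → S)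
    (h : Cong k x x') : Cong k (coeffwise φ x) (TEStructure.coeffwise φ x') := fun n hn => by
  rw [coeff_coeffwise, coeff_coeffwise, h n hn]

lemma Cong.liftD [Algebra ℂ R] {k : ℕ} {x x' : R⟦X⟧} (d : Derivation ℂ R R) (h : Cong k x x') :
    Cong k (liftD d x) (TEStructure.liftD d x') := fun n hn => by
  rw [coeff_liftD, coeff_liftD, h n hn]

/-- An `X`-adic contraction on a power of `R⟦X⟧` has a fixed point. -/
theorem exists_fixedPoint {ι : Type*} (Φ : (ι → R⟦X⟧) → ι → R⟦X⟧)
    (hΦ : ∀ k u v, (∀ i, Cong k (u i) (v i)) → ∀ i, Cong (k + 1) (Φ u i) (Φ v i)) :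
    ∃ u, Φ u = u := by
  let u : ℕ → ι → R⟦X⟧ := fun k => Φ^[k] 0
  have hu : ∀ k, u (k + 1) = Φ (u k) := fun k => Function.iterate_succ_apply' _ _ _
  have hstep : ∀ k i, Cong k (u k i) (u (k + 1) i) := by
    intro k
    induction k with
    | zero => exact fun i n hn => absurd hn (by omega)
    | succ k ih => rw [hu (k + 1), hu k]; exact hΦ k _ _ (hu k ▸ ih)
  have hstab : ∀ n m, n < m → ∀ i, coeff n (u m i) = coeff n (u (n + 1) i) := by
    intro n m hm i
    induction m, hm using Nat.le_induction with
    | base => rfl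
    | succ m hm ih => exact (hstep m i n hm).symm.trans ih
  -- Coefficient n is stable from iterate n + 1 onwards, hence the shift by one.
  let x : ι → R⟦X⟧ := fun i => PowerSeries.mk fun n => coeff n (u (n + 1) i)
  have hx : ∀ k i, Cong k (x i) (u k i) := fun k i n hn => by
    rw [coeff_mk]; exact (hstab n k hn i).symm
  refine ⟨x, funext fun i => ?_⟩
  ext n
  have := hΦ n x (u n) (hx n) i n (by omega)
  rw [← hu] at this
  rw [coeff_mk]; exact this

theorem exists_fixedPoint_single (Φ : R⟦X⟧ → R⟦X⟧)
    (h : ∀ k x x', Cong k x x' → Cong (k + 1) (Φ x) (Φ x')) : ∃ x, Φ x = x := by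
  obtain ⟨u, hu⟩ := exists_fixedPoint (fun u (_ : Unit) => Φ (u ()))
    (fun k u v huv _ => h k _ _ (huv ()))
  exact ⟨u (), congrFun hu ()⟩

theorem exists_fixedPoint_pair (Φ₁ Φ₂ : R⟦X⟧ → R⟦X⟧ → R⟦X⟧)
    (h₁ : ∀ k x x' y y', Cong k x x' → Cong k y y' → Cong (k + 1) (Φ₁ x y) (Φ₁ x' y'))
    (h₂ : ∀ k x x' y y', Cong k x x' → Cong k y y' → Cong (k + 1) (Φ₂ x y) (Φ₂ x' y')) :
    ∃ x y, Φ₁ x y = x ∧ Φ₂ x y = y := by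
  obtain ⟨u, hu⟩ := exists_fixedPoint
    (fun u (i : Bool) => if i then Φ₁ (u true) (u false) else Φ₂ (u true) (u false))
    (by
      rintro k u v huv (_ | _)
      · exact h₂ k _ _ _ _ (huv _) (huv _)
      · exact h₁ k _ _ _ _ (huv _) (huv _))
  exact ⟨u true, u false, congrFun hu true, congrFun hu false⟩

/-- The uniqueness counterpart of the fixed-point theorem. The starting order m allows for
recursions that determine a coefficient only from a certain degree on. -/
lemma eq_zero_of_cong {x : R⟦X⟧} (m : ℕ) (h₀ : Cong m x 0)
    (h : ∀ k, m ≤ k → Cong k x 0 → coeff k x = 0) : x = 0 := by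
  have : ∀ k, Cong (m + k) x 0 := by
    intro k
    induction k with
    | zero => exact h₀
    | succ k ih =>
      intro n hn
      rcases Nat.lt_succ_iff_lt_or_eq.1 hn with hn | rfl
      · exact ih n hn
      · exact (h (m + k) (by omega) ih).trans (map_zero _).symm
  ext n
  exact this (n + 1) n (by omega)

end FixedPoint

/-! ### Flatness, frame changes and the companion form in one variable -/

section Gauge

open PowerSeries Matrix

variable {R : Type*} [CommRing R] [Algebra ℂ R]

lemma map_derivation_mul {S P n : Type*} [Fintype n] [CommRing S] [CommRing P] [Algebra S P]
    (D : Derivation S P P) (M N : Matrix n n P) :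
    (M * N).map D = M.map D * N + M * N.map D := by
  ext i j
  simp only [Matrix.map_apply, Matrix.mul_apply, map_sum, Derivation.leibniz, smul_eq_mul,
    Matrix.add_apply, Finset.sum_add_distrib]
  rw [add_comm]
  congr 1
  exact Finset.sum_congr rfl fun k _ => mul_comm _ _

/-- Flatness of `z⁻¹ A dt + z⁻² B dz` in the direction of the derivation `d`. -/
def IsFlat (d : Derivation ℂ R R) (A B : Matrix (Fin 2) (Fin 2) R⟦X⟧) : Prop :=
  (X : R⟦X⟧) • B.map (liftD d) - (X : R⟦X⟧) ^ 2 • A.map (derivative R) + (X : R⟦X⟧) • A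
    + (A * B - B * A) = 0

/-- `T` transforms the connection matrix `A` in the direction of `d` into `A'`. -/
def IsGauge (d : Derivation ℂ R R) (T A A' : Matrix (Fin 2) (Fin 2) R⟦X⟧) : Prop :=
  (X : R⟦X⟧) • T.map (liftD d) + A * T = T * A'

/-- `T` transforms the connection matrix `B` in the direction of `z` into `B'`. -/
def IsZGauge (T B B' : Matrix (Fin 2) (Fin 2) R⟦X⟧) : Prop :=
  (X : R⟦X⟧) ^ 2 • T.map (derivative R) + B * T = T * B'

lemma map_derivation_smul {S P n : Type*} [CommRing S] [CommRing P] [Algebra S P]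
    (D : Derivation S P P) (x : P) (M : Matrix n n P) :
    (x • M).map D = D x • M + x • M.map D := by
  ext i j
  simp [add_comm, mul_comm]

lemma map_derivation_add {S P n : Type*} [CommRing S] [CommRing P] [Algebra S P]
    (D : Derivation S P P) (M N : Matrix n n P) :
    (M + N).map D = M.map D + N.map D := by
  ext i j
  simp

lemma map_derivation_sub {S P n : Type*} [CommRing S] [CommRing P] [Algebra S P]
    (D : Derivation S P P) (M N : Matrix n n P) :
    (M - N).map D = M.map D - N.map D := by
  ext i j
  simp

lemma eq_zero_of_mul_eq_zero {P : Type*} [CommRing P] {T M : Matrix (Fin 2) (Fin 2) P}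
    (hT : IsUnit T.det) (h : T * M = 0) : M = 0 := by
  have := (Matrix.isUnit_iff_isUnit_det T).2 hT
  exact this.mul_right_eq_zero.1 h

/-- Curvature transforms by conjugation: T times the new curvature equals the old one times T. This
results from differentiating each gauge equation in the direction of the other and cancelling the
mixed derivative of T. -/
theorem IsFlat.gauge {d : Derivation ℂ R R} {T A A' B B' : Matrix (Fin 2) (Fin 2) R⟦X⟧}
    (hT : IsUnit T.det) (hA : IsGauge d T A A') (hB : IsZGauge T B B') (h : IsFlat d A B) :
    IsFlat d A' B' := by
  refine eq_zero_of_mul_eq_zero hT ?_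
  have e1 := congrArg (fun M => (X : R⟦X⟧) • M.map (liftD d)) hB
  have e2 := congrArg (fun M => (X : R⟦X⟧) ^ 2 • M.map (derivative R)) hA
  have hc : (T.map (derivative R)).map (liftD d) = (T.map (liftD d)).map (derivative R) := by
    ext1 i j; simp [liftD_derivative]
  have hX : (derivative R) (X : R⟦X⟧) = 1 := by simp [derivative_X]
  simp only [map_derivation_add, map_derivation_mul, map_derivation_smul, hc, hX, liftD_X,
    Derivation.leibniz_pow, smul_zero, zero_smul, zero_add, one_smul, smul_add] at e1 e2
  unfold IsFlat at h
  unfold IsGauge at hA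
  unfold IsZGauge at hB
  generalize T.map (derivative R) = T2 at *
  generalize T.map (liftD d) = T1 at *
  generalize B.map (liftD d) = B1 at *
  generalize B'.map (liftD d) = B1' at *
  generalize A.map (derivative R) = A2 at *
  generalize A'.map (derivative R) = A2' at *
  generalize T1.map (derivative R) = T3 at *
  have h' := congrArg (· * T) h
  have p1 := congrArg (· * B') hA
  have p2 := congrArg (· * A') hB
  have p3 := congrArg (A * ·) hB
  have p4 := congrArg (B * ·) hA
  have p5 := congrArg ((X : R⟦X⟧) • ·) hA
  simp only [mul_add, add_mul, sub_mul, mul_sub, smul_add, smul_smul, smul_mul_assoc,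
    mul_smul_comm, ← mul_assoc, zero_mul, ← pow_succ', ← pow_succ, ← pow_two] at *
  linear_combination (norm := abel) h' - e1 + e2 - p1 + p2 - p5 - p3 + p4

/-- By the chain rule every term of the new flatness equation is h₁ times the image of the old one;
since h₁ is free of z, the z-derivative produces nothing further. -/
theorem IsFlat.pullback {R' : Type*} [CommRing R'] [Algebra ℂ R'] {d : Derivation ℂ R R}
    {d' : Derivation ℂ R' R'} (σ : R →ₐ[ℂ] R') (h₁ : R') (hσ : ∀ r, d' (σ r) = h₁ * σ (d r))
    {A B : Matrix (Fin 2) (Fin 2) R⟦X⟧} (h : IsFlat d A B) :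
    IsFlat d' ((C h₁ : R'⟦X⟧) • A.map (PowerSeries.map (σ : R →+* R')))
      (B.map (PowerSeries.map (σ : R →+* R'))) := by
  set μ := PowerSeries.map (σ : R →+* R') with hμ
  have k1 : ∀ x, liftD d' (μ x) = C h₁ * μ (liftD d x) := fun x => by
    ext n; simp [hμ, hσ]
  have k2 : ∀ x, derivative R' (μ x) = μ (derivative R x) := fun x => by
    ext n; simp [hμ, coeff_derivative]
  have k3 : μ X = X := by simp [hμ]
  unfold IsFlat at *
  have h' := congrArg (fun M => (C h₁ : R'⟦X⟧) • M.map μ) h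
  ext1 i j
  have := congrFun (congrFun h' i) j
  simp only [Matrix.smul_apply, Matrix.map_apply, Matrix.add_apply, Matrix.sub_apply, smul_eq_mul,
    map_add, map_sub, map_mul, map_pow, k3, Matrix.zero_apply, map_zero, Matrix.mul_apply,
    Fin.sum_univ_two, k1, k2, Derivation.leibniz, derivative_C, mul_zero, add_zero] at this ⊢
  linear_combination this

/-- The matrix `C₂ + z f E`. -/
def companionA (f : R⟦X⟧) : Matrix (Fin 2) (Fin 2) R⟦X⟧ := !![0, X * f; 1, 0]

/-- The inverse of two. -/
def half (R : Type*) [CommRing R] [Algebra ℂ R] : R⟦X⟧ := algebraMap ℂ R⟦X⟧ (1 / 2)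

lemma two_mul_half : 2 * half R = 1 := by
  rw [half, ← map_ofNat (algebraMap ℂ R⟦X⟧) 2, ← map_mul]
  norm_num

lemma half_eq_C : half R = C (algebraMap ℂ R (1 / 2)) := by
  rw [half, PowerSeries.algebraMap_apply]

@[simp] lemma liftD_half (d : Derivation ℂ R R) : liftD d (half R) = 0 := by
  simp [half]

@[simp] lemma liftD_two (d : Derivation ℂ R R) : liftD d 2 = 0 := by
  simpa using (liftD d).map_natCast 2

/-- The diagonal entry of the matrix `B` which is determined by its lower left entry `b`. -/
def diagB (d : Derivation ℂ R R) (b : R⟦X⟧) : R⟦X⟧ := -(half R * X * (liftD d b + 1))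

/-- The matrix `B` with trace `2 s` and lower left entry `b` accompanying `companionA f`. -/
def companionB (d : Derivation ℂ R R) (s f b : R⟦X⟧) : Matrix (Fin 2) (Fin 2) R⟦X⟧ :=
  !![s + diagB d b, X * (liftD d (diagB d b) + f * b); b, s - diagB d b]

/-- The flatness condition in terms of `f` and `b`. -/
def IsCompatible (d : Derivation ℂ R R) (f b : R⟦X⟧) : Prop :=
  f - X * derivative R f + liftD d f * b + 2 * f * liftD d b
    = half R * X * liftD d (liftD d (liftD d b))

lemma liftD_diagB (d : Derivation ℂ R R) (b : R⟦X⟧) :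
    liftD d (diagB d b) = -(half R * X * liftD d (liftD d b)) := by
  simp only [diagB, map_neg, Derivation.leibniz, map_add, Derivation.map_one_eq_zero, liftD_X,
    liftD_half, smul_eq_mul]
  ring

lemma X_mul_cancel {R : Type*} [CommRing R] {x y : R⟦X⟧} (h : X * x = X * y) : x = y := by
  ext n
  rw [← coeff_succ_X_mul, h, coeff_succ_X_mul]

/-- Three of the four entries of the flatness equation hold by the choice of `companionB`; the upper
right one is z² times `IsCompatible`. -/
theorem isFlat_companion {d : Derivation ℂ R R} {s f b : R⟦X⟧} (hs : liftD d s = 0)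
    (h : IsCompatible d f b) : IsFlat d (companionA f) (companionB d s f b) := by
  have h2 := two_mul_half (R := R)
  have hd : diagB d b = -(half R * X * (liftD d b + 1)) := rfl
  unfold IsCompatible at h
  rw [IsFlat, companionA, companionB, liftD_diagB]
  ext1 i j
  fin_cases i <;> fin_cases j <;> simp [hs, liftD_diagB]
  · ring
  · rw [hd]; linear_combination X ^ 2 * h + X ^ 2 * f * (liftD d b + 1) * h2
  · rw [hd]; linear_combination -(X * (liftD d b + 1)) * h2
  · ring

/-- The lower left entry of the flatness equation gives the difference of the diagonal entries of B
in terms of b, the upper left entry then gives the upper right entry of B, and the trace is killed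
by d. What remains is divisible by z² and yields `IsCompatible`. -/
theorem eq_companionB_of_isFlat {d : Derivation ℂ R R} {f : R⟦X⟧}
    {B : Matrix (Fin 2) (Fin 2) R⟦X⟧} (h : IsFlat d (companionA f) B) :
    ∃ s b, liftD d s = 0 ∧ IsCompatible d f b ∧ B = companionB d s f b := by
  have h2 := two_mul_half (R := R)
  obtain ⟨p, q, b, r, rfl⟩ : ∃ p q b r, B = !![p, q; b, r] := ⟨_, _, _, _, Matrix.eta_fin_two B⟩
  rw [IsFlat, companionA] at h
  have h00 := congrFun (congrFun h 0) 0
  have h01 := congrFun (congrFun h 0) 1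
  have h10 := congrFun (congrFun h 1) 0
  have h11 := congrFun (congrFun h 1) 1
  simp at h00 h01 h10 h11
  have hs : liftD d (half R * (p + r)) = 0 := by
    simp only [Derivation.leibniz, map_add, smul_eq_mul, liftD_half]
    apply X_mul_cancel
    linear_combination half R * (h00 + h11)
  have e1 : p = half R * (p + r) + diagB d b := by
    unfold diagB
    linear_combination -p * h2 + half R * h10
  have e2 : r = half R * (p + r) - diagB d b := by
    unfold diagB
    linear_combination -r * h2 - half R * h10
  have e3 : q = X * (liftD d (diagB d b) + f * b) := by
    have := congrArg (liftD d) e1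
    rw [map_add, hs, zero_add] at this
    rw [← this]
    linear_combination -h00
  refine ⟨half R * (p + r), b, hs, ?_, ?_⟩
  · rw [e3] at h01
    rw [liftD_diagB] at h01
    unfold IsCompatible
    apply X_mul_cancel
    apply X_mul_cancel
    simp at h01
    linear_combination h01 + X * f * h10
  · rw [companionB, ← e1, ← e2, ← e3]

end Gauge

end TEStructure

end

noncomputable section

namespace TEStructure

open TopologicalSpace (Opens)

/-! ### Gauge transformations between companion forms -/

section ScalarGauge

open PowerSeries Matrix

variable {R : Type*} [CommRing R] [Algebra ℂ R]

/-- The general form of a matrix which transforms `companionA f` into another companion matrix. -/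
def gaugeT (d : Derivation ℂ R R) (f a c : R⟦X⟧) : Matrix (Fin 2) (Fin 2) R⟦X⟧ :=
  !![a, X * (liftD d a + f * c); c, a + X * liftD d c]

/-- The first column of the gauge equation says that the second column of T is the covariant
derivative of the first, which is built into `gaugeT`. The two hypotheses are the entries of the
second column. -/
lemma isGauge_gaugeT {d : Derivation ℂ R R} {f f' a c : R⟦X⟧}
    (h₁ : 2 * liftD d a = (f' - f) * c - X * liftD d (liftD d c))
    (h₂ : (f' - f) * a = X * (liftD d (liftD d a) + liftD d (f * c) + f * liftD d c)) :
    IsGauge d (gaugeT d f a c) (companionA f) (companionA f') := by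
  rw [IsGauge, gaugeT, companionA, companionA]
  simp only [Derivation.leibniz, smul_eq_mul] at h₂
  ext1 i j
  fin_cases i <;> fin_cases j <;> simp
  · ring
  · linear_combination -X * h₂
  · ring
  · linear_combination X * h₁

lemma isUnit_det_gaugeT {d : Derivation ℂ R R} {f a c : R⟦X⟧} (ha : coeff 0 a = 1) :
    IsUnit (gaugeT d f a c).det := by
  rw [PowerSeries.isUnit_iff_constantCoeff, gaugeT, Matrix.det_fin_two_of]
  rw [coeff_zero_eq_constantCoeff_apply] at ha
  simp [ha]

/-- A transformation between companion matrices extends to the matrices `B`. -/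
theorem exists_companionB_of_isGauge {d : Derivation ℂ R R} {f f' s b : R⟦X⟧}
    {T : Matrix (Fin 2) (Fin 2) R⟦X⟧} (hs : liftD d s = 0) (h : IsCompatible d f b)
    (hT : IsUnit T.det) (hA : IsGauge d T (companionA f) (companionA f')) :
    ∃ s' b', liftD d s' = 0 ∧ IsCompatible d f' b' ∧
      IsZGauge T (companionB d s f b) (companionB d s' f' b') := by
  have hB : IsZGauge T (companionB d s f b)
      (T⁻¹ * ((X : R⟦X⟧) ^ 2 • T.map (derivative R) + companionB d s f b * T)) := by
    rw [IsZGauge, ← mul_assoc, Matrix.mul_nonsing_inv _ hT, one_mul]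
  obtain ⟨s', b', hs', hb', e⟩ :=
    eq_companionB_of_isFlat (IsFlat.gauge hT hA hB (isFlat_companion hs h))
  exact ⟨s', b', hs', hb', e ▸ hB⟩

/-- At z = 0 the matrices B are s + bC₂ and T is 1 + cC₂, and these commute. Hence only a change of
coordinate can alter the leading term of b. -/
lemma coeff_zero_eq_of_isZGauge {d : Derivation ℂ R R} {f f' s s' b b' a c : R⟦X⟧}
    (ha : coeff 0 a = 1)
    (h : IsZGauge (gaugeT d f a c) (companionB d s f b) (companionB d s' f' b')) :
    coeff 0 b = coeff 0 b' := by
  have h00 := congrArg (coeff 0) (congrFun (congrFun h 0) 0)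
  have h10 := congrArg (coeff 0) (congrFun (congrFun h 1) 0)
  rw [coeff_zero_eq_constantCoeff_apply] at ha
  simp [gaugeT, companionB, diagB, ha] at h00 h10
  rw [coeff_zero_eq_constantCoeff_apply, coeff_zero_eq_constantCoeff_apply]
  linear_combination h10 - constantCoeff c * h00

/-- The defects `Y`, `Z` of `T` in being a transformation in the two directions are related. -/
theorem defect_relation {d : Derivation ℂ R R} {T A A' B B' Y Z : Matrix (Fin 2) (Fin 2) R⟦X⟧}
    (h : IsFlat d A B) (h' : IsFlat d A' B')
    (hY : (X : R⟦X⟧) • T.map (liftD d) + A * T - T * A' = Y)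
    (hZ : (X : R⟦X⟧) ^ 2 • T.map (derivative R) + B * T - T * B' = Z) :
    (X : R⟦X⟧) • Z.map (liftD d) + A * Z - Z * A'
      = (X : R⟦X⟧) ^ 2 • Y.map (derivative R) + B * Y - Y * B' - (X : R⟦X⟧) • Y := by
  have hc : (T.map (derivative R)).map (liftD d) = (T.map (liftD d)).map (derivative R) := by
    ext1 i j; simp [liftD_derivative]
  have hX : (derivative R) (X : R⟦X⟧) = 1 := by simp [derivative_X]
  subst hY hZ
  simp only [map_derivation_sub, map_derivation_add, map_derivation_mul, map_derivation_smul, hc, hX, liftD_X,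
    Derivation.leibniz_pow, smul_zero, zero_smul, zero_add, one_smul]
  unfold IsFlat at h h'
  generalize T.map (derivative R) = T2 at *
  generalize T.map (liftD d) = T1 at *
  generalize B.map (liftD d) = B1 at *
  generalize B'.map (liftD d) = B1' at *
  generalize A.map (derivative R) = A2 at *
  generalize A'.map (derivative R) = A2' at *
  generalize T1.map (derivative R) = T3 at *
  -- After cancellation of the mixed derivatives, both sides differ by the flatness of (A, B) times
  -- T minus T times the flatness of (A', B').
  have p := congrArg (· * T) h
  have p' := congrArg (T * ·) h'
  simp only [mul_add, add_mul, sub_mul, mul_sub, smul_add, smul_sub, smul_smul, smul_mul_assoc,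
    mul_smul_comm, ← mul_assoc, zero_mul, mul_zero, ← pow_succ', ← pow_succ, ← pow_two] at p p' ⊢
  linear_combination (norm := abel) p - p'

end ScalarGauge

/-! ### Changes of the coordinate t₂ -/

section Pullback

open PowerSeries Matrix

variable {R R' : Type*} [CommRing R] [Algebra ℂ R] [CommRing R'] [Algebra ℂ R']

/-- The frame change which accompanies a change of the coordinate `t`. -/
def pullbackT (d' : Derivation ℂ R' R') (h₁ κ : R') : Matrix (Fin 2) (Fin 2) R'⟦X⟧ :=
  !![C κ, X * C (d' κ); 0, C (κ * h₁)]

lemma isUnit_det_pullbackT {d' : Derivation ℂ R' R'} {h₁ κ : R'} (hκ : κ ^ 2 * h₁ = 1) :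
    IsUnit (pullbackT d' h₁ κ).det := by
  have : (pullbackT d' h₁ κ).det = 1 := by
    rw [pullbackT, Matrix.det_fin_two_of, mul_zero, sub_zero, ← map_mul, ← map_one C, ← hκ]
    ring_nf
  rw [this]; exact isUnit_one

/-- With κ = h₁^(-1/2) the matrix `pullbackT` has determinant 1 and restores the companion form. The
term κ''κh₁ = κ''/κ is -1/2 times the Schwarzian derivative: f changes like a projective connection,
whereas b changes like a vector field. -/
theorem pullback_companion {d : Derivation ℂ R R} {d' : Derivation ℂ R' R'} (σ : R →ₐ[ℂ] R')
    {h₁ κ : R'} (hσ : ∀ r, d' (σ r) = h₁ * σ (d r)) (hκ : κ ^ 2 * h₁ = 1)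
    {f b s : R⟦X⟧} {μ : R⟦X⟧ →+* R'⟦X⟧} (hμ : μ = PowerSeries.map (σ : R →+* R'))
    {f' b' : R'⟦X⟧} (hf' : f' = C (h₁ ^ 2) * μ f + X * C (d' (d' κ) * κ * h₁))
    (hb' : b' = C (κ ^ 2) * μ b) :
    IsGauge d' (pullbackT d' h₁ κ) ((C h₁ : R'⟦X⟧) • (companionA f).map μ) (companionA f') ∧
    IsZGauge (pullbackT d' h₁ κ) ((companionB d s f b).map μ) (companionB d' (μ s) f' b') := by
  have k1 : ∀ x, liftD d' (μ x) = C h₁ * μ (liftD d x) := fun x => by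
    ext n; simp [hμ, hσ]
  have k3 : μ X = X := by simp [hμ]
  have k4 : μ (half R) = half R' := by
    rw [hμ, half_eq_C, half_eq_C, PowerSeries.map_C]; simp
  have h2 := two_mul_half (R := R')
  have hd := congrArg d' hκ
  simp only [Derivation.leibniz, Derivation.leibniz_pow, Derivation.map_one_eq_zero, smul_eq_mul,
    nsmul_eq_mul] at hd
  -- The derivative of κ²h₁ = 1, in which the unit κ, with inverse κh₁, is cancelled.
  have hd' : κ * d' h₁ = -2 * d' κ * h₁ := by
    have : κ * h₁ * (κ * (κ * d' h₁ + 2 * d' κ * h₁)) = 0 := by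
      push_cast at hd
      linear_combination κ * h₁ * hd
    have e : κ * h₁ * κ = 1 := by linear_combination hκ
    linear_combination this - (κ * d' h₁ + 2 * d' κ * h₁) * e
  have hκC : (C κ : R'⟦X⟧) ^ 2 * C h₁ = 1 := by rw [← map_pow, ← map_mul, hκ, map_one]
  have hdC : (C κ : R'⟦X⟧) * C (d' h₁) = -2 * C (d' κ) * C h₁ := by
    rw [← map_mul, hd']
    simp only [map_mul, map_neg, map_ofNat]
  have kb : liftD d' b' = 2 * C κ * C (d' κ) * μ b + C κ ^ 2 * C h₁ * μ (liftD d b) := by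
    rw [hb']; simp [k1]; ring
  have kbb : liftD d' (liftD d' b') = 2 * C (d' κ) ^ 2 * μ b + 2 * C κ * C (d' (d' κ)) * μ b
      + 2 * C κ * C (d' κ) * C h₁ * μ (liftD d b)  + C h₁ * μ (liftD d (liftD d b)) := by
    rw [kb, hκC]; simp [k1]; ring
  have eA : (companionA f).map μ = !![0, X * μ f; 1, 0] := by
    ext1 i j; fin_cases i <;> fin_cases j <;> simp [companionA, k3]
  have eB : (companionB d s f b).map μ
      = !![μ s - half R' * X * (μ (liftD d b) + 1),
          X * (-(half R' * X * μ (liftD d (liftD d b))) + μ f * μ b);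
          μ b, μ s + half R' * X * (μ (liftD d b) + 1)] := by
    ext1 i j
    fin_cases i <;> fin_cases j <;> simp [companionB, diagB, k3, k4, sub_eq_add_neg]
  constructor
  · rw [IsGauge, pullbackT, eA, companionA, hf']
    ext1 i j
    fin_cases i <;> fin_cases j <;> simp
    · linear_combination -X ^ 2 * C (d' (d' κ)) * hκC
    · ring
    · linear_combination X * hdC
  · rw [IsZGauge, pullbackT, eB, companionB, liftD_diagB, kbb, diagB,
      kb, hf', hb', hκC]
    ext1 i j
    fin_cases i <;> fin_cases j <;> simp
    · linear_combination X * C κ ^ 2 * C (d' κ) * μ b * h2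
    · linear_combination (-X * C κ * C h₁ * μ f * μ b - X ^ 2 * C κ ^ 2 * C (d' (d' κ)) * μ b
        + 2 * half R' * X ^ 2 * C (d' κ) * μ (liftD d b)) * hκC
        + (X ^ 2 * C κ ^ 2 * C (d' (d' κ)) * μ b - X ^ 2 * C (d' κ)) * h2
    · linear_combination -C κ * μ b * hκC
    · linear_combination -μ b * X * C (d' κ) * C κ ^ 2 * C h₁ * h2 - μ b * X * C (d' κ) * hκC

end Pullback

end TEStructure

end

noncomputable section

namespace TEStructure

open TopologicalSpace (Opens)

/-! ### Normalising f on a disc when its leading coefficient is 1 or f = O(z²) -/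

section DiscCalculus

open PowerSeries Matrix

/-- The calculus of holomorphic functions on a disc: the coordinate, the derivative, the value at
the centre, primitives, and solutions of `κ g + t g' = f`. -/
structure DiscCalculus (R : Type*) [CommRing R] [Algebra ℂ R] where
  d : Derivation ℂ R R
  t : R
  ev : R →ₐ[ℂ] ℂ
  prim : R → R
  euler : ℝ → R → R
  d_t : d t = 1
  ev_t : ev t = 0
  d_prim : ∀ f, d (prim f) = f
  ev_prim : ∀ f, ev (prim f) = 0
  eq_zero_of_d : ∀ f, d f = 0 → ev f = 0 → f = 0
  euler_spec : ∀ (κ : ℝ) f, 0 < κ → algebraMap ℂ R κ * euler κ f + t * d (euler κ f) = f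
  euler_unique : ∀ (κ : ℝ) f, 0 < κ → algebraMap ℂ R κ * f + t * d f = 0 → f = 0

variable {R : Type*} [CommRing R] [Algebra ℂ R]

lemma exists_eq_C_add_X_mul {R : Type*} [CommRing R] (x : R⟦X⟧) :
    ∃ y, x = C (coeff 0 x) + X * y := by
  obtain ⟨y, hy⟩ : X ∣ x - C (coeff 0 x) := by
    rw [X_dvd_iff]; simp
  exact ⟨y, by rw [← hy]; ring⟩

variable (R) in
/-- Power series with constant coefficients. -/
def cst : ℂ⟦X⟧ →+* R⟦X⟧ := PowerSeries.map (algebraMap ℂ R)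

@[simp] lemma coeff_cst (g : ℂ⟦X⟧) (n : ℕ) : coeff n (cst R g) = algebraMap ℂ R (coeff n g) :=
  coeff_map _ _ _

@[simp] lemma cst_X : cst R X = X := PowerSeries.map_X _

@[simp] lemma cst_C (c : ℂ) : cst R (C c) = C (algebraMap ℂ R c) := PowerSeries.map_C _ _

@[simp] lemma liftD_cst (d : Derivation ℂ R R) (g : ℂ⟦X⟧) : liftD d (cst R g) = 0 := by
  ext n; simp

@[simp] lemma derivative_cst (g : ℂ⟦X⟧) : derivative R (cst R g) = cst R (derivative ℂ g) := by
  ext n; simp [coeff_derivative]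

namespace DiscCalculus

variable (𝒟 : DiscCalculus R)

/-- Primitives of power series, coefficient by coefficient. -/
def Prim : R⟦X⟧ → R⟦X⟧ := coeffwise fun _ => 𝒟.prim

@[simp] lemma liftD_Prim (x : R⟦X⟧) : liftD 𝒟.d (𝒟.Prim x) = x := by
  ext n; simp [Prim, 𝒟.d_prim]

/-- The value at the centre of the disc, coefficient by coefficient. -/
def Ev : R⟦X⟧ →+* ℂ⟦X⟧ := PowerSeries.map (𝒟.ev : R →+* ℂ)

@[simp] lemma coeff_Ev (x : R⟦X⟧) (n : ℕ) : coeff n (𝒟.Ev x) = 𝒟.ev (coeff n x) :=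
  coeff_map _ _ _

@[simp] lemma Ev_Prim (x : R⟦X⟧) : 𝒟.Ev (𝒟.Prim x) = 0 := by
  ext n; simp [Prim, 𝒟.ev_prim]

lemma eq_of_liftD_eq {x y : R⟦X⟧} (h : liftD 𝒟.d x = liftD 𝒟.d y) (h' : 𝒟.Ev x = 𝒟.Ev y) :
    x = y := by
  rw [← sub_eq_zero] at h h' ⊢
  rw [← map_sub] at h h'
  ext n
  have e := congrArg (coeff n) h
  have e' := congrArg (coeff n) h'
  rw [coeff_liftD, map_zero] at e
  rw [coeff_Ev, map_zero] at e'
  rw [𝒟.eq_zero_of_d _ e e', map_zero]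

@[simp] lemma Ev_cst (g : ℂ⟦X⟧) : 𝒟.Ev (cst R g) = g := by
  ext n; simp

lemma eq_cst_of_liftD_eq_zero {x : R⟦X⟧} (h : liftD 𝒟.d x = 0) : x = cst R (𝒟.Ev x) :=
  𝒟.eq_of_liftD_eq (by simp [h]) (by simp)

/-- Write f = 1 + zg. The gauge equations become δa = -(z/2)(gc + δ²c) and 2δc = -ga + O(z).
Expressing a through c by a primitive leaves one equation for c with principal term δc, which is a
contraction after integration. The matrix B comes along automatically. -/
theorem exists_gauge_of_coeff_zero_eq_one {f s b : R⟦X⟧} (hf : coeff 0 f = 1)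
    (hs : liftD 𝒟.d s = 0) (hb : IsCompatible 𝒟.d f b) :
    ∃ T s' b', IsUnit T.det ∧ IsGauge 𝒟.d T (companionA f) (companionA 1) ∧
      IsZGauge T (companionB 𝒟.d s f b) (companionB 𝒟.d s' 1 b') ∧
      liftD 𝒟.d s' = 0 ∧ IsCompatible 𝒟.d 1 b' := by
  obtain ⟨g, hg⟩ := exists_eq_C_add_X_mul f
  rw [hf, map_one] at hg
  have h2 := two_mul_half (R := R)
  let η := half R
  let δ := liftD 𝒟.d
  let Λ : R⟦X⟧ → R⟦X⟧ := fun c => 𝒟.Prim (-(η * (g * c + δ (δ c))))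
  have hΛ : ∀ k x x', Cong k x x' → Cong k (Λ x) (Λ x') := fun k x x' h =>
    (((h.const_mul g).add ((h.liftD _).liftD _)).const_mul η |>.neg).coeffwise _
  obtain ⟨c, hc⟩ := exists_fixedPoint_single
    (fun c => 𝒟.Prim (-(η * g * (1 + X * Λ c)) - X * (η * (η * δ (g * c) + g * δ c
      - η * δ (δ (δ c)))))) (fun k x x' h => by
        refine Cong.coeffwise _ (Cong.sub (Cong.neg (Cong.const_mul _ ((Cong.refl _ _).add
          (hΛ k x x' h).X_mul))) (Cong.X_mul (Cong.const_mul _ ?_)))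
        exact (((h.const_mul g).liftD _).const_mul η |>.add ((h.liftD _).const_mul g)).sub
          ((((h.liftD _).liftD _).liftD _).const_mul η))
  set a := 1 + X * Λ c with ha
  have da : δ a = -(X * (η * (g * c + δ (δ c)))) := by
    simp [ha, δ, Λ]
  have dc : δ c = -(η * g * a) - X * (η * (η * δ (g * c) + g * δ c - η * δ (δ (δ c)))) := by
    conv_lhs => rw [← hc]
    exact 𝒟.liftD_Prim _
  have dda : δ (δ a) = -(X * (η * (δ (g * c) + δ (δ (δ c))))) := by
    rw [da]; simp [δ, η]
  have ha0 : coeff 0 a = 1 := by simp [ha]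
  have hG : IsGauge 𝒟.d (gaugeT 𝒟.d f a c) (companionA f) (companionA 1) := by
    apply isGauge_gaugeT
    · change 2 * δ a = _
      rw [da, hg]
      linear_combination -X * (g * c + δ (δ c)) * h2
    · change _ = X * (δ (δ a) + δ (f * c) + f * δ c)
      have : δ (f * c) = δ c + X * δ (g * c) := by rw [hg]; simp [δ]; ring
      rw [dda, this, hg]
      linear_combination -2 * X * dc + X ^ 2 * δ (g * c) * h2
        - X * (-(g * a) - X * (η * δ (g * c) + g * δ c - η * δ (δ (δ c)))) * h2
  have hu := isUnit_det_gaugeT (d := 𝒟.d) (f := f) (c := c) ha0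
  obtain ⟨s', b', hs', hb', hZ⟩ := exists_companionB_of_isGauge hs hb hu hG
  exact ⟨_, s', b', hu, hG, hZ, hs', hb'⟩

/-- For f = 1 the function u = b_t + 1/2 satisfies u = (z/4) u_tt, so it vanishes to every order in
z. -/
lemma eq_of_isCompatible_one {b : R⟦X⟧} (hb : IsCompatible 𝒟.d 1 b) :
    b = -(half R * C 𝒟.t) + cst R (𝒟.Ev b) := by
  have h2 := two_mul_half (R := R)
  unfold IsCompatible at hb
  have h1 : liftD 𝒟.d b + half R = half R ^ 2 * X * liftD 𝒟.d (liftD 𝒟.d (liftD 𝒟.d b + half R)) := by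
    simp at hb
    simp
    linear_combination half R * hb - liftD 𝒟.d b * h2
  have h0 : liftD 𝒟.d b + half R = 0 := by
    refine eq_zero_of_cong 0 (fun n hn => absurd hn (by omega)) fun k _ hk => ?_
    rw [h1, mul_assoc]
    have := (((hk.liftD 𝒟.d).liftD 𝒟.d).X_mul).const_mul (half R ^ 2) k (by omega)
    rw [this]; simp
  have ht : 𝒟.Ev (C 𝒟.t) = 0 := by ext n; simp [coeff_C, apply_ite, 𝒟.ev_t]
  refine 𝒟.eq_of_liftD_eq ?_ ?_
  · simp [𝒟.d_t]; linear_combination h0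
  · simp [ht]

/-- Write f = z²g. The first gauge equation makes δa, hence δ²a, divisible by z; inserting it into
the second one gives δ³c = 2ga + O(z), which a threefold primitive turns into a contraction. The
vanishing of the z-coefficient of f is indispensable, because the second equation has the form -fa =
z(δ²a + …) with δ²a = O(z). -/
theorem exists_gauge_of_coeff_eq_zero {f s b : R⟦X⟧} (hf : coeff 0 f = 0) (hf' : coeff 1 f = 0)
    (hs : liftD 𝒟.d s = 0) (hb : IsCompatible 𝒟.d f b) :
    ∃ T s' b', IsUnit T.det ∧ IsGauge 𝒟.d T (companionA f) (companionA 0) ∧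
      IsZGauge T (companionB 𝒟.d s f b) (companionB 𝒟.d s' 0 b') ∧
      liftD 𝒟.d s' = 0 ∧ IsCompatible 𝒟.d 0 b' ∧ coeff 0 b' = coeff 0 b := by
  obtain ⟨g, hg⟩ : X ^ 2 ∣ f := by
    rw [X_pow_dvd_iff]; intro m hm; interval_cases m <;> assumption
  have h2 := two_mul_half (R := R)
  let η := half R
  let δ := liftD 𝒟.d
  let P3 : R⟦X⟧ → R⟦X⟧ := fun x => 𝒟.Prim (𝒟.Prim (𝒟.Prim x))
  let Λ : R⟦X⟧ → R⟦X⟧ := fun c => 𝒟.Prim (-(η * (X * g * c + δ (δ c))))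
  have hΛ : ∀ k x x', Cong k x x' → Cong k (Λ x) (Λ x') := fun k x x' h =>
    (((h.const_mul _).add ((h.liftD _).liftD _)).const_mul η |>.neg).coeffwise _
  obtain ⟨c, hc⟩ := exists_fixedPoint_single
    (fun c => P3 (2 * g * (1 + X * Λ c) + X * (δ (g * c) + 2 * g * δ c))) (fun k x x' h => by
        refine Cong.coeffwise _ (Cong.coeffwise _ (Cong.coeffwise _ (Cong.add (Cong.const_mul _
          ((Cong.refl _ _).add (hΛ k x x' h).X_mul)) (Cong.X_mul ?_))))
        exact ((h.const_mul g).liftD _).add ((h.liftD _).const_mul _))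
  set a := 1 + X * Λ c with ha
  have da : δ a = -(X * (η * (X * g * c + δ (δ c)))) := by
    simp [ha, δ, Λ]
  have dc : δ (δ (δ c)) = 2 * g * a + X * (δ (g * c) + 2 * g * δ c) := by
    conv_lhs => rw [← hc]
    simp [δ, P3]
  have dda : δ (δ a) = -(X * (η * (X * δ (g * c) + δ (δ (δ c))))) := by
    rw [da, mul_assoc X g c]; simp [δ, η]
  have ha0 : coeff 0 a = 1 := by simp [ha]
  have hG : IsGauge 𝒟.d (gaugeT 𝒟.d f a c) (companionA f) (companionA 0) := by
    apply isGauge_gaugeT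
    · change 2 * δ a = _
      rw [da, hg]
      linear_combination -X * (X * g * c + δ (δ c)) * h2
    · change _ = X * (δ (δ a) + δ (f * c) + f * δ c)
      have : δ (f * c) = X ^ 2 * δ (g * c) := by rw [hg, mul_assoc]; simp [δ]
      rw [dda, this, hg]
      linear_combination X ^ 2 * η * dc + X ^ 2 * (g * a + X * g * δ c + X * η * δ (g * c)) * h2
        + X ^ 3 * δ (g * c) * (1 - η) * h2
  have hu := isUnit_det_gaugeT (d := 𝒟.d) (f := f) (c := c) ha0
  obtain ⟨s', b', hs', hb', hZ⟩ := exists_companionB_of_isGauge hs hb hu hG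
  exact ⟨_, s', b', hu, hG, hZ, hs', hb', (coeff_zero_eq_of_isZGauge ha0 hZ).symm⟩

/-- For f = 0 compatibility says exactly that the third derivative of b vanishes. -/
lemma eq_of_isCompatible_zero {b : R⟦X⟧} (hb : IsCompatible 𝒟.d 0 b) :
    ∃ b₀ b₁ b₂ : ℂ⟦X⟧, b = cst R b₀ + cst R b₁ * C 𝒟.t + cst R b₂ * C 𝒟.t ^ 2 := by
  have h2 := two_mul_half (R := R)
  unfold IsCompatible at hb
  have h3 : liftD 𝒟.d (liftD 𝒟.d (liftD 𝒟.d b)) = 0 := by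
    apply X_mul_cancel
    simp at hb
    linear_combination -2 * hb - X * liftD 𝒟.d (liftD 𝒟.d (liftD 𝒟.d b)) * h2
  have ht : 𝒟.Ev (C 𝒟.t) = 0 := by ext n; simp [coeff_C, apply_ite, 𝒟.ev_t]
  have e2 := 𝒟.eq_cst_of_liftD_eq_zero h3
  have hη : cst R (C (1 / 2 : ℂ)) = half R := by rw [half_eq_C, cst_C]
  set g₂ := 𝒟.Ev (liftD 𝒟.d (liftD 𝒟.d b))
  have e1 : liftD 𝒟.d b = cst R (𝒟.Ev (liftD 𝒟.d b)) + cst R g₂ * C 𝒟.t := by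
    refine 𝒟.eq_of_liftD_eq ?_ ?_
    · simp [𝒟.d_t, e2]
    · simp [ht]
  set g₁ := 𝒟.Ev (liftD 𝒟.d b)
  refine ⟨𝒟.Ev b, g₁, C (1 / 2 : ℂ) * g₂, 𝒟.eq_of_liftD_eq ?_ ?_⟩
  · rw [e1, map_mul, hη]
    simp [𝒟.d_t]
    linear_combination -cst R g₂ * C 𝒟.t * h2
  · simp [ht]

end DiscCalculus

end DiscCalculus

end TEStructure

end

/-! ### Normalising b when f begins with 1 or tʳ -/

noncomputable section

namespace TEStructure

open TopologicalSpace (Opens)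

namespace DiscCalculus

open PowerSeries Matrix

variable {R : Type*} [CommRing R] [Algebra ℂ R] (𝒟 : DiscCalculus R)

/-- Division of the `n`-th coefficient by `n + 1 + c`. -/
def divIndex (c : ℂ) : ℂ⟦X⟧ → ℂ⟦X⟧ := coeffwise fun n r => r / (n + c)

lemma derivative_X_mul_divIndex (x : ℂ⟦X⟧) : derivative ℂ (X * divIndex 1 x) = x := by
  ext n
  have : (n : ℂ) + 1 ≠ 0 := by exact_mod_cast n.succ_ne_zero
  rw [coeff_derivative, coeff_succ_X_mul, divIndex, coeff_coeffwise]
  field_simp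

lemma X_mul_derivative_divIndex {c : ℂ} (hc : ∀ n : ℕ, (n : ℂ) + c ≠ 0) (x : ℂ⟦X⟧) :
    X * derivative ℂ (divIndex c x) + C c * divIndex c x = x := by
  ext n
  have h := hc n
  rcases n with _ | n
  · rw [map_add, coeff_C_mul, divIndex, coeff_coeffwise]
    simp at h ⊢
    field_simp
  · rw [map_add, coeff_C_mul, coeff_succ_X_mul, coeff_derivative, divIndex, coeff_coeffwise]
    push_cast at h ⊢
    field_simp

/-- Gauges `gaugeT` with entries x, y constant in t preserve f = 1. With g = g(0) + zg', removing
the higher terms amounts to the system ∂_z x = -g'y, z ∂_z y + y/2 = -g'x, and its indices n + 1/2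
never vanish. -/
theorem exists_gauge_constant_one (s : R⟦X⟧) (g : ℂ⟦X⟧) :
    ∃ T : Matrix (Fin 2) (Fin 2) R⟦X⟧, IsUnit T.det ∧
      IsGauge 𝒟.d T (companionA 1) (companionA 1) ∧
      IsZGauge T (companionB 𝒟.d s 1 (-(half R * C 𝒟.t) + cst R g))
        (companionB 𝒟.d s 1 (-(half R * C 𝒟.t) + cst R (C (coeff 0 g)))) := by
  obtain ⟨g', hg⟩ := exists_eq_C_add_X_mul g
  -- The formula for x is substituted into the one for y, since only the former carries the factor X
  -- required for contraction.
  obtain ⟨x, y, hx, hy⟩ := exists_fixedPoint_pair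
    (fun _ y => 1 + X * divIndex 1 (-(g' * y)))
    (fun _ y => divIndex (1 / 2) (-(g' * (1 + X * divIndex 1 (-(g' * y))))))
    (fun k _ _ y y' _ h => (Cong.refl _ _).add ((h.const_mul g').neg.coeffwise _).X_mul)
    (fun k _ _ y y' _ h => (((Cong.refl _ _).add
      ((h.const_mul g').neg.coeffwise _).X_mul).const_mul g').neg.coeffwise _)
  have hh : ∀ n : ℕ, (n : ℂ) + 1 / 2 ≠ 0 := fun n => by
    have : (2 * n + 1 : ℕ) ≠ 0 := by omega
    intro h
    apply this
    have : ((2 * n + 1 : ℕ) : ℂ) = 0 := by push_cast; linear_combination 2 * h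
    exact_mod_cast this
  have dx : derivative ℂ x = -(g' * y) := by
    conv_lhs => rw [← hx]
    rw [map_add, derivative_X_mul_divIndex, derivative_one, zero_add]
  have dy : X * derivative ℂ y + C (1 / 2) * y = -(g' * x) := by
    have := X_mul_derivative_divIndex hh (-(g' * (1 + X * divIndex 1 (-(g' * y)))))
    rwa [hx, ← hx, hy, hx] at this
  have hx0 : coeff 0 x = 1 := by rw [← hx]; simp
  have dx' := congrArg (cst R) dx
  have dy' := congrArg (cst R) dy
  have hη : cst R (C (1 / 2 : ℂ)) = half R := by rw [half_eq_C, cst_C]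
  rw [map_add, map_mul, map_mul, cst_X, hη] at dy'
  simp only [map_neg, map_mul] at dx' dy'
  have h2 := two_mul_half (R := R)
  refine ⟨gaugeT 𝒟.d 1 (cst R x) (cst R y), isUnit_det_gaugeT (by rw [coeff_cst, hx0, map_one]),
    isGauge_gaugeT (by simp) (by simp), ?_⟩
  have hg' := congrArg (cst R) hg
  rw [map_add, map_mul, cst_X] at hg'
  rw [IsZGauge, gaugeT, companionB, companionB, diagB, diagB, hg']
  ext1 i j
  fin_cases i <;> fin_cases j <;> simp [𝒟.d_t]
  · linear_combination X ^ 2 * dx'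
  · linear_combination X ^ 2 * dy' - X ^ 2 * cst R y * (1 - half R) * h2
  · linear_combination X * dy' - X * cst R y * half R * h2
  · linear_combination X ^ 2 * dx'

/-- The equation in the t-direction would have to be divided by tʳ, so c is obtained instead from
the lower left entry of the z-equation, an Euler equation z ∂_z c + (1 - μ)c + μ t c_t = … whose
index n + 1 - μ + μj on zⁿtʲ is positive. The series a comes from the t-direction, with its value at
t = 0 taken from the z-direction. The entries not yet satisfied are defects obeying a homogeneous
linear system, and uniqueness for an Euler equation makes them vanish. -/
theorem exists_gauge_of_coeff_zero_eq_pow (r : ℕ) {f s b : R⟦X⟧}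
    {μ : ℂ} (hμ : μ = 1 / (r + 2)) (hf : coeff 0 f = 𝒟.t ^ r)
    (hb₀ : coeff 0 b = -(algebraMap ℂ R μ * 𝒟.t)) (hs : liftD 𝒟.d s = 0)
    (hb : IsCompatible 𝒟.d f b)
    (hb' : IsCompatible 𝒟.d (C 𝒟.t ^ r) (-(C (algebraMap ℂ R μ) * C 𝒟.t))) :
    ∃ T : Matrix (Fin 2) (Fin 2) R⟦X⟧, IsUnit T.det ∧
      IsGauge 𝒟.d T (companionA f) (companionA (C 𝒟.t ^ r)) ∧
      IsZGauge T (companionB 𝒟.d s f b)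
        (companionB 𝒟.d s (C 𝒟.t ^ r) (-(C (algebraMap ℂ R μ) * C 𝒟.t))) := by
  obtain ⟨g, hg⟩ := exists_eq_C_add_X_mul f
  obtain ⟨β, hβ⟩ := exists_eq_C_add_X_mul b
  rw [hf, map_pow] at hg
  rw [hb₀, map_neg, map_mul] at hβ
  have h2 := two_mul_half (R := R)
  set η := half R with hη
  set m : R⟦X⟧ := C (algebraMap ℂ R μ) with hm
  set τ : R⟦X⟧ := C 𝒟.t with hτ
  set F : R⟦X⟧ := τ ^ r with hF
  set δ := liftD 𝒟.d with hδ
  have dm : δ m = 0 := by simp [hδ, hm]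
  have dτ : δ τ = 1 := by simp [hδ, hτ, 𝒟.d_t]
  have dη : δ η = 0 := by simp [hδ, hη]
  have dX : δ X = 0 := by simp [hδ]
  have db : δ b = -m + X * δ β := by rw [hβ]; simp [dm, dτ, dX]
  have hr0 : (r : ℂ) + 2 ≠ 0 := by exact_mod_cast (by omega : r + 2 ≠ 0)
  -- In degree n the equation (n + 1 - μ) x + μ t x' = w, multiplied by r + 2 = 1/μ, is an Euler
  -- equation with constant (n + 1)(r + 2) - 1 > 0.
  let J : R⟦X⟧ → R⟦X⟧ := coeffwise fun n w =>
    𝒟.euler ((n + 1) * (r + 2) - 1) (algebraMap ℂ R (r + 2) * w)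
  have hJ : ∀ w, X * derivative R (J w) + (1 - m) * J w + m * τ * δ (J w) = w := by
    intro w
    ext n
    have e := 𝒟.euler_spec ((n + 1) * (r + 2) - 1) (algebraMap ℂ R (r + 2) * coeff n w)
      (by nlinarith [Nat.cast_nonneg (α := ℝ) n, Nat.cast_nonneg (α := ℝ) r])
    have e1 : coeff n (X * derivative R (J w)) = (n : R) * coeff n (J w) := by
      rcases n with _ | n
      · simp
      · rw [coeff_succ_X_mul, coeff_derivative]; push_cast; ring
    have e2 : algebraMap ℂ R μ * algebraMap ℂ R (r + 2) = 1 := by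
      rw [← map_mul, hμ, one_div_mul_cancel hr0, map_one]
    have e3 : algebraMap ℂ R ((((n + 1) * (r + 2) - 1 : ℝ) : ℂ))
        = ((n : R) + 1) * algebraMap ℂ R (r + 2) - 1 := by
      push_cast; simp
    rw [e3] at e
    rw [map_add, map_add, e1, sub_mul, one_mul, map_sub, hm, hτ, mul_assoc (C _), coeff_C_mul,
      coeff_C_mul, coeff_C_mul, hδ, coeff_liftD]
    change (n : R) * _ + _ + _ = _
    have e4 : coeff n (J w) = 𝒟.euler ((n + 1) * (r + 2) - 1) (algebraMap ℂ R (r + 2) * coeff n w) :=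
      coeff_coeffwise _ _ _
    rw [e4]
    linear_combination algebraMap ℂ R μ * e +
      (coeff n w - ((n : R) + 1) * 𝒟.euler ((n + 1) * (r + 2) - 1)
        (algebraMap ℂ R (r + 2) * coeff n w)) * e2
  -- The primitive fixes δa. The summand constant in t fixes ∂_z of a at t = 0 so that the upper
  -- left entry of the z-defect vanishes there.
  let Φ : R⟦X⟧ → R⟦X⟧ → R⟦X⟧ := fun a c => 1 + X * (𝒟.Prim (-(η * (g * c + δ (δ c))))
    + cst R (divIndex 1 (𝒟.Ev (η * δ β * a - (f * β - η * δ (δ b)) * c))))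
  have hcst : ∀ {k : ℕ} {x x' : ℂ⟦X⟧}, Cong k x x' → Cong k (cst R x) (cst R x') :=
    fun h n hn => by rw [coeff_cst, coeff_cst, h n hn]
  have hEv : ∀ {k : ℕ} {x x' : R⟦X⟧}, Cong k x x' → Cong k (𝒟.Ev x) (𝒟.Ev x') :=
    fun h n hn => by rw [coeff_Ev, coeff_Ev, h n hn]
  have hΦ : ∀ k x x' y y', Cong k x x' → Cong k y y' → Cong (k + 1) (Φ x y) (Φ x' y') :=
    fun k x x' y y' h h' => (Cong.refl _ _).add (Cong.X_mul (Cong.add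
      (Cong.coeffwise _ (Cong.neg (Cong.const_mul _ ((h'.const_mul g).add ((h'.liftD _).liftD _)))))
      (hcst (Cong.coeffwise _ (hEv ((h.const_mul _).sub (h'.const_mul _)))))))
  obtain ⟨a, c, ha, hc⟩ := exists_fixedPoint_pair Φ
    (fun a c => J (-(β * Φ a c) - X * (η * δ β * c))) hΦ
    (fun k x x' y y' h h' => Cong.coeffwise _ (Cong.sub (Cong.neg (Cong.const_mul _
      (hΦ k x x' y y' h h'))) (Cong.X_mul (h'.const_mul _))))
  have da : δ a = -(X * (η * (g * c + δ (δ c)))) := by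
    conv_lhs => rw [← ha]
    simp [Φ, hδ]
  have dc : X * derivative R c + (1 - m) * c + m * τ * δ c = -(β * a) - X * (η * δ β * c) := by
    have := hJ (-(β * Φ a c) - X * (η * δ β * c))
    rwa [hc, ha] at this
  have da0 : derivative ℂ (𝒟.Ev a) = 𝒟.Ev (η * δ β * a - (f * β - η * δ (δ b)) * c) := by
    conv_lhs => rw [← ha]
    have hEX : 𝒟.Ev X = X := PowerSeries.map_X _
    simp only [Φ, map_add, map_mul, map_one, hEX, 𝒟.Ev_Prim, 𝒟.Ev_cst, zero_add, mul_add, mul_zero]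
    rw [derivative_one, zero_add, derivative_X_mul_divIndex]
  have ha0 : coeff 0 a = 1 := by rw [← ha]; simp [Φ]
  clear_value Φ J
  have hu := isUnit_det_gaugeT (d := 𝒟.d) (f := f) (c := c) ha0
  set bb : R⟦X⟧ := -(m * τ) with hbb
  have dbb : δ bb = -m := by simp [hbb, dm, dτ]
  set T := gaugeT 𝒟.d f a c with hT
  -- By construction of a and c the t-defect is confined to the upper right entry, and it is
  -- divisible by z².
  obtain ⟨y, hy⟩ : ∃ y, y = X ^ 2 * (δ (δ a) + δ (f * c) + g * a + f * δ c) := ⟨_, rfl⟩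
  have hY : (X : R⟦X⟧) • T.map (liftD 𝒟.d) + companionA f * T - T * companionA F
      = !![0, y; 0, 0] := by
    rw [hT, gaugeT, companionA, companionA, hy, ← hδ, Derivation.leibniz]
    ext1 i j
    fin_cases i <;> fin_cases j <;> simp [dX]
    · ring
    · linear_combination X * a * hg
    · ring
    · linear_combination 2 * X * da + X * c * hg - X ^ 2 * (g * c + δ (δ c)) * h2
  obtain ⟨x, w, v, x', hZ⟩ : ∃ x w v x', (X : R⟦X⟧) ^ 2 • T.map (derivative R)
      + companionB 𝒟.d s f b * T - T * companionB 𝒟.d s F bb = !![x, w; v, x'] :=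
    ⟨_, _, _, _, Matrix.eta_fin_two _⟩
  have hv : v = 0 := by
    have := congrFun (congrFun hZ 1) 0
    simp [hT, gaugeT, companionB, diagB, ← hδ, dbb, db, ← hη] at this
    rw [← this]
    linear_combination X * dc + a * hβ + a * hbb + X * c * (1 - m) * h2
      - X * δ c * hbb
  have hx0 : 𝒟.Ev x = 0 := by
    have := congrFun (congrFun hZ 0) 0
    simp [hT, gaugeT, companionB, diagB, ← hδ, dbb, db, ← hη] at this
    have ddb : δ (δ b) = X * δ (δ β) := by rw [db]; simp [dm, dX]
    have hx : x = X ^ 2 * (derivative R a - (η * δ β * a - (f * β - η * δ (δ b)) * c))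
        + bb * (-(X * δ a)) := by
      rw [← this, dη, dX, dm, ddb]
      linear_combination X * f * c * hβ
    have hbb0 : 𝒟.Ev bb = 0 := by
      have : 𝒟.Ev τ = 0 := by ext n; simp [hτ, coeff_C, apply_ite, 𝒟.ev_t]
      rw [hbb, map_neg, map_mul, this, mul_zero, neg_zero]
    have hder : 𝒟.Ev (derivative R a) = derivative ℂ (𝒟.Ev a) := by
      ext n; simp [coeff_derivative]
    rw [hx, map_add, map_mul, map_mul, hbb0, map_sub, hder, da0, sub_self]
    ring
  subst hv
  -- The relation expresses w and δx through y and yields one equation for y, homogeneous up to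
  -- multiples of z times x and y.
  have rel := defect_relation (isFlat_companion hs hb) (isFlat_companion hs hb') hY hZ
  have r00 := congrFun (congrFun rel 0) 0
  have r01 := congrFun (congrFun rel 0) 1
  have r10 := congrFun (congrFun rel 1) 0
  have r11 := congrFun (congrFun rel 1) 1
  simp [companionA, companionB, diagB, ← hδ, dbb, db, ← hη] at r00 r01 r10 r11
  obtain rfl : x = x' := sub_eq_zero.1 r10
  have dx : δ x = η * y * β := by
    apply X_mul_cancel
    linear_combination η * (r00 + r11) + η * y * hβ - X * δ x * h2
  have hw : w = X * δ x + y * bb := by linear_combination -r00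
  have dw : δ w = X * δ (δ x) + (y * -m + bb * δ y) := by
    rw [hw]; simp [dX, dbb]
  have ey : X * δ (δ x) + (y * -m + bb * δ y) + X * g * x
      = X * derivative R y - η * (-m + X * δ β + 1) * y - y * (η * (-m + 1)) - y := by
    apply X_mul_cancel
    rw [dw] at r01
    linear_combination r01 - X * x * hg
  have hx_of : ∀ k, Cong k y 0 → Cong k x 0 := by
    intro k hk n hn
    rw [map_zero]
    refine 𝒟.eq_zero_of_d _ ?_ ?_
    · rw [← coeff_liftD, ← hδ, dx, mul_assoc]
      have := ((hk.mul (Cong.refl k β)).const_mul η) n hn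
      rw [this]; simp
    · rw [← coeff_Ev, hx0, map_zero]
  -- If y vanishes below order k then so does x, since δx = yβ/2 and x is 0 at t = 0. The terms of
  -- c5 carrying a factor X therefore do not contribute in degree k.
  have y0 : y = 0 := by
    refine eq_zero_of_cong 2 ?_ fun k hk hky => ?_
    · intro n hn
      rw [hy, coeff_X_pow_mul', if_neg (by omega), map_zero]
    · have hkx := hx_of k hky
      have c1 : coeff k (X * δ (δ x)) = 0 := by
        have := ((hkx.liftD 𝒟.d).liftD 𝒟.d).X_mul k (by omega)
        rw [hδ, this]; simp
      have c2 : coeff k (X * g * x) = 0 := by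
        have := (hkx.const_mul g).X_mul k (by omega)
        rw [mul_assoc, this]; simp
      have c3 : coeff k (X * (η * δ β * y)) = 0 := by
        have := (hky.const_mul (η * δ β)).X_mul k (by omega)
        rw [this]; simp
      have c4 : coeff k (X * derivative R y) = (k : R) * coeff k y := by
        obtain ⟨k, rfl⟩ := Nat.exists_eq_add_of_le hk
        rw [show 2 + k = (1 + k) + 1 by ring, coeff_succ_X_mul, coeff_derivative]
        push_cast; ring
      have c5 : X * derivative R y - 2 * y + 2 * (m * y) + m * (τ * δ y)
          = X * δ (δ x) + X * g * x + X * (η * δ β * y) := by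
        linear_combination -ey + (y - m * y) * h2 + δ y * hbb
      have c6 := congrArg (coeff k) c5
      have c7 : coeff k (2 * y) = 2 * coeff k y := by
        rw [two_mul, two_mul, map_add]
      have c8 : coeff k (2 * (m * y)) = 2 * (algebraMap ℂ R μ * coeff k y) := by
        rw [two_mul, two_mul, map_add, hm, coeff_C_mul]
      rw [map_add, map_add, map_sub, map_add, map_add, c1, c2, c3, c4, c7, c8, hm, coeff_C_mul, hτ,
        coeff_C_mul, hδ, coeff_liftD] at c6
      have hkr : (2 : ℝ) ≤ k := by exact_mod_cast hk
      -- In degree k the equation is (k - 2 + 2μ) y_k + μ t y_k' = 0. Multiplied by r + 2 its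
      -- constant is (k - 2)(r + 2) + 2, which is positive for k ≥ 2; lower degrees are absent
      -- because z² divides y.
      refine 𝒟.euler_unique (((k : ℝ) - 2) * (r + 2) + 2) _
        (by nlinarith [Nat.cast_nonneg (α := ℝ) r]) ?_
      have e2 : algebraMap ℂ R μ * algebraMap ℂ R (r + 2) = 1 := by
        rw [← map_mul, hμ, one_div_mul_cancel hr0, map_one]
      have e3 : algebraMap ℂ R (((((k : ℝ) - 2) * (r + 2) + 2 : ℝ) : ℂ))
          = ((k : R) - 2) * algebraMap ℂ R (r + 2) + 2 := by
        simp only [Complex.ofReal_add, Complex.ofReal_mul, Complex.ofReal_sub,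
          Complex.ofReal_natCast, Complex.ofReal_ofNat, map_add, map_mul, map_sub, map_natCast,
          map_ofNat]
      rw [e3]
      linear_combination algebraMap ℂ R (r + 2) * c6
        - (2 * coeff k y + 𝒟.t * 𝒟.d (coeff k y)) * e2
  have x0 : x = 0 := by
    refine 𝒟.eq_of_liftD_eq ?_ (by rw [hx0, map_zero])
    rw [← hδ, dx, y0]; simp
  have w0 : w = 0 := by rw [hw, x0, y0]; simp
  refine ⟨T, hu, ?_, ?_⟩
  · rw [IsGauge, ← sub_eq_zero, hY, y0]
    ext1 i j; fin_cases i <;> fin_cases j <;> simp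
  · rw [IsZGauge, ← sub_eq_zero, hZ, x0, w0]
    ext1 i j; fin_cases i <;> fin_cases j <;> simp

end DiscCalculus

end TEStructure

end

/-! ### Normalising a quadratic b when f = 0 -/

noncomputable section

namespace TEStructure

open TopologicalSpace (Opens)

lemma Cong.mono {R : Type*} [CommRing R] {k : ℕ} {x y : PowerSeries R} (h : Cong (k + 1) x y) :
    Cong k x y :=
  fun n hn => h n (by omega)

namespace DiscCalculus

open PowerSeries Matrix

variable {R : Type*} [CommRing R] [Algebra ℂ R] (𝒟 : DiscCalculus R)

/-- The quadratic polynomial in `t` with coefficients in `ℂ⟦z⟧`. -/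
def quad (b₀ b₁ b₂ : ℂ⟦X⟧) : R⟦X⟧ :=
  cst R b₀ + cst R b₁ * C 𝒟.t + cst R b₂ * C 𝒟.t ^ 2

/-- For f = 0 the gauge equations in the t-direction are 2a_t = -z c_tt and a_tt = 0, so c = c₀ +
c₁t + c₂t² and a = p - z c₂ t. The z-equation is then polynomial in t, and its coefficients reduce
to the four equations in ℂ⟦z⟧ assumed here. -/
theorem exists_gauge_quad (s : R⟦X⟧) {b₀ b₁ b₂ b₀' b₁' b₂' p c₀ c₁ c₂ : ℂ⟦X⟧}
    (hp : coeff 0 p = 1)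
    (e11 : X * derivative ℂ p - C (1 / 2) * (b₁ - b₁') * p - X * b₂ * c₀ + X * b₀' * c₂ = 0)
    (e21 : X * (X * derivative ℂ c₀ + c₀) + C (1 / 2) * X * (b₁ + b₁') * c₀ + (b₀ - b₀') * p
      - X * c₁ * b₀' = 0)
    (e22 : X * (X * derivative ℂ c₁ + c₁) - X * c₂ * (b₀ + b₀') + X * (b₂ + b₂') * c₀
      + C (1 / 2) * (b₁ - b₁') * (2 * p + X * c₁) = 0)
    (e12 : X * (X * derivative ℂ c₂ + c₂) - C (1 / 2) * X * (b₁ + b₁') * c₂ + (b₂ - b₂') * p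
      + X * b₂ * c₁ = 0) :
    ∃ T : Matrix (Fin 2) (Fin 2) R⟦X⟧, IsUnit T.det ∧
      IsGauge 𝒟.d T (companionA 0) (companionA 0) ∧
      IsZGauge T (companionB 𝒟.d s 0 (𝒟.quad b₀ b₁ b₂))
        (companionB 𝒟.d s 0 (𝒟.quad b₀' b₁' b₂')) := by
  have hη : cst R (C (1 / 2 : ℂ)) = half R := by rw [half_eq_C, cst_C]
  have h2 := two_mul_half (R := R)
  replace e11 := congrArg (cst R) e11
  replace e21 := congrArg (cst R) e21
  replace e22 := congrArg (cst R) e22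
  replace e12 := congrArg (cst R) e12
  simp only [map_add, map_sub, map_mul, hη, cst_X, map_zero, map_ofNat] at e11 e21 e22 e12
  refine ⟨gaugeT 𝒟.d 0 (cst R p - X * cst R c₂ * C 𝒟.t) (𝒟.quad c₀ c₁ c₂),
    isUnit_det_gaugeT (by rw [map_sub, coeff_cst, hp]; simp), isGauge_gaugeT ?_ ?_, ?_⟩
  · simp [quad, 𝒟.d_t]; ring
  · simp [𝒟.d_t]
  · rw [IsZGauge, gaugeT, companionB, companionB, diagB, diagB, quad, quad, quad]
    have hd2 : derivative R (2 : R⟦X⟧) = 0 := by simpa using (derivative R).map_natCast 2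
    ext1 i j
    fin_cases i <;> fin_cases j <;> simp [𝒟.d_t, hd2]
    · linear_combination X * e11 - C 𝒟.t * X * e12
        - (X * C 𝒟.t * (cst R b₂ * cst R p - cst R p * cst R b₂') + X ^ 2 * C 𝒟.t * (cst R c₂ * cst R b₁' + cst R b₂ * cst R c₁) + X ^ 2 * C 𝒟.t ^ 2 * cst R c₂ * cst R b₂' + X ^ 2 * cst R b₂ * cst R c₀) * h2
    · linear_combination -X ^ 2 * e12
        - (X ^ 2 * (cst R b₂ * cst R p - cst R p * cst R b₂') - X ^ 3 * (cst R c₂ - cst R b₂ * cst R c₁)) * h2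
    · linear_combination e21 + C 𝒟.t * e22 + C 𝒟.t ^ 2 * e12
        - (C 𝒟.t * (cst R b₁ * cst R p - cst R p * cst R b₁') - X * cst R c₀ - X * C 𝒟.t * (cst R b₂ * cst R c₀ + cst R c₀ * cst R b₂' + cst R c₁ + cst R c₁ * cst R b₁') - X * C 𝒟.t ^ 2 * (cst R b₁ * cst R c₂ + cst R b₂ * cst R c₁ + cst R c₂ + cst R c₂ * cst R b₁' + cst R c₁ * cst R b₂') - X * C 𝒟.t ^ 3 * (cst R b₂ * cst R c₂ + cst R c₂ * cst R b₂')) * h2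
    · linear_combination X * e22 + X * e11 + C 𝒟.t * X * e12
        - (X * C 𝒟.t * (cst R p * cst R b₂' - cst R b₂ * cst R p) - X ^ 2 * C 𝒟.t * (cst R c₂ * cst R b₁ + cst R c₁ * cst R b₂) - X ^ 2 * C 𝒟.t ^ 2 * cst R c₂ * cst R b₂ - X ^ 2 * cst R c₀ * cst R b₂') * h2

lemma cong_divIndex {k : ℕ} {c : ℂ} {x y : ℂ⟦X⟧} (h : Cong k x y) :
    Cong k (divIndex c x) (divIndex c y) :=
  h.coeffwise _

/-- Solution of `X x' + c x - y = w` with `y` confined to the resonant degree. -/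
lemma exists_resonance (c : ℂ) : ∃ φ ψ : ℕ → ℂ → ℂ,
    (∀ w : ℂ⟦X⟧, X * derivative ℂ (coeffwise φ w) + C c * coeffwise φ w - coeffwise ψ w = w) ∧
    ∀ (w : ℂ⟦X⟧) (n : ℕ), (n : ℂ) + c ≠ 0 → coeff n (coeffwise ψ w) = 0 := by
  classical
  refine ⟨fun n r => if (n : ℂ) + c = 0 then 0 else r / (n + c),
    fun n r => if (n : ℂ) + c = 0 then -r else 0, fun w => ?_, fun w n hn => ?_⟩
  · ext n
    have e1 : ∀ x : ℂ⟦X⟧, coeff n (X * derivative ℂ x) = n * coeff n x := by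
      intro x
      rcases n with _ | n
      · simp
      · rw [coeff_succ_X_mul, coeff_derivative]; push_cast; ring
    rw [map_sub, map_add, e1, coeff_C_mul, coeff_coeffwise, coeff_coeffwise]
    split_ifs with h
    · simp
    · field_simp
      ring
  · rw [coeff_coeffwise, if_neg hn]

lemma X_mul_derivative_add_divIndex_one (w : ℂ⟦X⟧) :
    X * derivative ℂ (divIndex 1 w) + divIndex 1 w = w := by
  have := X_mul_derivative_divIndex (c := 1) (fun n => by exact_mod_cast n.succ_ne_zero) w
  rwa [map_one, one_mul] at this

/-- Normalization of `ε + λ t + …` up to resonances. -/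
theorem exists_gauge_linear (s : R⟦X⟧) (ε lam : ℂ) {b₀ b₁ b₂ : ℂ⟦X⟧} (h₀ : coeff 0 b₀ = ε)
    (h₁ : coeff 0 b₁ = lam) (h₂ : coeff 0 b₂ = 0) :
    ∃ (e θ : ℂ⟦X⟧) (T : Matrix (Fin 2) (Fin 2) R⟦X⟧), IsUnit T.det ∧
      (∀ n : ℕ, (n : ℂ) + (1 + lam) ≠ 0 → coeff n e = 0) ∧
      (∀ n : ℕ, (n : ℂ) + (1 - lam) ≠ 0 → coeff n θ = 0) ∧
      IsGauge 𝒟.d T (companionA 0) (companionA 0) ∧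
      IsZGauge T (companionB 𝒟.d s 0 (𝒟.quad b₀ b₁ b₂))
        (companionB 𝒟.d s 0 (𝒟.quad (C ε + X * e) (C lam) (X * θ))) := by
  obtain ⟨β₀, hβ₀⟩ := exists_eq_C_add_X_mul b₀
  obtain ⟨β₁, hβ₁⟩ := exists_eq_C_add_X_mul b₁
  obtain ⟨β₂, hβ₂⟩ := exists_eq_C_add_X_mul b₂
  rw [h₀] at hβ₀
  rw [h₁] at hβ₁
  rw [h₂, map_zero, zero_add] at hβ₂
  obtain ⟨φ₀, ψ₀, hr₀, hs₀⟩ := exists_resonance (1 + lam)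
  obtain ⟨φ₂, ψ₂, hr₂, hs₂⟩ := exists_resonance (1 - lam)
  let η : ℂ⟦X⟧ := C (1 / 2)
  -- The unknowns u 0, …, u 5 are p, c₀, c₁, c₂ and the resonant terms e, θ. The terms 2εc₂ in the
  -- equation for c₁ and εc₁ in the one for c₀ carry no factor z; solving in the order W₂, W₁, W₀
  -- and inserting the solved expressions keeps the map contracting. The indices for c₀, c₁, c₂ are
  -- n + 1 + λ, n + 1 and n + 1 - λ.
  let Q (u : Fin 6 → ℂ⟦X⟧) : ℂ⟦X⟧ :=
    divIndex 1 (η * β₁ * u 0 + X * (β₂ * u 1) - (C ε * u 3 + X * (u 4 * u 3)))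
  let P (u : Fin 6 → ℂ⟦X⟧) : ℂ⟦X⟧ := 1 + X * Q u
  let W₂ (u : Fin 6 → ℂ⟦X⟧) : ℂ⟦X⟧ :=
    -(β₂ * P u) + X * (u 5 * Q u + η * β₁ * u 3 - β₂ * u 2)
  let W₁ (u : Fin 6 → ℂ⟦X⟧) : ℂ⟦X⟧ := 2 * C ε * coeffwise φ₂ (W₂ u) - β₁ * P u
    + X * ((β₀ + u 4) * u 3 - (β₂ + u 5) * u 1 - η * β₁ * u 2)
  let W₀ (u : Fin 6 → ℂ⟦X⟧) : ℂ⟦X⟧ := C ε * divIndex 1 (W₁ u) - β₀ * P u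
    + X * (u 4 * u 2 + u 4 * Q u - η * β₁ * u 1)
  obtain ⟨u, hu⟩ := exists_fixedPoint (fun u : Fin 6 → ℂ⟦X⟧ =>
      ![P u, coeffwise φ₀ (W₀ u), divIndex 1 (W₁ u), coeffwise φ₂ (W₂ u), coeffwise ψ₀ (W₀ u),
        coeffwise ψ₂ (W₂ u)]) (by
    intro k u v h
    have hQ : Cong k (Q u) (Q v) :=
      ((((h 0).const_mul _).add ((((h 1).const_mul _).X_mul).mono)).sub
        (((h 3).const_mul _).add ((((h 4).mul (h 3)).X_mul).mono))).coeffwise _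
    have hP : Cong (k + 1) (P u) (P v) := (Cong.refl _ _).add hQ.X_mul
    have hW₂ : Cong (k + 1) (W₂ u) (W₂ v) := (hP.const_mul _).neg.add
      ((((h 5).mul hQ).add ((h 3).const_mul _)).sub ((h 2).const_mul _)).X_mul
    have hW₁ : Cong (k + 1) (W₁ u) (W₁ v) :=
      (((hW₂.coeffwise _).const_mul _).sub (hP.const_mul _)).add
      ((((((Cong.refl _ _).add (h 4)).mul (h 3)).sub (((Cong.refl _ _).add (h 5)).mul (h 1))).sub
        ((h 2).const_mul _)).X_mul)
    have hW₀ : Cong (k + 1) (W₀ u) (W₀ v) :=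
      (((hW₁.coeffwise _).const_mul _).sub (hP.const_mul _)).add
      (((((h 4).mul (h 2)).add ((h 4).mul hQ)).sub ((h 1).const_mul _)).X_mul)
    intro i
    fin_cases i
    exacts [hP, hW₀.coeffwise φ₀, cong_divIndex hW₁, hW₂.coeffwise φ₂, hW₀.coeffwise ψ₀,
      hW₂.coeffwise ψ₂])
  have u0 : P u = u 0 := congrFun hu 0
  have u1 : coeffwise φ₀ (W₀ u) = u 1 := congrFun hu 1
  have u2 : divIndex 1 (W₁ u) = u 2 := congrFun hu 2
  have u3 : coeffwise φ₂ (W₂ u) = u 3 := congrFun hu 3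
  have u4 : coeffwise ψ₀ (W₀ u) = u 4 := congrFun hu 4
  have u5 : coeffwise ψ₂ (W₂ u) = u 5 := congrFun hu 5
  have dp : derivative ℂ (u 0)
      = η * β₁ * u 0 + X * (β₂ * u 1) - (C ε * u 3 + X * (u 4 * u 3)) := by
    conv_lhs => rw [← u0]
    rw [map_add, derivative_X_mul_divIndex]
    simp
  have hXQ : X * Q u = u 0 - 1 := by rw [← u0]; ring
  have d0 := hr₀ (W₀ u)
  have d1 := X_mul_derivative_add_divIndex_one (W₁ u)
  have d2 := hr₂ (W₂ u)
  have hW2 : W₂ u = -(β₂ * u 0) + (u 5 * (u 0 - 1) + X * (η * β₁ * u 3 - β₂ * u 2)) := by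
    simp only [W₂]; rw [u0]; linear_combination u 5 * hXQ
  have hW1 : W₁ u = 2 * C ε * u 3 - β₁ * u 0
      + X * ((β₀ + u 4) * u 3 - (β₂ + u 5) * u 1 - η * β₁ * u 2) := by
    simp only [W₁]; rw [u0, u3]
  have hW0 : W₀ u = C ε * u 2 - β₀ * u 0 + (u 4 * (u 0 - 1) + X * (u 4 * u 2 - η * β₁ * u 1)) := by
    simp only [W₀]; rw [u0, u2]; linear_combination u 4 * hXQ
  rw [u1, u4, hW0, map_add, map_one] at d0
  rw [u2, hW1] at d1
  rw [u3, u5, hW2, map_sub, map_one] at d2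
  have h2 : 2 * η = 1 := by
    simp only [η]; rw [← map_ofNat (C (R := ℂ)) 2, ← map_mul]; norm_num
  obtain ⟨T, hT, hT₁, hT₂⟩ := 𝒟.exists_gauge_quad s (b₀ := b₀) (b₁ := b₁) (b₂ := b₂)
    (b₀' := C ε + X * u 4) (b₁' := C lam) (b₂' := X * u 5) (p := u 0) (c₀ := u 1) (c₁ := u 2)
    (c₂ := u 3) (by rw [← u0]; simp [P])
    (by rw [hβ₁, hβ₂]; change _ - η * _ * _ - _ + _ = _; linear_combination X * dp)
    (by rw [hβ₁, hβ₀]; change _ + η * _ * _ * _ + _ - _ = _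
        linear_combination X * d0 + X * C lam * u 1 * h2)
    (by rw [hβ₁, hβ₀, hβ₂]; change _ - _ + _ + η * _ * _ = _
        linear_combination X * d1 + X * β₁ * u 0 * h2)
    (by rw [hβ₁, hβ₂]; change _ - η * _ * _ * _ + _ + _ = _
        linear_combination X * d2 - X * C lam * u 3 * h2)
  exact ⟨u 4, u 5, T, hT, by rw [← u4]; exact hs₀ _, by rw [← u5]; exact hs₂ _, hT₁, hT₂⟩

/-- Normalization of `t² + …`. -/
theorem exists_gauge_square (s : R⟦X⟧) {b₀ b₁ b₂ : ℂ⟦X⟧} (h₀ : coeff 0 b₀ = 0)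
    (h₁ : coeff 0 b₁ = 0) (h₂ : coeff 0 b₂ = 1) :
    ∃ T : Matrix (Fin 2) (Fin 2) R⟦X⟧, IsUnit T.det ∧
      IsGauge 𝒟.d T (companionA 0) (companionA 0) ∧
      IsZGauge T (companionB 𝒟.d s 0 (𝒟.quad b₀ b₁ b₂))
        (companionB 𝒟.d s 0 (𝒟.quad 0 0 1)) := by
  obtain ⟨β₀, hβ₀⟩ := exists_eq_C_add_X_mul b₀
  obtain ⟨β₁, hβ₁⟩ := exists_eq_C_add_X_mul b₁
  obtain ⟨β₂, hβ₂⟩ := exists_eq_C_add_X_mul b₂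
  rw [h₀, map_zero, zero_add] at hβ₀
  rw [h₁, map_zero, zero_add] at hβ₁
  rw [h₂, map_one] at hβ₂
  let η : ℂ⟦X⟧ := C (1 / 2)
  -- Here λ = 0, so every index is n + 1 and there is no resonance. The leading coefficient 1 of b₂
  -- couples c₀ into c₁ and c₁ into c₂ without a factor z, so the order of solution is W₀, W₁, W₂,
  -- opposite to the linear case.
  let P (u : Fin 4 → ℂ⟦X⟧) : ℂ⟦X⟧ := 1 + X * divIndex 1 (η * β₁ * u 0 + b₂ * u 1)
  let W₀ (u : Fin 4 → ℂ⟦X⟧) : ℂ⟦X⟧ := -(β₀ * P u) - X * (η * β₁ * u 1)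
  let W₁ (u : Fin 4 → ℂ⟦X⟧) : ℂ⟦X⟧ := -(2 * divIndex 1 (W₀ u)) - β₁ * P u
    + X * (β₀ * u 3 - β₂ * u 1 - η * β₁ * u 2)
  let W₂ (u : Fin 4 → ℂ⟦X⟧) : ℂ⟦X⟧ := -divIndex 1 (W₁ u) - β₂ * P u
    + X * (η * β₁ * u 3 - β₂ * u 2)
  obtain ⟨u, hu⟩ := exists_fixedPoint (fun u : Fin 4 → ℂ⟦X⟧ =>
      ![P u, divIndex 1 (W₀ u), divIndex 1 (W₁ u), divIndex 1 (W₂ u)]) (by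
    intro k u v h
    have hP : Cong (k + 1) (P u) (P v) := (Cong.refl _ _).add
      ((((h 0).const_mul _).add ((h 1).const_mul _)).coeffwise _).X_mul
    have hW₀ : Cong (k + 1) (W₀ u) (W₀ v) :=
      (hP.const_mul _).neg.sub ((h 1).const_mul _).X_mul
    have hW₁ : Cong (k + 1) (W₁ u) (W₁ v) :=
      (((hW₀.coeffwise _).const_mul _).neg.sub (hP.const_mul _)).add
      ((((h 3).const_mul _).sub ((h 1).const_mul _)).sub ((h 2).const_mul _)).X_mul
    have hW₂ : Cong (k + 1) (W₂ u) (W₂ v) :=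
      ((hW₁.coeffwise _).neg.sub (hP.const_mul _)).add
      (((h 3).const_mul _).sub ((h 2).const_mul _)).X_mul
    intro i
    fin_cases i
    exacts [hP, cong_divIndex hW₀, cong_divIndex hW₁, cong_divIndex hW₂])
  have u0 : P u = u 0 := congrFun hu 0
  have u1 : divIndex 1 (W₀ u) = u 1 := congrFun hu 1
  have u2 : divIndex 1 (W₁ u) = u 2 := congrFun hu 2
  have u3 : divIndex 1 (W₂ u) = u 3 := congrFun hu 3
  have dp : derivative ℂ (u 0) = η * β₁ * u 0 + b₂ * u 1 := by
    conv_lhs => rw [← u0]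
    rw [map_add, derivative_X_mul_divIndex]
    simp
  have d0 := X_mul_derivative_add_divIndex_one (W₀ u)
  have d1 := X_mul_derivative_add_divIndex_one (W₁ u)
  have d2 := X_mul_derivative_add_divIndex_one (W₂ u)
  rw [u1] at d0
  rw [u2] at d1
  rw [u3] at d2
  simp only [W₀, u0] at d0
  simp only [W₁, u0, u1] at d1
  simp only [W₂, u0, u2] at d2
  have h2 : 2 * η = 1 := by
    simp only [η]; rw [← map_ofNat (C (R := ℂ)) 2, ← map_mul]; norm_num
  exact ⟨_, 𝒟.exists_gauge_quad s (b₀ := b₀) (b₁ := b₁) (b₂ := b₂)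
    (b₀' := 0) (b₁' := 0) (b₂' := 1) (p := u 0) (c₀ := u 1) (c₁ := u 2)
    (c₂ := u 3) (by rw [← u0]; simp [P])
    (by rw [hβ₁]; change _ - η * _ * _ - _ + _ = _; linear_combination X * dp)
    (by rw [hβ₁, hβ₀]; change _ + η * _ * _ * _ + _ - _ = _
        linear_combination X * d0)
    (by rw [hβ₁, hβ₀, hβ₂]; change _ - _ + _ + η * _ * _ = _
        linear_combination X * d1 + X * β₁ * u 0 * h2)
    (by rw [hβ₁, hβ₂]; change _ - η * _ * _ * _ + _ + _ = _
        linear_combination X * d2) |>.choose_spec⟩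

end DiscCalculus

end TEStructure

end

noncomputable section

namespace TEStructure

open TopologicalSpace (Opens)

/-! ### From matrices over `Holo U` to formal (TE)-structures -/

section Realization

open PowerSeries

variable {m r : ℕ}

/-- The function with values in matrices over `ℂ⟦z⟧` given by a matrix over `(Holo U)⟦z⟧`. -/
def realize {V : Type*} [NormedAddCommGroup V] [NormedSpace ℂ V] {U : Opens V}
    (M : Matrix (Fin r) (Fin r) (Holo U)⟦X⟧) (t : V) : ZMat r :=
  Matrix.of fun a b => PowerSeries.mk fun n => (coeff n (M a b)).fn t

lemma coeff_realize {V : Type*} [NormedAddCommGroup V] [NormedSpace ℂ V] {U : Opens V}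
    (M : Matrix (Fin r) (Fin r) (Holo U)⟦X⟧) (t : V) (a b : Fin r) (n : ℕ) :
    coeff n (realize M t a b) = (coeff n (M a b)).fn t := by
  simp [realize]

lemma realize_eq {V : Type*} [NormedAddCommGroup V] [NormedSpace ℂ V] {U : Opens V}
    (M : Matrix (Fin r) (Fin r) (Holo U)⟦X⟧) (x : U) :
    realize M (x : V) = (PowerSeries.map (Holo.eval x : Holo U →+* ℂ)).mapMatrix M := by
  ext a b n
  rw [coeff_realize]
  simp [Holo.eval_eq_fn]

lemma mapMatrix_smul {P Q : Type*} [CommRing P] [CommRing Q] (φ : P →+* Q) (x : P)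
    (M : Matrix (Fin r) (Fin r) P) : φ.mapMatrix (x • M) = φ x • φ.mapMatrix M := by
  ext a b
  simp

lemma isFormalHoloMat_realize {U : Opens (Base m)} (h0 : 0 ∈ U)
    (M : Matrix (Fin r) (Fin r) (Holo U)⟦X⟧) : IsFormalHoloMat (realize M) := fun a b =>
  ⟨U, U.isOpen.mem_nhds h0, fun n => by
    simp only [coeff_realize]
    exact (coeff n (M a b)).analytic_fn⟩

lemma pdMat_realize {U : Opens (Base m)} (M : Matrix (Fin r) (Fin r) (Holo U)⟦X⟧) (i : Fin m)
    (x : U) : pdMat i (realize M) (x : Base m)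
      = realize (M.map (liftD (Holo.pd (Pi.single i 1)))) (x : Base m) := by
  ext a b n
  rw [coeff_realize]
  simp only [pdMat, pd, Matrix.of_apply, coeff_mk, coeff_realize, Matrix.map_apply, coeff_liftD]
  rw [Holo.fn_pd _ _ x.2]

lemma dz_realize {V : Type*} [NormedAddCommGroup V] [NormedSpace ℂ V] {U : Opens V}
    (M : Matrix (Fin r) (Fin r) (Holo U)⟦X⟧) (x : U) :
    dz (realize M (x : V)) = realize (M.map (derivative (Holo U))) (x : V) := by
  ext a b n
  rw [realize_eq, realize_eq, dz]
  simp [coeff_derivative]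

/-- The flatness condition for a pair of directions. -/
def IsFlatPair {R : Type*} [CommRing R] [Algebra ℂ R] (d d' : Derivation ℂ R R)
    (A A' : Matrix (Fin 2) (Fin 2) R⟦X⟧) : Prop :=
  (X : R⟦X⟧) • A'.map (liftD d) - (X : R⟦X⟧) • A.map (liftD d') + (A * A' - A' * A) = 0

lemma IsFlatPair.realize {U : Opens (Base m)} {i j : Fin m}
    {A A' : Matrix (Fin 2) (Fin 2) (Holo U)⟦X⟧}
    (h : IsFlatPair (Holo.pd (Pi.single i 1)) (Holo.pd (Pi.single j 1)) A A') (x : U) :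
    z • pdMat i (realize A') x - z • pdMat j (TEStructure.realize A) x
      + (TEStructure.realize A x * TEStructure.realize A' x
        - TEStructure.realize A' x * TEStructure.realize A x) = 0 := by
  replace h := congrArg (PowerSeries.map (Holo.eval x : Holo U →+* ℂ)).mapMatrix h
  rw [pdMat_realize _ _ x, pdMat_realize _ _ x]
  simp only [realize_eq _ x]
  simpa only [map_add, map_sub, map_mul, mapMatrix_smul, PowerSeries.map_X, map_zero] using h

lemma IsFlat.realize {U : Opens (Base m)} {i : Fin m}
    {A B : Matrix (Fin 2) (Fin 2) (Holo U)⟦X⟧} (h : IsFlat (Holo.pd (Pi.single i 1)) A B) (x : U) :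
    z • pdMat i (realize B) x - z ^ 2 • dz (TEStructure.realize A x) + z • TEStructure.realize A x
      + (TEStructure.realize A x * TEStructure.realize B x
        - TEStructure.realize B x * TEStructure.realize A x) = 0 := by
  replace h := congrArg (PowerSeries.map (Holo.eval x : Holo U →+* ℂ)).mapMatrix h
  rw [pdMat_realize _ _ x, dz_realize _ x]
  simp only [realize_eq _ x]
  simpa only [map_add, map_sub, map_mul, mapMatrix_smul, PowerSeries.map_X, map_zero, map_pow]
    using h

/-- The structure given by holomorphic data on an open neighbourhood of the origin. -/
def ofHolo {U : Opens (Base m)} (h0 : 0 ∈ U) (A : Fin m → Matrix (Fin 2) (Fin 2) (Holo U)⟦X⟧)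
    (B : Matrix (Fin 2) (Fin 2) (Holo U)⟦X⟧)
    (hA : ∀ i j, IsFlatPair (Holo.pd (Pi.single i 1)) (Holo.pd (Pi.single j 1)) (A i) (A j))
    (hB : ∀ i, IsFlat (Holo.pd (Pi.single i 1)) (A i) B) : FormalTE m 2 where
  A i := realize (A i)
  B := realize B
  holoA i := isFormalHoloMat_realize h0 _
  holoB := isFormalHoloMat_realize h0 _
  flatA i j := by
    filter_upwards [U.isOpen.mem_nhds h0] with t ht using (hA i j).realize ⟨t, ht⟩
  flatB i := by
    filter_upwards [U.isOpen.mem_nhds h0] with t ht using (hB i).realize ⟨t, ht⟩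

lemma pdMat_congr {M N : Base m → ZMat r} {t : Base m} (h : M =ᶠ[𝓝 t] N) (i : Fin m) :
    pdMat i M t = pdMat i N t := by
  ext a b n
  simp only [pdMat, pd, Matrix.of_apply, coeff_mk]
  have : (fun s => coeff n (M s a b)) =ᶠ[𝓝 t] fun s => coeff n (N s a b) := by
    filter_upwards [h] with s hs using by rw [hs]
  rw [this.fderiv_eq]

lemma IsFormalHoloMat.eventually_analyticAt {M : Base m → ZMat r} (hM : IsFormalHoloMat M) :
    ∀ᶠ t in 𝓝 (0 : Base m), ∀ a b n, AnalyticAt ℂ (fun s => coeff n (M s a b)) t := by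
  rw [eventually_all]
  intro a
  rw [eventually_all]
  intro b
  obtain ⟨U, hU, h⟩ := hM a b
  filter_upwards [hU] with t ht n using h n t ht

lemma isFormalHoloMat_of_eventually {M : Base m → ZMat r}
    (h : ∀ᶠ t in 𝓝 (0 : Base m), ∀ a b n, AnalyticAt ℂ (fun s => coeff n (M s a b)) t) :
    IsFormalHoloMat M := fun a b => ⟨_, h, fun n _ ht => ht a b n⟩

/-- An isomorphism of structures in terms of the matrix `T ∘ h` instead of `T`. -/
lemma formallyIsomorphic_of {S S' : FormalTE m r} {h : Base m → Base m} {T : Base m → ZMat r}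
    (hh : IsBiholoGerm h) (hT : IsFormalHoloMat T) (hT0 : IsUnit (coeffZero (T 0)))
    (hA : ∀ i, ∀ᶠ t in 𝓝 (0 : Base m),
      z • pdMat i T t + (∑ j, k (pd i (fun s => h s j) t) • S.A j (h t)) * T t
        - T t * S'.A i t = 0)
    (hB : ∀ᶠ t in 𝓝 (0 : Base m), z ^ 2 • dz (T t) + S.B (h t) * T t - T t * S'.B t = 0) :
    FormallyIsomorphic S S' := by
  obtain ⟨hh1, hh0, g, hg, hg0, hgh, hhg⟩ := hh
  have e : ∀ᶠ t in 𝓝 (0 : Base m), T (g (h t)) = T t := hgh.mono fun t ht => by rw [ht]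
  -- A formal isomorphism uses T∘h; composing the given matrix with the inverse germ g makes T ∘ g ∘
  -- h agree with it near 0.
  refine ⟨h, T ∘ g, ⟨hh1, hh0, g, hg, hg0, hgh, hhg⟩, ?_, ?_, fun i => ?_, ?_⟩
  · apply isFormalHoloMat_of_eventually
    have h1 : ∀ᶠ t in 𝓝 (0 : Base m), ∀ a b n, AnalyticAt ℂ (fun s => coeff n (T s a b)) (g t) := by
      have := hg.continuousAt.tendsto
      rw [hg0] at this
      exact this.eventually hT.eventually_analyticAt
    filter_upwards [h1, hg.eventually_analyticAt] with t ht ht' a b n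
    exact (ht a b n).comp ht'
  · simpa [hg0] using hT0
  · filter_upwards [hA i, e, e.eventually_nhds] with t h1 h2 h3
    have h4 : ((T ∘ g) ∘ h) =ᶠ[𝓝 t] T := h3
    rw [pdMat_congr h4, Function.comp_apply, h2, h1]
  · filter_upwards [hB, e] with t h1 h2
    rw [Function.comp_apply, h2, h1]

lemma IsBiholoGerm.comp {h h' : Base m → Base m} (H : IsBiholoGerm h) (H' : IsBiholoGerm h') :
    IsBiholoGerm (h ∘ h') := by
  obtain ⟨a, a0, g, b, b0, c, d⟩ := H
  obtain ⟨a', a0', g', b', b0', c', d'⟩ := H'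
  have t1 : Tendsto h' (𝓝 0) (𝓝 0) := by simpa [a0'] using a'.continuousAt.tendsto
  have t2 : Tendsto g (𝓝 0) (𝓝 0) := by simpa [b0] using b.continuousAt.tendsto
  refine ⟨AnalyticAt.comp (by rwa [a0']) a', by simp [a0, a0'], g' ∘ g,
    AnalyticAt.comp (by rwa [b0]) b, by simp [b0, b0'], ?_, ?_⟩
  · filter_upwards [t1.eventually c, c'] with t h1 h2
    simp [h1, h2]
  · filter_upwards [t2.eventually d', d] with t h1 h2
    simp [h1, h2]

lemma pdMat_mul {M N : Base m → ZMat r} {t : Base m}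
    (hM : ∀ a b n, AnalyticAt ℂ (fun s => coeff n (M s a b)) t)
    (hN : ∀ a b n, AnalyticAt ℂ (fun s => coeff n (N s a b)) t) (i : Fin m) :
    pdMat i (fun s => M s * N s) t = pdMat i M t * N t + M t * pdMat i N t := by
  ext a b n
  have : HasFDerivAt (fun s => coeff n ((M s * N s) a b))
      (∑ c, ∑ p ∈ Finset.HasAntidiagonal.antidiagonal n,
        (coeff p.1 (M t a c) • fderiv ℂ (fun s => coeff p.2 (N s c b)) t
          + coeff p.2 (N t c b) • fderiv ℂ (fun s => coeff p.1 (M s a c)) t)) t := by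
    simp only [Matrix.mul_apply, map_sum, coeff_mul]
    exact HasFDerivAt.fun_sum fun c _ => HasFDerivAt.fun_sum fun p _ =>
      (hM a c p.1).differentiableAt.hasFDerivAt.mul (hN c b p.2).differentiableAt.hasFDerivAt
  rw [pdMat, Matrix.of_apply, coeff_mk, pd, this.fderiv]
  simp only [sum_apply, Matrix.add_apply, Matrix.mul_apply, map_add, map_sum,
    coeff_mul, pdMat, Matrix.of_apply, coeff_mk, pd]
  rw [← Finset.sum_add_distrib]
  refine Finset.sum_congr rfl fun c _ => ?_
  rw [← Finset.sum_add_distrib]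
  refine Finset.sum_congr rfl fun p _ => ?_
  simp
  ring

lemma sum_pd_single {f : Base m → ℂ} {t : Base m} (v : Base m) :
    fderiv ℂ f t v = ∑ j, v j * pd j f t := by
  conv_lhs => rw [← Finset.univ_sum_single v, map_sum]
  refine Finset.sum_congr rfl fun j _ => ?_
  rw [pd, ← smul_eq_mul, ← map_smul, ← Pi.single_smul, smul_eq_mul, mul_one]

lemma pd_comp {f : Base m → ℂ} {h : Base m → Base m} {t : Base m}
    (hf : DifferentiableAt ℂ f (h t)) (hh : DifferentiableAt ℂ h t) (i : Fin m) :
    pd i (fun s => f (h s)) t = ∑ j, pd i (fun s => h s j) t * pd j f (h t) := by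
  have e : fderiv ℂ (fun s => f (h s)) t = (fderiv ℂ f (h t)).comp (fderiv ℂ h t) :=
    fderiv_comp t hf hh
  rw [pd, e, ContinuousLinearMap.comp_apply, sum_pd_single]
  refine Finset.sum_congr rfl fun j _ => ?_
  congr 1
  have : HasFDerivAt (fun s => h s j) ((ContinuousLinearMap.proj j).comp (fderiv ℂ h t)) t :=
    (ContinuousLinearMap.proj (R := ℂ) (φ := fun _ : Fin m => ℂ) j).hasFDerivAt.comp t
      hh.hasFDerivAt
  rw [pd, this.fderiv]
  rfl

lemma pdMat_comp {M : Base m → ZMat r} {h : Base m → Base m} {t : Base m}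
    (hM : ∀ a b n, AnalyticAt ℂ (fun s => coeff n (M s a b)) (h t)) (hh : AnalyticAt ℂ h t)
    (i : Fin m) :
    pdMat i (fun s => M (h s)) t = ∑ j, k (pd i (fun s => h s j) t) • pdMat j M (h t) := by
  ext a b n
  rw [pdMat, Matrix.of_apply, coeff_mk, pd_comp (hM a b n).differentiableAt hh.differentiableAt]
  simp [Matrix.sum_apply, pdMat]

lemma dz_mul (M N : ZMat r) : dz (M * N) = dz M * N + M * dz N :=
  map_derivation_mul _ M N

/-- Formal isomorphisms compose. -/
theorem FormallyIsomorphic.trans {S S' S'' : FormalTE m r} (H : FormallyIsomorphic S S')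
    (H' : FormallyIsomorphic S' S'') : FormallyIsomorphic S S'' := by
  obtain ⟨h, T, hh, hT, hT0, hA, hB⟩ := H
  obtain ⟨h', T', hh', hT', hT0', hA', hB'⟩ := H'
  have tt : ∀ {g : Base m → Base m}, IsBiholoGerm g → Tendsto g (𝓝 0) (𝓝 0) := fun hg => by
    simpa [hg.2.1] using hg.1.continuousAt.tendsto
  have an : ∀ᶠ t in 𝓝 (0 : Base m), ∀ a b n, AnalyticAt ℂ (fun s => coeff n ((T ∘ h) s a b)) t := by
    filter_upwards [(tt hh).eventually hT.eventually_analyticAt, hh.1.eventually_analyticAt] with t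
      h1 h2 a b n using (h1 a b n).comp h2
  have an₁ : ∀ᶠ t in 𝓝 (0 : Base m),
      ∀ a b n, AnalyticAt ℂ (fun s => coeff n ((T ∘ h) (h' s) a b)) t := by
    filter_upwards [(tt hh').eventually an, hh'.1.eventually_analyticAt] with t
      h1 h2 a b n using (h1 a b n).comp h2
  have an₂ : ∀ᶠ t in 𝓝 (0 : Base m),
      ∀ a b n, AnalyticAt ℂ (fun s => coeff n ((T' ∘ h') s a b)) t := by
    filter_upwards [(tt hh').eventually hT'.eventually_analyticAt, hh'.1.eventually_analyticAt]
      with t h1 h2 a b n using (h1 a b n).comp h2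
  refine formallyIsomorphic_of (h := h ∘ h') (T := fun s => (T ∘ h) (h' s) * (T' ∘ h') s)
    (hh.comp hh') (isFormalHoloMat_of_eventually ?_) ?_ (fun i => ?_) ?_
  · filter_upwards [an₁, an₂] with t h1 h2 a b n
    simp only [Matrix.mul_apply, map_sum, coeff_mul]
    exact Finset.analyticAt_fun_sum _ fun c _ => Finset.analyticAt_fun_sum _ fun p _ =>
      (h1 a c p.1).mul (h2 c b p.2)
  · have e : coeffZero (T 0 * T' 0) = coeffZero (T 0) * coeffZero (T' 0) :=
      map_mul (PowerSeries.constantCoeff (R := ℂ)).mapMatrix (T 0) (T' 0)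
    simp only [Function.comp_apply, hh'.2.1, hh.2.1, e]
    exact hT0.mul hT0'
  · filter_upwards [an₁, an₂, hA' i, (tt hh').eventually (eventually_all.2 hA),
      hh'.1.eventually_analyticAt, (tt hh').eventually an,
      (tt hh').eventually hh.1.eventually_analyticAt] with t a1 a2 h1 h2 h3 h4 h5
    rw [pdMat_mul a1 a2, pdMat_comp h4 h3]
    have e1 : ∀ l, pd i (fun s => (h ∘ h') s l) t
        = ∑ j, pd i (fun s => h' s j) t * pd j (fun s => h s l) (h' t) := fun l =>
      pd_comp (f := fun s => h s l) (differentiableAt_pi.1 h5.differentiableAt l)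
        h3.differentiableAt i
    simp only [e1, map_sum, map_mul, Finset.sum_smul]
    rw [Finset.sum_comm]
    simp only [Function.comp_apply]
    simp only [mul_smul, ← Finset.smul_sum]
    have e2 : ∀ j, z • pdMat j (T ∘ h) (h' t) = T (h (h' t)) * S'.A j (h' t)
        - (∑ l, k (pd j (fun s => h s l) (h' t)) • S.A l (h (h' t))) * T (h (h' t)) := fun j => by
      rw [← sub_eq_zero, ← h2 j]; abel
    have e3 : z • ∑ j, k (pd i (fun s => h' s j) t) • pdMat j (T ∘ h) (h' t)
        = T (h (h' t)) * (∑ j, k (pd i (fun s => h' s j) t) • S'.A j (h' t))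
          - (∑ j, k (pd i (fun s => h' s j) t) •
            ∑ l, k (pd j (fun s => h s l) (h' t)) • S.A l (h (h' t))) * T (h (h' t)) := by
      rw [Finset.mul_sum, Finset.sum_mul, ← Finset.sum_sub_distrib, Finset.smul_sum]
      refine Finset.sum_congr rfl fun j _ => ?_
      rw [smul_comm, e2, smul_sub, Matrix.mul_smul, Matrix.smul_mul]
    have e4 : z • pdMat i (T' ∘ h') t = T' (h' t) * S''.A i t
        - (∑ j, k (pd i (fun s => h' s j) t) • S'.A j (h' t)) * T' (h' t) := by
      rw [← sub_eq_zero, ← h1]; abel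
    rw [smul_add, ← Matrix.smul_mul, ← Matrix.mul_smul, e3, e4]
    noncomm_ring
  · filter_upwards [hB', (tt hh').eventually hB] with t h1 h2
    simp only [Function.comp_apply, dz_mul]
    have e2 : z ^ 2 • dz (T (h (h' t))) = T (h (h' t)) * S'.B (h' t)
        - S.B (h (h' t)) * T (h (h' t)) := by
      rw [← sub_eq_zero, ← h2]; abel
    have e4 : z ^ 2 • dz (T' (h' t)) = T' (h' t) * S''.B t - S'.B (h' t) * T' (h' t) := by
      rw [← sub_eq_zero, ← h1]; abel
    rw [smul_add, ← Matrix.smul_mul, ← Matrix.mul_smul, e2, e4]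
    noncomm_ring

lemma isBiholoGerm_id : IsBiholoGerm (id : Base m → Base m) :=
  ⟨analyticAt_id, rfl, id, analyticAt_id, rfl, by simp, by simp⟩

lemma pdMat_const (i : Fin m) (M : ZMat r) (t : Base m) : pdMat i (fun _ => M) t = 0 := by
  ext a b n
  simp [pdMat, pd]

lemma sum_pd_id (i : Fin m) (A : Fin m → ZMat r) (t : Base m) :
    ∑ j, k (pd i (fun s => id s j) t) • A j = A i := by
  have e : ∀ j, pd i (fun s : Base m => id s j) t = (Pi.single i 1 : Base m) j := fun j => by
    have : HasFDerivAt (fun s : Base m => id s j)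
      (ContinuousLinearMap.proj (R := ℂ) (φ := fun _ : Fin m => ℂ) j) t :=
      (ContinuousLinearMap.proj (R := ℂ) (φ := fun _ : Fin m => ℂ) j).hasFDerivAt
    rw [pd, this.fderiv]; rfl
  simp only [e]
  rw [Finset.sum_eq_single i]
  · simp
  · intro j _ hj; simp [hj]
  · simp

/-- Structures which agree near the origin are isomorphic. -/
lemma formallyIsomorphic_of_eventuallyEq {S S' : FormalTE m r}
    (hA : ∀ i, S.A i =ᶠ[𝓝 0] S'.A i) (hB : S.B =ᶠ[𝓝 0] S'.B) : FormallyIsomorphic S S' := by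
  refine formallyIsomorphic_of (h := id) (T := fun _ => 1) isBiholoGerm_id
    (fun a b => ⟨Set.univ, Filter.univ_mem, fun n => analyticOnNhd_const⟩) ?_ (fun i => ?_) ?_
  · have : coeffZero (1 : ZMat r) = 1 := map_one (PowerSeries.constantCoeff (R := ℂ)).mapMatrix
    simp [this]
  · filter_upwards [hA i] with t ht
    rw [pdMat_const, sum_pd_id, id, ht]
    simp
  · filter_upwards [hB] with t ht
    have : dz (1 : ZMat r) = 0 := by
      ext a b n
      by_cases hab : a = b <;> simp [dz, hab]
    rw [this, id, ht]
    simp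

end Realization

end TEStructure

end

noncomputable section

namespace TEStructure

open TopologicalSpace (Opens)

open PowerSeries

/-- An isomorphism given by matrices over `(Holo W)⟦z⟧`. -/
theorem formallyIsomorphic_of_realize {m : ℕ} {S S' : FormalTE m 2} {W : Opens (Base m)}
    (h0 : 0 ∈ W) {h : Base m → Base m} (hh : IsBiholoGerm h)
    {T B B' : Matrix (Fin 2) (Fin 2) (Holo W)⟦X⟧} (hT : IsUnit T.det)
    {A A' : Fin m → Matrix (Fin 2) (Fin 2) (Holo W)⟦X⟧} {c : Fin m → Fin m → Holo W}
    (hc : ∀ i j, ∀ t ∈ W, (c i j).fn t = pd i (fun s => h s j) t)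
    (hA : ∀ j, ∀ t ∈ W, S.A j (h t) = realize (A j) t) (hB : ∀ t ∈ W, S.B (h t) = realize B t)
    (hA' : ∀ j, ∀ t ∈ W, S'.A j t = realize (A' j) t) (hB' : ∀ t ∈ W, S'.B t = realize B' t)
    (gA : ∀ i, IsGauge (Holo.pd (Pi.single i 1)) T (∑ j, C (c i j) • A j) (A' i))
    (gB : IsZGauge T B B') : FormallyIsomorphic S S' := by
  refine formallyIsomorphic_of (T := realize T) hh (isFormalHoloMat_realize h0 T) ?_
    (fun i => ?_) ?_
  · have e : coeffZero (realize T 0) = ((PowerSeries.constantCoeff (R := ℂ)).comp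
        (PowerSeries.map (Holo.eval ⟨0, h0⟩ : Holo W →+* ℂ))).mapMatrix T := by
      have := realize_eq T ⟨0, h0⟩
      rw [show realize T 0 = _ from this]
      rfl
    rw [e]
    exact ((Matrix.isUnit_iff_isUnit_det T).2 hT).map _
  · filter_upwards [W.isOpen.mem_nhds h0] with t ht
    have g := congrArg (PowerSeries.map (Holo.eval ⟨t, ht⟩ : Holo W →+* ℂ)).mapMatrix (gA i)
    simp only [map_add, map_mul, mapMatrix_smul, PowerSeries.map_X, map_sum,
      PowerSeries.map_C] at g
    rw [sub_eq_zero, pdMat_realize _ _ ⟨t, ht⟩, hA' i t ht]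
    simp only [hA _ t ht, ← hc i _ t ht]
    simp only [realize_eq _ (⟨t, ht⟩ : W)]
    rw [← g]
    simp only [RingHom.coe_coe, Holo.eval_eq_fn]
  · filter_upwards [W.isOpen.mem_nhds h0] with t ht
    have g := congrArg (PowerSeries.map (Holo.eval ⟨t, ht⟩ : Holo W →+* ℂ)).mapMatrix gB
    simp only [map_add, map_mul, mapMatrix_smul, PowerSeries.map_X, map_pow] at g
    rw [sub_eq_zero, dz_realize _ ⟨t, ht⟩, hB' t ht, hB t ht]
    simp only [realize_eq _ (⟨t, ht⟩ : W)]
    rw [← g]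

/-! ### Structures over two variables built from data in t₂ alone -/

section OneVariable

/-- The set of points whose second coordinate lies in `U`. -/
def cylinder (U : Opens ℂ) : Opens (Base 2) :=
  ⟨{t | t 1 ∈ U}, U.isOpen.preimage (continuous_apply 1)⟩

lemma mem_cylinder {U : Opens ℂ} {t : Base 2} : t ∈ cylinder U ↔ t 1 ∈ U := Iff.rfl

lemma analyticOnNhd_apply (i : Fin 2) (s : Set (Base 2)) :
    AnalyticOnNhd ℂ (fun t : Base 2 => t i) s := fun t _ =>
  (ContinuousLinearMap.proj (R := ℂ) (φ := fun _ : Fin 2 => ℂ) i).analyticAt t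

/-- A function of the second coordinate as a function of both. -/
def inflate (U : Opens ℂ) : Holo U →ₐ[ℂ] Holo (cylinder U) :=
  Holo.comp (fun t : Base 2 => t 1) (analyticOnNhd_apply 1 _) fun _ h => mem_cylinder.1 h

lemma fn_inflate {U : Opens ℂ} (f : Holo U) (t : Base 2) : (inflate U f).fn t = f.fn (t 1) := by
  by_cases h : t 1 ∈ U
  · exact Holo.fn_comp _ _ f (x := t) h
  · rw [Holo.fn_of_notMem _ h, Holo.fn_of_notMem _ (mem_cylinder.not.2 h)]

/-- The coordinate functions. -/
def coord {W : Opens (Base 2)} (i : Fin 2) : Holo W := Holo.mk _ (analyticOnNhd_apply i _)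

lemma fderiv_apply_base (i : Fin 2) (t v : Base 2) :
    fderiv ℂ (fun t : Base 2 => t i) t v = v i := by
  have : HasFDerivAt (fun t : Base 2 => t i)
      (ContinuousLinearMap.proj (R := ℂ) (φ := fun _ : Fin 2 => ℂ) i) t :=
    (ContinuousLinearMap.proj (R := ℂ) (φ := fun _ : Fin 2 => ℂ) i).hasFDerivAt
  rw [this.fderiv]
  rfl

lemma pd_inflate {U : Opens ℂ} (f : Holo U) (v : Base 2) :
    Holo.pd v (inflate U f) = v 1 • inflate U (Holo.pd 1 f) := by
  apply Holo.eq_of_fn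
  intro x hx
  rw [inflate, Holo.fn_pd_comp _ _ _ _ hx, fderiv_apply_base, Holo.fn_smul,
    Holo.fn_comp _ _ _ hx, Holo.fn_pd _ _ (mem_cylinder.1 hx), ← smul_eq_mul, ← map_smul, smul_eq_mul, mul_one]

lemma pd_coord {W : Opens (Base 2)} (i : Fin 2) (v : Base 2) :
    Holo.pd v (coord i : Holo W) = algebraMap ℂ _ (v i) := by
  apply Holo.eq_of_fn
  intro x hx
  have : (coord i : Holo W).fn =ᶠ[𝓝 x] fun t => t i := by
    filter_upwards [W.isOpen.mem_nhds hx] with y hy using Holo.fn_mk _ _ hy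
  rw [Holo.fn_pd _ _ hx, this.fderiv_eq, fderiv_apply_base, Holo.fn_algebraMap _ hx]

section Generic

variable {R R' : Type*} [CommRing R] [Algebra ℂ R] [CommRing R'] [Algebra ℂ R']
  {d : Derivation ℂ R R} {d₀ d₁ : Derivation ℂ R' R'} {σ : R →ₐ[ℂ] R'} {τ : R'}

lemma isFlatPair_one_left {A : Matrix (Fin 2) (Fin 2) R⟦X⟧} (h₀ : ∀ f, d₀ (σ f) = 0) :
    IsFlatPair d₀ d₁ 1 ((PowerSeries.map (σ : R →+* R')).mapMatrix A) := by
  rw [IsFlatPair]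
  ext i j n
  rcases n with _ | n
  · simp
  · by_cases hij : i = j <;> simp [hij, h₀, coeff_succ_X_mul]

lemma isFlatPair_one_right {A : Matrix (Fin 2) (Fin 2) R⟦X⟧} (h₀ : ∀ f, d₀ (σ f) = 0) :
    IsFlatPair d₁ d₀ ((PowerSeries.map (σ : R →+* R')).mapMatrix A) 1 := by
  rw [IsFlatPair]
  ext i j n
  rcases n with _ | n
  · simp
  · by_cases hij : i = j <;> simp [hij, h₀, coeff_succ_X_mul]

lemma isFlatPair_self (A : Matrix (Fin 2) (Fin 2) R⟦X⟧) : IsFlatPair d d A A := by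
  simp [IsFlatPair]

/-- In the direction of d₀ only -τ varies, and its derivative -1 cancels the term zA with A = 1. -/
lemma isFlat_one_sub {B : Matrix (Fin 2) (Fin 2) R⟦X⟧} (h₀ : ∀ f, d₀ (σ f) = 0) (hτ : d₀ τ = 1) :
    IsFlat d₀ 1 ((PowerSeries.map (σ : R →+* R')).mapMatrix B - C τ • 1) := by
  rw [IsFlat]
  ext i j n
  rcases n with _ | n
  · simp
  · by_cases hij : i = j <;> simp [hij, h₀, hτ, coeff_succ_X_mul, pow_two, coeff_X, coeff_one]

lemma IsFlat.sub_smul_one {A B : Matrix (Fin 2) (Fin 2) R'⟦X⟧} (hτ : d₁ τ = 0)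
    (h : IsFlat d₁ A B) : IsFlat d₁ A (B - C τ • 1) := by
  have e : (C τ • (1 : Matrix (Fin 2) (Fin 2) R'⟦X⟧)).map (liftD d₁) = 0 := by
    ext1 i j
    by_cases hij : i = j <;> simp [hij, hτ]
  rw [IsFlat] at h
  rw [IsFlat, map_derivation_sub, e, sub_zero]
  refine Eq.trans ?_ h
  simp [mul_sub, sub_mul]

lemma IsFlat.mapMatrix {A B : Matrix (Fin 2) (Fin 2) R⟦X⟧} (h₁ : ∀ f, d₁ (σ f) = σ (d f))
    (h : IsFlat d A B) : IsFlat d₁ ((PowerSeries.map (σ : R →+* R')).mapMatrix A)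
      ((PowerSeries.map (σ : R →+* R')).mapMatrix B) := by
  have := h.pullback σ 1 (d' := d₁) (by simpa using h₁)
  rwa [map_one, one_smul] at this

end Generic

lemma pd_zero_inflate {U : Opens ℂ} (f : Holo U) :
    Holo.pd (Pi.single 0 1) (inflate U f) = 0 := by
  rw [pd_inflate]; simp

lemma pd_one_inflate {U : Opens ℂ} (f : Holo U) :
    Holo.pd (Pi.single 1 1) (inflate U f) = inflate U (Holo.pd 1 f) := by
  rw [pd_inflate]; simp

/-- Inflation of matrices of power series. -/
def inflateMat (U : Opens ℂ) : Matrix (Fin 2) (Fin 2) (Holo U)⟦X⟧ →+*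
    Matrix (Fin 2) (Fin 2) (Holo (cylinder U))⟦X⟧ :=
  (PowerSeries.map (inflate U : Holo U →+* Holo (cylinder U))).mapMatrix

/-- The matrix `-t₁ + β(t₂)`. -/
def shiftB {U : Opens ℂ} (β : Matrix (Fin 2) (Fin 2) (Holo U)⟦X⟧) :
    Matrix (Fin 2) (Fin 2) (Holo (cylinder U))⟦X⟧ :=
  inflateMat U β - C (coord 0 : Holo (cylinder U)) • 1

/-- The structure with `A₁ = 1`, `A₂ = A(t₂)` and `B = -t₁ + β(t₂)`. -/
def ofOneVar {U : Opens ℂ} (h0 : 0 ∈ U) (A β : Matrix (Fin 2) (Fin 2) (Holo U)⟦X⟧)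
    (h : IsFlat (Holo.pd 1) A β) : FormalTE 2 2 :=
  ofHolo (U := cylinder U) h0 ![1, inflateMat U A] (shiftB β)
    (by
      intro i j
      fin_cases i <;> fin_cases j
      · exact isFlatPair_self _
      · exact isFlatPair_one_left pd_zero_inflate
      · exact isFlatPair_one_right pd_zero_inflate
      · exact isFlatPair_self _)
    (by
      intro i
      fin_cases i
      · exact isFlat_one_sub pd_zero_inflate (by rw [pd_coord]; simp)
      · exact (h.mapMatrix pd_one_inflate).sub_smul_one (by rw [pd_coord]; simp))

lemma realize_inflateMat {U : Opens ℂ} (M : Matrix (Fin 2) (Fin 2) (Holo U)⟦X⟧) (t : Base 2) :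
    realize (inflateMat U M) t = realize M (t 1) := by
  ext a b n
  rw [coeff_realize, coeff_realize, ← fn_inflate]
  rfl

lemma realize_shiftB {U : Opens ℂ} (β : Matrix (Fin 2) (Fin 2) (Holo U)⟦X⟧) {t : Base 2}
    (ht : t 1 ∈ U) : realize (shiftB β) t = realize β (t 1) - k (t 0) • 1 := by
  rw [← mem_cylinder] at ht
  rw [show realize (shiftB β) t = _ from realize_eq _ (⟨t, ht⟩ : cylinder U), shiftB, map_sub,
    mapMatrix_smul, map_one, ← realize_eq, realize_inflateMat, PowerSeries.map_C, RingHom.coe_coe,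
    Holo.eval_eq_fn, coord, Holo.fn_mk _ _ ht]

section

variable {U : Opens ℂ} {h0 : 0 ∈ U} {A β : Matrix (Fin 2) (Fin 2) (Holo U)⟦X⟧}
  {h : IsFlat (Holo.pd 1) A β}

lemma ofOneVar_A_one (t : Base 2) : (ofOneVar h0 A β h).A 1 t = realize A (t 1) :=
  realize_inflateMat A t

lemma ofOneVar_A_zero {t : Base 2} (ht : t 1 ∈ U) : (ofOneVar h0 A β h).A 0 t = 1 := by
  have : realize (1 : Matrix (Fin 2) (Fin 2) (Holo (cylinder U))⟦X⟧) t = 1 := by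
    rw [show realize (1 : Matrix (Fin 2) (Fin 2) (Holo (cylinder U))⟦X⟧) t = _ from
      realize_eq _ (⟨t, ht⟩ : cylinder U), map_one]
  exact this

lemma ofOneVar_B {t : Base 2} (ht : t 1 ∈ U) :
    (ofOneVar h0 A β h).B t = realize β (t 1) - k (t 0) • 1 := by
  exact realize_shiftB β ht

end

/-- A biholomorphic germ of one variable. -/
lemma exists_local_inverse {h : ℂ → ℂ} (hh : AnalyticAt ℂ h 0) (h0 : h 0 = 0)
    (h' : deriv h 0 ≠ 0) : ∃ g : ℂ → ℂ, AnalyticAt ℂ g 0 ∧ g 0 = 0 ∧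
      (∀ᶠ t in 𝓝 0, g (h t) = t) ∧ ∀ᶠ t in 𝓝 0, h (g t) = t := by
  have := hh.analyticAt_localInverse h'
  rw [h0] at this
  refine ⟨_, this, ?_, hh.hasStrictDerivAt.eventually_left_inverse h', ?_⟩
  · have := HasStrictFDerivAt.localInverse_apply_image
      (hh.hasStrictDerivAt.hasStrictFDerivAt_equiv h')
    rw [h0] at this
    exact this
  · have := hh.hasStrictDerivAt.eventually_right_inverse h'
    rwa [h0] at this

lemma analyticAt_pair {g : ℂ → ℂ} {t : Base 2} (hg : AnalyticAt ℂ g (t 1)) :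
    AnalyticAt ℂ (fun t : Base 2 => (![t 0, g (t 1)] : Base 2)) t := by
  rw [analyticAt_pi_iff]
  intro i
  fin_cases i
  · exact analyticOnNhd_apply 0 Set.univ t (Set.mem_univ _)
  · exact AnalyticAt.comp (g := g) hg (analyticOnNhd_apply 1 Set.univ t (Set.mem_univ _))

lemma isBiholoGerm_pair {h : ℂ → ℂ} (hh : AnalyticAt ℂ h 0) (h0 : h 0 = 0)
    (h' : deriv h 0 ≠ 0) : IsBiholoGerm (fun t : Base 2 => (![t 0, h (t 1)] : Base 2)) := by
  obtain ⟨g, hg, g0, hgh, hhg⟩ := exists_local_inverse hh h0 h'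
  have tt : Tendsto (fun t : Base 2 => t 1) (𝓝 0) (𝓝 0) :=
    (continuous_apply (A := fun _ : Fin 2 => ℂ) 1).tendsto 0
  refine ⟨analyticAt_pair hh, ?_, _, analyticAt_pair hg, ?_, ?_, ?_⟩
  · ext i; fin_cases i <;> simp [h0]
  · ext i; fin_cases i <;> simp [g0]
  · filter_upwards [tt.eventually hgh] with t ht
    ext i; fin_cases i <;> simp [ht]
  · filter_upwards [tt.eventually hhg] with t ht
    ext i; fin_cases i <;> simp [ht]

lemma pd_pair {h : ℂ → ℂ} {t : Base 2} (hh : DifferentiableAt ℂ h (t 1)) (i j : Fin 2) :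
    pd i (fun s : Base 2 => (![s 0, h (s 1)] : Base 2) j) t
      = if i = j then (if i = 0 then 1 else deriv h (t 1)) else 0 := by
  fin_cases j
  · simp only [Fin.zero_eta, Matrix.cons_val_zero, pd, fderiv_apply_base]
    fin_cases i <;> simp
  · simp only [Fin.mk_one, Matrix.cons_val_one, Matrix.cons_val_zero, pd]
    have e : fderiv ℂ (fun s : Base 2 => h (s 1)) t
        = (fderiv ℂ h (t 1)).comp (fderiv ℂ (fun s : Base 2 => s 1) t) :=
      fderiv_comp t hh (analyticOnNhd_apply 1 Set.univ t (Set.mem_univ _)).differentiableAt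
    rw [e, ContinuousLinearMap.comp_apply, fderiv_apply_base]
    fin_cases i <;> simp

lemma sum_smul_pair {R : Type*} [CommRing R] (h₁ : R) (A : Fin 2 → Matrix (Fin 2) (Fin 2) R⟦X⟧)
    (i : Fin 2) : ∑ j, C (if i = j then (if i = 0 then 1 else h₁) else 0) • A j
      = C (if i = 0 then 1 else h₁) • A i := by
  fin_cases i <;> simp

section Generic

variable {R R' : Type*} [CommRing R] [Algebra ℂ R] [CommRing R'] [Algebra ℂ R']
  {d : Derivation ℂ R R} {d₀ d₁ : Derivation ℂ R' R'} {σ : R →ₐ[ℂ] R'} {τ : R'}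

lemma IsGauge.mapMatrix {T A A' : Matrix (Fin 2) (Fin 2) R⟦X⟧} (h₁ : ∀ f, d₁ (σ f) = σ (d f))
    (h : IsGauge d T A A') : IsGauge d₁ ((PowerSeries.map (σ : R →+* R')).mapMatrix T)
      ((PowerSeries.map (σ : R →+* R')).mapMatrix A)
      ((PowerSeries.map (σ : R →+* R')).mapMatrix A') := by
  have e : ((PowerSeries.map (σ : R →+* R')).mapMatrix T).map (liftD d₁)
      = (PowerSeries.map (σ : R →+* R')).mapMatrix (T.map (liftD d)) := by
    ext i j n; simp [h₁]
  have := congrArg (PowerSeries.map (σ : R →+* R')).mapMatrix h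
  rw [map_add, mapMatrix_smul, PowerSeries.map_X, map_mul, map_mul] at this
  rw [IsGauge, e, this]

lemma IsZGauge.mapMatrix {T B B' : Matrix (Fin 2) (Fin 2) R⟦X⟧}
    (h : IsZGauge T B B') : IsZGauge ((PowerSeries.map (σ : R →+* R')).mapMatrix T)
      ((PowerSeries.map (σ : R →+* R')).mapMatrix B)
      ((PowerSeries.map (σ : R →+* R')).mapMatrix B') := by
  have e : ((PowerSeries.map (σ : R →+* R')).mapMatrix T).map (derivative R')
      = (PowerSeries.map (σ : R →+* R')).mapMatrix (T.map (derivative R)) := by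
    ext i j n; simp [coeff_derivative]
  have := congrArg (PowerSeries.map (σ : R →+* R')).mapMatrix h
  rw [map_add, mapMatrix_smul, map_pow, PowerSeries.map_X, map_mul, map_mul] at this
  rw [IsZGauge, e, this]

lemma IsZGauge.sub_smul_one {P : Type*} [CommRing P] {T B B' : Matrix (Fin 2) (Fin 2) P⟦X⟧}
    (h : IsZGauge T B B') (c : P⟦X⟧) :
    IsZGauge T (B - c • 1) (B' - c • 1) := by
  rw [IsZGauge] at h ⊢
  simp only [sub_mul, mul_sub, ← h, Matrix.smul_mul, Matrix.mul_smul, one_mul, mul_one]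
  abel

lemma isGauge_one {T : Matrix (Fin 2) (Fin 2) R⟦X⟧} (h₀ : ∀ f, d₀ (σ f) = 0) :
    IsGauge d₀ ((PowerSeries.map (σ : R →+* R')).mapMatrix T) 1 1 := by
  have e : ((PowerSeries.map (σ : R →+* R')).mapMatrix T).map (liftD d₀) = 0 := by
    ext i j n; simp [h₀]
  rw [IsGauge, e]; simp

end Generic

/-- An isomorphism in one variable yields one in two variables. -/
theorem formallyIsomorphic_ofOneVar {U W : Opens ℂ} {hU : 0 ∈ U} {hW : 0 ∈ W}
    {A β : Matrix (Fin 2) (Fin 2) (Holo U)⟦X⟧} {A' β' : Matrix (Fin 2) (Fin 2) (Holo W)⟦X⟧}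
    {hf : IsFlat (Holo.pd 1) A β} {hf' : IsFlat (Holo.pd 1) A' β'}
    {h : ℂ → ℂ} (hh : AnalyticOnNhd ℂ h W) (h0 : h 0 = 0) (h' : deriv h 0 ≠ 0)
    (hWU : ∀ x ∈ W, h x ∈ U)
    {σ : Holo U →ₐ[ℂ] Holo W} (hσ : ∀ f, ∀ x ∈ W, (σ f).fn x = f.fn (h x))
    {h₁ : Holo W} (hh₁ : ∀ x ∈ W, h₁.fn x = deriv h x)
    {T : Matrix (Fin 2) (Fin 2) (Holo W)⟦X⟧} (hT : IsUnit T.det)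
    (gA : IsGauge (Holo.pd 1) T
      (C h₁ • A.map (PowerSeries.map (σ : Holo U →+* Holo W))) A')
    (gB : IsZGauge T (β.map (PowerSeries.map (σ : Holo U →+* Holo W))) β') :
    FormallyIsomorphic (ofOneVar hU A β hf) (ofOneVar hW A' β' hf') := by
  have eR : ∀ (M : Matrix (Fin 2) (Fin 2) (Holo U)⟦X⟧), ∀ t ∈ W,
      realize M (h t) = realize (M.map (PowerSeries.map (σ : Holo U →+* Holo W))) t := by
    intro M t ht
    ext a b n
    rw [coeff_realize, coeff_realize, ← hσ _ t ht]
    simp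
  refine formallyIsomorphic_of_realize (W := cylinder W) (T := inflateMat W T)
    (h := fun t => ![t 0, h (t 1)])
    (A := ![1, inflateMat W (A.map (PowerSeries.map (σ : Holo U →+* Holo W)))])
    (B := shiftB (β.map (PowerSeries.map (σ : Holo U →+* Holo W))))
    (A' := ![1, inflateMat W A']) (B' := shiftB β')
    (c := fun i j => if i = j then (if i = 0 then 1 else inflate W h₁) else 0)
    hW (isBiholoGerm_pair (hh 0 hW) h0 h') ?_ ?_ ?_ ?_ ?_ ?_ ?_ ?_
  · have := (((Matrix.isUnit_iff_isUnit_det T).2 hT).map (inflateMat W))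
    exact (Matrix.isUnit_iff_isUnit_det _).1 this
  · intro i j t ht
    rw [pd_pair (hh _ ht).differentiableAt]
    split_ifs
    · exact Holo.fn_one ht
    · rw [fn_inflate, hh₁ _ ht]
    · exact Holo.fn_zero _
  · intro j t ht
    fin_cases j
    · refine (ofOneVar_A_zero (hWU _ ht)).trans ?_
      exact (ofOneVar_A_zero (h := hf') (h0 := hW) ht).symm
    · refine (ofOneVar_A_one _).trans ?_
      refine Eq.trans ?_ (realize_inflateMat _ t).symm
      exact eR A (t 1) ht
  · intro t ht
    refine (ofOneVar_B (hWU _ ht)).trans ?_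
    rw [realize_shiftB _ ht, ← eR β (t 1) ht]
    rfl
  · intro j t ht
    fin_cases j <;> rfl
  · intro t ht
    rfl
  · intro i
    rw [sum_smul_pair]
    fin_cases i
    · have := isGauge_one (d₀ := Holo.pd (Pi.single 0 1)) (T := T) (σ := inflate W)
        pd_zero_inflate
      simpa only [Fin.zero_eta, Fin.isValue, if_true, map_one, one_smul, Matrix.cons_val_zero,
        inflateMat]
        using this
    · have := gA.mapMatrix pd_one_inflate
      rw [mapMatrix_smul, PowerSeries.map_C] at this
      exact this
  · exact gB.mapMatrix.sub_smul_one _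

/-- A change of frame in one variable. -/
theorem formallyIsomorphic_of_gauge {U : Opens ℂ} {hU : 0 ∈ U}
    {A β A' β' : Matrix (Fin 2) (Fin 2) (Holo U)⟦X⟧}
    {hf : IsFlat (Holo.pd 1) A β} {hf' : IsFlat (Holo.pd 1) A' β'}
    {T : Matrix (Fin 2) (Fin 2) (Holo U)⟦X⟧} (hT : IsUnit T.det)
    (gA : IsGauge (Holo.pd 1) T A A') (gB : IsZGauge T β β') :
    FormallyIsomorphic (ofOneVar hU A β hf) (ofOneVar hU A' β' hf') := by
  have e : ∀ M : Matrix (Fin 2) (Fin 2) (Holo U)⟦X⟧,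
      M.map (PowerSeries.map ((AlgHom.id ℂ (Holo U) : Holo U →ₐ[ℂ] Holo U) : Holo U →+* Holo U))
        = M := by
    intro M; ext i j n; simp
  refine formallyIsomorphic_ofOneVar (h := fun x => x) (σ := AlgHom.id ℂ _) (h₁ := 1) (T := T)
    analyticOnNhd_id rfl (by simp) (fun x h => h) (fun f x _ => rfl)
    (fun x hx => by rw [Holo.fn_one hx]; simp) hT ?_ ?_
  · rwa [e, map_one, one_smul]
  · rwa [e]

/-- Restriction to a smaller open set. -/
theorem formallyIsomorphic_of_realize_eq {U W : Opens ℂ} {hU : 0 ∈ U} {hW : 0 ∈ W}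
    {A β : Matrix (Fin 2) (Fin 2) (Holo U)⟦X⟧} {A' β' : Matrix (Fin 2) (Fin 2) (Holo W)⟦X⟧}
    {hf : IsFlat (Holo.pd 1) A β} {hf' : IsFlat (Holo.pd 1) A' β'}
    (hA : ∀ᶠ x in 𝓝 0, realize A x = realize A' x) (hβ : ∀ᶠ x in 𝓝 0, realize β x = realize β' x) :
    FormallyIsomorphic (ofOneVar hU A β hf) (ofOneVar hW A' β' hf') := by
  have tt : Tendsto (fun t : Base 2 => t 1) (𝓝 0) (𝓝 0) :=
    (continuous_apply (A := fun _ : Fin 2 => ℂ) 1).tendsto 0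
  refine formallyIsomorphic_of_eventuallyEq (fun i => ?_) ?_
  · filter_upwards [tt.eventually hA, tt.eventually (U.isOpen.mem_nhds hU),
      tt.eventually (W.isOpen.mem_nhds hW)] with t h1 h2 h3
    fin_cases i
    · exact (ofOneVar_A_zero h2).trans (ofOneVar_A_zero h3).symm
    · exact (ofOneVar_A_one t).trans (h1.trans (ofOneVar_A_one t).symm)
  · filter_upwards [tt.eventually hβ, tt.eventually (U.isOpen.mem_nhds hU),
      tt.eventually (W.isOpen.mem_nhds hW)] with t h1 h2 h3
    rw [ofOneVar_B h2, ofOneVar_B h3, h1]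

/-- Companion structures lie over `𝒩₂`. -/
theorem liesOverN2_of_companion {U : Opens ℂ} {hU : 0 ∈ U} {f : (Holo U)⟦X⟧}
    {β : Matrix (Fin 2) (Fin 2) (Holo U)⟦X⟧} {hf : IsFlat (Holo.pd 1) (companionA f) β} :
    LiesOverN2 (ofOneVar hU (companionA f) β hf) := by
  have tt : Tendsto (fun t : Base 2 => t 1) (𝓝 0) (𝓝 0) :=
    (continuous_apply (A := fun _ : Fin 2 => ℂ) 1).tendsto 0
  have key : ∀ᶠ t in 𝓝 (0 : Base 2), ∀ Y : Base 2,
      higgs (ofOneVar hU (companionA f) β hf) t Y = !![Y 0, 0; Y 1, Y 0] := by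
    filter_upwards [tt.eventually (U.isOpen.mem_nhds hU)] with t ht Y
    rw [higgs, Fin.sum_univ_two, ofOneVar_A_zero ht, ofOneVar_A_one,
      show realize (companionA f) (t 1) = _ from realize_eq _ (⟨t 1, ht⟩ : U)]
    ext i j
    fin_cases i <;> fin_cases j <;> simp [coeffZero, companionA]
  -- With ζ the first basis vector, Y ↦ C_Y ζ is the identity.
  refine ⟨⟨fun _ => ![1, 0], analyticAt_const, ?_⟩, ?_⟩
  · filter_upwards [key] with t ht
    simp only [ht]
    have : (fun Y : Base 2 => (!![Y 0, 0; Y 1, Y 0] : Matrix (Fin 2) (Fin 2) ℂ).mulVec ![1, 0])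
        = id := by
      funext Y
      ext i
      fin_cases i <;> simp [Matrix.mulVec, dotProduct]
    rw [this]
    exact Function.bijective_id
  · filter_upwards [key] with t ht
    refine ⟨fun Y Z => ?_, ?_⟩
    · rw [ht, ht, ht]
      ext i j
      fin_cases i <;> fin_cases j <;> simp [n2Mul]; ring
    · rw [ht]
      ext i j
      fin_cases i <;> fin_cases j <;> simp [n2Unit]

end OneVariable

end TEStructure

end

noncomputable section

namespace TEStructure

open TopologicalSpace (Opens)

/-! ### Function theory on a disc: primitives and the Euler operator -/

section Disc

/-- The open disc around the origin. -/
def disc (ρ : ℝ) : Opens ℂ := ⟨Metric.ball 0 ρ, Metric.isOpen_ball⟩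

lemma mem_disc {ρ : ℝ} {x : ℂ} : x ∈ disc ρ ↔ ‖x‖ < ρ := by
  change x ∈ Metric.ball 0 ρ ↔ _
  simp

lemma zero_mem_disc {ρ : ℝ} (hρ : 0 < ρ) : (0 : ℂ) ∈ disc ρ := by
  simpa [mem_disc]

lemma Holo.fn_pd_one {U : Opens ℂ} (f : Holo U) {x : ℂ} (hx : x ∈ U) :
    (Holo.pd 1 f).fn x = deriv f.fn x := by
  rw [Holo.fn_pd _ _ hx, fderiv_apply_one_eq_deriv]

lemma Holo.differentiableOn_fn {U : Opens ℂ} (f : Holo U) : DifferentiableOn ℂ f.fn U :=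
  f.analytic_fn.differentiableOn

/-- A differentiable function on an open set of the complex plane as an element of `Holo`. -/
def Holo.ofDiff {U : Opens ℂ} (g : ℂ → ℂ) (hg : DifferentiableOn ℂ g U) : Holo U :=
  Holo.mk g (hg.analyticOnNhd U.isOpen)

lemma Holo.fn_ofDiff {U : Opens ℂ} (g : ℂ → ℂ) (hg : DifferentiableOn ℂ g U) {x : ℂ}
    (hx : x ∈ U) : (Holo.ofDiff g hg).fn x = g x :=
  Holo.fn_mk _ _ hx

lemma Holo.fn_pd_ofDiff {U : Opens ℂ} (g : ℂ → ℂ) (hg : DifferentiableOn ℂ g U) {x : ℂ}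
    (hx : x ∈ U) : (Holo.pd 1 (Holo.ofDiff g hg)).fn x = deriv g x := by
  rw [Holo.fn_pd_one _ hx]
  apply Filter.EventuallyEq.deriv_eq
  filter_upwards [U.isOpen.mem_nhds hx] with y hy using Holo.fn_ofDiff g hg hy

/-- The coordinate of the complex plane. -/
def Holo.var (U : Opens ℂ) : Holo U := Holo.ofDiff id differentiableOn_id

lemma Holo.fn_var {U : Opens ℂ} {x : ℂ} (hx : x ∈ U) : (Holo.var U).fn x = x :=
  Holo.fn_ofDiff _ _ hx

lemma Holo.pd_var {U : Opens ℂ} : Holo.pd 1 (Holo.var U) = 1 :=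
  Holo.eq_of_fn fun x hx => by
    rw [Holo.var, Holo.fn_pd_ofDiff _ _ hx, Holo.fn_one hx]; simp

lemma exists_primitive {ρ : ℝ} (hρ : 0 < ρ) (f : Holo (disc ρ)) (y : ℂ) :
    ∃ g : Holo (disc ρ), Holo.pd 1 g = f ∧ g.fn 0 = y := by
  obtain ⟨g, hy, hg⟩ := (f.differentiableOn_fn.isExactOn_ball).with_val_at 0 y
  have hd : DifferentiableOn ℂ g (disc ρ) := fun x hx =>
    (hg x hx).differentiableAt.differentiableWithinAt
  refine ⟨Holo.ofDiff g hd, Holo.eq_of_fn fun x hx => ?_, ?_⟩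
  · rw [Holo.fn_pd_ofDiff _ _ hx, (hg x hx).deriv]
  · rw [Holo.fn_ofDiff _ _ (zero_mem_disc hρ), hy]

lemma Holo.iteratedDeriv_fn {U : Opens ℂ} (f : Holo U) (n : ℕ) : ∀ x ∈ U,
    iteratedDeriv n f.fn x = ((Holo.pd (1 : ℂ))^[n] f).fn x := by
  induction n with
  | zero => intro x _; simp
  | succ n ih =>
    intro x hx
    rw [iteratedDeriv_succ, Function.iterate_succ_apply', Holo.fn_pd_one _ hx]
    apply Filter.EventuallyEq.deriv_eq
    filter_upwards [U.isOpen.mem_nhds hx] with y hy using ih y hy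

/-- The Taylor series at 0 represents the function on the whole disc. -/
lemma Holo.eq_zero_of_iterate_pd {ρ : ℝ} (hρ : 0 < ρ) {f : Holo (disc ρ)}
    (h : ∀ n, ((Holo.pd (1 : ℂ))^[n] f).fn 0 = 0) : f = 0 := by
  apply Holo.eq_of_fn
  intro x hx
  have := Complex.hasSum_taylorSeries_on_ball (f := f.fn) (c := 0) (r := ρ) (z := x)
    f.differentiableOn_fn hx
  simp only [Holo.iteratedDeriv_fn f _ 0 (zero_mem_disc hρ), h, smul_zero] at this
  rw [Holo.fn_zero, this.unique hasSum_zero]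

/-- The Taylor coefficients are divided by κ + n. Since |κ + n| ≥ κ > 0, the new series still
converges on the whole disc, so infinitely many orders in z can be treated on one and the same disc.
-/
lemma exists_euler {ρ : ℝ} {κ : ℝ} (hκ : 0 < κ) (f : Holo (disc ρ)) :
    ∃ g : Holo (disc ρ),
      algebraMap ℂ (Holo (disc ρ)) κ * g + Holo.var _ * Holo.pd 1 g = f := by
  let a : ℕ → ℂ := fun n => (n.factorial : ℂ)⁻¹ * iteratedDeriv n f.fn 0
  have hf : ∀ x ∈ disc ρ, HasSum (fun n => a n * x ^ n) (f.fn x) := by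
    intro x hx
    have e : (fun n => a n * x ^ n) = fun n : ℕ =>
        (n.factorial : ℂ)⁻¹ • (x - 0) ^ n • iteratedDeriv n f.fn 0 := by
      funext n; simp [a]; ring
    rw [e]
    exact Complex.hasSum_taylorSeries_on_ball (f := f.fn) (c := 0) (r := ρ) (z := x)
      f.differentiableOn_fn hx
  have hn : ∀ n : ℕ, (κ : ℂ) + n ≠ 0 := fun n h => by
    have := congrArg Complex.re h
    simp at this
    have : (0 : ℝ) ≤ n := Nat.cast_nonneg n
    linarith
  have hle : ∀ n : ℕ, κ ≤ ‖(κ : ℂ) + n‖ := fun n => by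
    have : (κ : ℂ) + n = ((κ + n : ℝ) : ℂ) := by push_cast; rfl
    rw [this, Complex.norm_real, Real.norm_of_nonneg (by positivity)]
    linarith [(Nat.cast_nonneg n : (0 : ℝ) ≤ n)]
  let F : ℕ → ℂ → ℂ := fun n x => a n / (κ + n) * x ^ n
  let g : ℂ → ℂ := fun x => ∑' n, F n x
  have key : ∀ x ∈ disc ρ, ∃ r, x ∈ Metric.ball (0 : ℂ) r ∧ ∃ u : ℕ → ℝ, Summable u ∧
      ∀ n, ∀ w ∈ Metric.ball (0 : ℂ) r, ‖F n w‖ ≤ u n := by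
    intro x hx
    obtain ⟨r, h1, h2⟩ := exists_between (mem_disc.1 hx)
    have hr : 0 ≤ r := (norm_nonneg x).trans h1.le
    have hs := (hf (r : ℂ) (by
      rw [mem_disc, Complex.norm_real, Real.norm_of_nonneg hr]; exact h2)).summable.norm
    refine ⟨r, by simpa using h1, _, hs.mul_left κ⁻¹, fun n w hw => ?_⟩
    have hw' : ‖w‖ ≤ r := by simpa using (Metric.mem_ball.1 hw).le
    simp only [F, norm_mul, norm_div, norm_pow, Complex.norm_real, Real.norm_of_nonneg hr]
    rw [div_eq_mul_inv, mul_comm ‖a n‖, mul_assoc]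
    have := hle n
    gcongr
  have hF : ∀ n, ∀ s : Set ℂ, DifferentiableOn ℂ (F n) s := fun n s => by fun_prop
  have hd : DifferentiableOn ℂ g (disc ρ) := by
    intro x hx
    obtain ⟨r, hr, u, hu, h⟩ := key x hx
    exact ((Complex.differentiableOn_tsum_of_summable_norm hu (fun n => hF n _)
      Metric.isOpen_ball h).differentiableAt (Metric.isOpen_ball.mem_nhds hr)).differentiableWithinAt
  refine ⟨Holo.ofDiff g hd, Holo.eq_of_fn fun x hx => ?_⟩
  rw [Holo.fn_add, Holo.fn_mul, Holo.fn_mul, Holo.fn_algebraMap _ hx, Holo.fn_var hx,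
    Holo.fn_ofDiff _ _ hx, Holo.fn_pd_ofDiff _ _ hx]
  obtain ⟨r, hr, u, hu, h⟩ := key x hx
  have h1 := (Complex.hasSum_deriv_of_summable_norm hu (fun n => hF n _)
      Metric.isOpen_ball h hr).mul_left x
  have h2 : HasSum (fun n => F n x) (g x) :=
    (Summable.of_norm_bounded hu fun n => h n x hr).hasSum
  have h3 := (h2.mul_left (κ : ℂ)).add h1
  refine h3.unique ?_
  suffices e : (fun n => a n * x ^ n) = fun n => (κ : ℂ) * F n x + x * deriv (F n) x by
    rw [← e]; exact hf x hx
  funext n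
  have e : deriv (F n) x = a n / (κ + n) * (n * x ^ (n - 1)) := by
    simp only [F]
    rw [deriv_const_mul _ (by fun_prop), deriv_pow_field]
  have e' : x * ((n : ℂ) * x ^ (n - 1)) = n * x ^ n := by
    rcases n with _ | n
    · simp
    · simp [pow_succ]; ring
  rw [e]
  have := hn n
  simp only [F]
  field_simp
  linear_combination -a n * e'

/-- Differentiating n times gives (κ + n) f⁽ⁿ⁾ + t f⁽ⁿ⁺¹⁾ = 0, hence f⁽ⁿ⁾(0) = 0 for every n. -/
lemma Holo.euler_unique {ρ : ℝ} (hρ : 0 < ρ) {κ : ℝ} (hκ : 0 < κ) {f : Holo (disc ρ)}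
    (h : algebraMap ℂ (Holo (disc ρ)) κ * f + Holo.var _ * Holo.pd 1 f = 0) : f = 0 := by
  have key : ∀ n : ℕ, (algebraMap ℂ (Holo (disc ρ)) κ + (n : Holo (disc ρ))) * (Holo.pd (1 : ℂ))^[n] f
      + Holo.var _ * Holo.pd 1 ((Holo.pd (1 : ℂ))^[n] f) = 0 := by
    intro n
    induction n with
    | zero => simpa using h
    | succ n ih =>
      have := congrArg (Holo.pd (1 : ℂ)) ih
      simp only [map_add, Derivation.leibniz, Derivation.map_algebraMap, Derivation.map_natCast,
        Holo.pd_var, smul_eq_mul, map_zero] at this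
      rw [Function.iterate_succ_apply']
      push_cast
      linear_combination this
  refine Holo.eq_zero_of_iterate_pd hρ fun n => ?_
  have h0 := zero_mem_disc hρ
  have := congrArg (fun f => Holo.fn f 0) (key n)
  simp only [Holo.fn_add, Holo.fn_mul, Holo.fn_var h0, Holo.fn_algebraMap _ h0, Holo.fn_zero,
    zero_mul, add_zero] at this
  have e : (n : Holo (disc ρ)).fn 0 = n := by
    have := Holo.fn_algebraMap (U := disc ρ) (n : ℂ) h0
    rwa [map_natCast] at this
  rw [e] at this
  refine (mul_eq_zero.1 this).resolve_left fun h => ?_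
  have := congrArg Complex.re h
  simp at this
  have : (0 : ℝ) ≤ n := Nat.cast_nonneg n
  linarith

lemma Holo.eq_zero_of_pd {ρ : ℝ} (hρ : 0 < ρ) {f : Holo (disc ρ)} (h : Holo.pd 1 f = 0)
    (h0 : f.fn 0 = 0) : f = 0 := by
  refine Holo.eq_zero_of_iterate_pd hρ fun n => ?_
  rcases n with _ | n
  · exact h0
  · rw [Function.iterate_succ_apply, h]
    induction n with
    | zero => exact Holo.fn_zero _
    | succ n ih => rwa [Function.iterate_succ_apply, map_zero]

/-- The calculus on a disc. -/
def discCalculus {ρ : ℝ} (hρ : 0 < ρ) : DiscCalculus (Holo (disc ρ)) where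
  d := Holo.pd 1
  t := Holo.var _
  ev := Holo.eval ⟨0, zero_mem_disc hρ⟩
  prim f := (exists_primitive hρ f 0).choose
  -- The value 0 for κ ≤ 0 is immaterial: both laws of the operator assume κ > 0.
  euler κ f := open scoped Classical in if h : 0 < κ then (exists_euler h f).choose else 0
  d_t := Holo.pd_var
  ev_t := by rw [Holo.eval_eq_fn, Holo.fn_var (zero_mem_disc hρ)]
  d_prim f := (exists_primitive hρ f 0).choose_spec.1
  ev_prim f := by rw [Holo.eval_eq_fn]; exact (exists_primitive hρ f 0).choose_spec.2
  eq_zero_of_d f h h' := Holo.eq_zero_of_pd hρ h (by rwa [Holo.eval_eq_fn] at h')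
  euler_spec κ f h := by rw [dif_pos h]; exact (exists_euler h f).choose_spec
  euler_unique κ f h h' := Holo.euler_unique hρ h h'

end Disc

end TEStructure

end

/-! ### Structures up to isomorphism as pairs (f, b), and coordinate changes -/

noncomputable section

namespace TEStructure

open TopologicalSpace (Opens)

open PowerSeries

lemma isCompatible_of_isFlat {R : Type*} [CommRing R] [Algebra ℂ R] {d : Derivation ℂ R R}
    {s f b : R⟦X⟧} (h : IsFlat d (companionA f) (companionB d s f b)) : IsCompatible d f b := by
  obtain ⟨s', b', -, hc, e⟩ := eq_companionB_of_isFlat h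
  have : b = b' := by simpa [companionB] using congrFun (congrFun e 1) 0
  rwa [this]

/-- `S` is isomorphic to the structure on a disc given by `f`, `b` and the scalar part `g`. -/
def HasForm (S : FormalTE 2 2) (ρ : ℝ) (f b : (Holo (disc ρ))⟦X⟧) (g : ℂ⟦X⟧) : Prop :=
  ∃ (hρ : 0 < ρ) (hc : IsCompatible (Holo.pd 1) f b),
    FormallyIsomorphic S (ofOneVar (zero_mem_disc hρ) (companionA f)
      (companionB (Holo.pd 1) (cst _ g) f b) (isFlat_companion (liftD_cst _ _) hc))

section HasForm

variable {S : FormalTE 2 2} {ρ : ℝ} {f b : (Holo (disc ρ))⟦X⟧} {g : ℂ⟦X⟧}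

lemma HasForm.gauge (H : HasForm S ρ f b g) {f' b' : (Holo (disc ρ))⟦X⟧} {g' : ℂ⟦X⟧}
    {T : Matrix (Fin 2) (Fin 2) (Holo (disc ρ))⟦X⟧} (hT : IsUnit T.det)
    (hc : IsCompatible (Holo.pd 1) f' b')
    (gA : IsGauge (Holo.pd 1) T (companionA f) (companionA f'))
    (gB : IsZGauge T (companionB (Holo.pd 1) (cst _ g) f b)
      (companionB (Holo.pd 1) (cst _ g') f' b')) : HasForm S ρ f' b' g' := by
  obtain ⟨hρ, hc₀, H⟩ := H
  exact ⟨hρ, hc, H.trans (formallyIsomorphic_of_gauge hT gA gB)⟩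

lemma isZGauge_smul_one {R : Type*} [CommRing R] [Algebra ℂ R] {w g g' : R⟦X⟧}
    (h : X ^ 2 * derivative R w + g * w = w * g') (d : Derivation ℂ R R) (f b : R⟦X⟧) :
    IsZGauge (w • 1) (companionB d g f b) (companionB d g' f b) := by
  have e : (w • (1 : Matrix (Fin 2) (Fin 2) R⟦X⟧)).map (derivative R) = derivative R w • 1 := by
    ext1 i j; by_cases hij : i = j <;> simp [hij]
  rw [IsZGauge, e, companionB, companionB]
  ext1 i j
  fin_cases i <;> fin_cases j <;> simp
  · linear_combination h
  · linear_combination h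

lemma isGauge_smul_one {R : Type*} [CommRing R] [Algebra ℂ R] {w : R⟦X⟧} {d : Derivation ℂ R R}
    (h : liftD d w = 0) (A : Matrix (Fin 2) (Fin 2) R⟦X⟧) : IsGauge d (w • 1) A A := by
  have e : (w • (1 : Matrix (Fin 2) (Fin 2) R⟦X⟧)).map (liftD d) = 0 := by
    ext1 i j; by_cases hij : i = j <;> simp [hij, h]
  rw [IsGauge, e]
  simp

/-- With g = c + αz + z²g₂, a solution of ∂_z w = -g₂w absorbs z²g₂; the factor z² in front of ∂_z
protects c and α. -/
lemma exists_scalar_gauge (g : ℂ⟦X⟧) : ∃ w : ℂ⟦X⟧, coeff 0 w = 1 ∧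
    X ^ 2 * derivative ℂ w + g * w = w * (C (coeff 0 g) + C (coeff 1 g) * X) := by
  obtain ⟨g₁, hg₁⟩ := exists_eq_C_add_X_mul g
  obtain ⟨g₂, hg₂⟩ := exists_eq_C_add_X_mul g₁
  have e : coeff 0 g₁ = coeff 1 g := by
    conv_rhs => rw [hg₁]
    rw [map_add, show (1 : ℕ) = 0 + 1 from rfl, coeff_succ_X_mul]
    simp
  obtain ⟨w, hw⟩ := exists_fixedPoint_single (R := ℂ)
    (fun w => 1 + X * DiscCalculus.divIndex 1 (-(g₂ * w)))
    (fun k x y h => (Cong.refl _ _).add (DiscCalculus.cong_divIndex (h.const_mul _).neg).X_mul)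
  have hd : derivative ℂ w = -(g₂ * w) := by
    conv_lhs => rw [← hw]
    rw [map_add, DiscCalculus.derivative_X_mul_divIndex]
    simp
  refine ⟨w, by rw [← hw]; simp, ?_⟩
  rw [e] at hg₂
  rw [hd]
  linear_combination w * hg₁ + X * w * hg₂

lemma HasForm.scalar (H : HasForm S ρ f b g) :
    HasForm S ρ f b (C (coeff 0 g) + C (coeff 1 g) * X) := by
  obtain ⟨w, hw, h⟩ := exists_scalar_gauge g
  have hd : ∀ x : ℂ⟦X⟧, derivative (Holo (disc ρ)) (cst _ x) = cst _ (derivative ℂ x) :=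
    derivative_cst
  refine H.gauge (T := cst _ w • 1) ?_ H.2.1 (isGauge_smul_one (liftD_cst _ _) _)
    (isZGauge_smul_one ?_ _ _ _)
  · have : IsUnit (cst (Holo (disc ρ)) w) := by
      refine IsUnit.map _ ?_
      rw [PowerSeries.isUnit_iff_constantCoeff, ← coeff_zero_eq_constantCoeff_apply, hw]
      exact isUnit_one
    rw [Matrix.det_smul, Matrix.det_one, mul_one]
    exact this.pow _
  · have := congrArg (cst (Holo (disc ρ))) h
    rw [map_add, map_mul, map_mul, map_mul, map_pow, cst_X] at this
    rw [hd, this]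

end HasForm

/-- A holomorphic coordinate change from a disc to a disc which preserves the origin, with a
square root of the inverse of its derivative. -/
structure CoordChange (ρ ρ' : ℝ) where
  h : ℂ → ℂ
  pos : 0 < ρ'
  analytic : AnalyticOnNhd ℂ h (disc ρ')
  zero : h 0 = 0
  maps : ∀ x ∈ disc ρ', h x ∈ disc ρ
  κ : Holo (disc ρ')
  spec : κ ^ 2 * Holo.mk (deriv h) analytic.deriv = 1

namespace CoordChange

variable {ρ ρ' : ℝ} (φ : CoordChange ρ ρ')

/-- Composition with the coordinate change. -/
def σ : Holo (disc ρ) →ₐ[ℂ] Holo (disc ρ') := Holo.comp φ.h φ.analytic φ.maps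

/-- The derivative of the coordinate change. -/
def h₁ : Holo (disc ρ') := Holo.mk (deriv φ.h) φ.analytic.deriv

lemma κ_sq_mul_h₁ : φ.κ ^ 2 * φ.h₁ = 1 := φ.spec

lemma fn_σ (f : Holo (disc ρ)) {x : ℂ} (hx : x ∈ disc ρ') : (φ.σ f).fn x = f.fn (φ.h x) :=
  Holo.fn_comp _ _ _ hx

lemma fn_σ_zero (f : Holo (disc ρ)) : (φ.σ f).fn 0 = f.fn 0 := by
  rw [fn_σ _ _ (zero_mem_disc φ.pos), φ.zero]

lemma fn_h₁ {x : ℂ} (hx : x ∈ disc ρ') : φ.h₁.fn x = deriv φ.h x := Holo.fn_mk _ _ hx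

lemma pd_σ (f : Holo (disc ρ)) : Holo.pd 1 (φ.σ f) = φ.h₁ * φ.σ (Holo.pd 1 f) := by
  apply Holo.eq_of_fn
  intro x hx
  rw [σ, Holo.fn_pd_comp _ _ _ _ hx, Holo.fn_mul, fn_h₁ _ hx, Holo.fn_comp _ _ _ hx,
    Holo.fn_pd_one _ (φ.maps x hx), fderiv_apply_one_eq_deriv, fderiv_eq_smul_deriv, smul_eq_mul]

lemma deriv_zero_ne : deriv φ.h 0 ≠ 0 := by
  intro h
  have h0 := zero_mem_disc φ.pos
  have := congrArg (fun f => Holo.fn f 0) φ.κ_sq_mul_h₁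
  simp only [Holo.fn_mul, fn_h₁ _ h0, h, mul_zero, Holo.fn_one h0] at this
  exact one_ne_zero this.symm

/-- The effect of a coordinate change on power series. -/
def μ : (Holo (disc ρ))⟦X⟧ →+* (Holo (disc ρ'))⟦X⟧ :=
  PowerSeries.map (φ.σ : Holo (disc ρ) →+* Holo (disc ρ'))

@[simp] lemma coeff_μ (x : (Holo (disc ρ))⟦X⟧) (n : ℕ) : coeff n (φ.μ x) = φ.σ (coeff n x) := by
  simp [μ]

@[simp] lemma μ_cst (x : ℂ⟦X⟧) : φ.μ (cst _ x) = cst _ x := by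
  ext n
  simp

end CoordChange

lemma HasForm.pullback {S : FormalTE 2 2} {ρ ρ' : ℝ} {f b : (Holo (disc ρ))⟦X⟧} {g : ℂ⟦X⟧}
    (H : HasForm S ρ f b g) (φ : CoordChange ρ ρ') :
    HasForm S ρ' (C (φ.h₁ ^ 2) * φ.μ f + X * C (Holo.pd 1 (Holo.pd 1 φ.κ) * φ.κ * φ.h₁))
      (C (φ.κ ^ 2) * φ.μ b) g := by
  obtain ⟨hρ, hc, H⟩ := H
  obtain ⟨gA, gB⟩ := pullback_companion (d := Holo.pd 1) (d' := Holo.pd 1) φ.σ φ.pd_σ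
    φ.κ_sq_mul_h₁ (f := f) (b := b) (s := cst _ g) (μ := φ.μ) rfl rfl rfl
  rw [φ.μ_cst] at gB
  have hT := isUnit_det_pullbackT (d' := Holo.pd 1) φ.κ_sq_mul_h₁
  -- Compatibility of the transformed pair is read off from flatness, which both pullback and gauge
  -- preserve.
  have hfl := ((isFlat_companion (liftD_cst _ g) hc).pullback φ.σ φ.h₁ φ.pd_σ).gauge hT gA gB
  have hc' := isCompatible_of_isFlat hfl
  refine ⟨φ.pos, hc', H.trans ?_⟩
  exact formallyIsomorphic_ofOneVar φ.analytic φ.zero φ.deriv_zero_ne φ.maps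
    (σ := φ.σ) (fun f x hx => φ.fn_σ f hx) (fun x hx => φ.fn_h₁ hx) hT gA gB

end TEStructure

end

noncomputable section

namespace TEStructure

open TopologicalSpace (Opens)

/-! ### Logarithms, orders of vanishing, and the equation φ'' = qφ -/

section Functions

lemma exists_disc_of_eventually {p : ℂ → Prop} (h : ∀ᶠ x in 𝓝 (0 : ℂ), p x) {ρ : ℝ} (hρ : 0 < ρ) :
    ∃ ρ', 0 < ρ' ∧ ρ' ≤ ρ ∧ ∀ x ∈ disc ρ', p x := by
  obtain ⟨ε, hε, h⟩ := Metric.eventually_nhds_iff_ball.1 h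
  refine ⟨min ε ρ, lt_min hε hρ, min_le_right _ _, fun x hx => h x ?_⟩
  simpa using (mem_disc.1 hx).trans_le (min_le_left _ _)

lemma disc_mono {ρ ρ' : ℝ} (h : ρ' ≤ ρ) {x : ℂ} (hx : x ∈ disc ρ') : x ∈ disc ρ :=
  mem_disc.2 ((mem_disc.1 hx).trans_le h)

namespace Holo

variable {ρ : ℝ}

/-- Take for L the primitive of f'/f with value log f(0) at 0; then f exp(-L) has derivative 0 and
value 1 at 0. -/
lemma exists_log (hρ : 0 < ρ) {f : Holo (disc ρ)} (hf : ∀ x ∈ disc ρ, f.fn x ≠ 0) :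
    ∃ L : Holo (disc ρ), f = exp L := by
  have h0 := zero_mem_disc hρ
  obtain ⟨fi, hfi⟩ := (f.isUnit_of_ne_zero hf).exists_right_inv
  obtain ⟨L, hL, hL0⟩ := exists_primitive hρ (pd 1 f * fi) (Complex.log (f.fn 0))
  have h1 : f * exp (-L) - 1 = 0 := by
    refine Holo.eq_zero_of_pd hρ ?_ ?_
    · rw [map_sub, Derivation.leibniz, pd_exp, Derivation.map_one_eq_zero, map_neg, hL, smul_eq_mul,
        smul_eq_mul]
      linear_combination -(pd 1 f * exp (-L)) * hfi
    · rw [fn_sub, fn_mul, fn_one h0, exp, fn_mk _ _ h0, fn_neg, hL0, Complex.exp_neg,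
        Complex.exp_log (hf 0 h0), mul_inv_cancel₀ (hf 0 h0), sub_self]
  refine ⟨L, ?_⟩
  linear_combination exp L * h1 - f * exp_mul_exp_neg L

/-- By the identity theorem f does not vanish identically near 0, so its order r at 0 is finite; the
disc is shrunk until the cofactor has no zeros. -/
lemma exists_factorization (hρ : 0 < ρ) {f : Holo (disc ρ)} (hf : f ≠ 0) :
    ∃ (ρ' : ℝ) (r : ℕ) (w : Holo (disc ρ')), 0 < ρ' ∧ ρ' ≤ ρ ∧ (∀ x ∈ disc ρ', w.fn x ≠ 0) ∧
      ∀ x ∈ disc ρ', f.fn x = x ^ r * w.fn x := by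
  have h0 := zero_mem_disc hρ
  have hne : ¬ ∀ᶠ x in 𝓝 0, f.fn x = 0 := by
    intro h
    have := f.analytic_fn.eqOn_zero_of_preconnected_of_eventuallyEq_zero
      (convex_ball 0 ρ).isPreconnected h0 h
    exact hf (eq_of_fn fun x hx => by rw [this hx, fn_zero]; rfl)
  obtain ⟨r, w, hw, hw0, he⟩ :=
    (f.analytic_fn 0 h0).exists_eventuallyEq_pow_smul_nonzero_iff.2 hne
  obtain ⟨ρ', hρ', hle, h⟩ := exists_disc_of_eventually
    ((hw.eventually_analyticAt.and (hw.continuousAt.eventually_ne hw0)).and he) hρ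
  have hA : AnalyticOnNhd ℂ w (disc ρ') := fun x hx => (h x hx).1.1
  refine ⟨ρ', r, mk w hA, hρ', hle, fun x hx => ?_, fun x hx => ?_⟩
  · rw [fn_mk _ _ hx]; exact (h x hx).1.2
  · rw [fn_mk _ _ hx, (h x hx).2]; simp

lemma norm_le_of_pd (hρ : 0 < ρ) {f : Holo (disc ρ)} {K : ℝ} (h0 : f.fn 0 = 0)
    (h : ∀ x ∈ disc ρ, ‖(pd 1 f).fn x‖ ≤ K) {x : ℂ} (hx : x ∈ disc ρ) : ‖f.fn x‖ ≤ K * ρ := by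
  have := Convex.norm_image_sub_le_of_norm_deriv_le (𝕜 := ℂ) (f := f.fn) (C := K) (s := disc ρ)
    (x := 0) (y := x) (fun y hy => f.differentiableAt_fn hy)
    (fun y hy => by rw [← fn_pd_one _ hy]; exact h y hy) (convex_ball 0 ρ) (zero_mem_disc hρ) hx
  rw [h0, sub_zero, sub_zero] at this
  have hK : 0 ≤ K := (norm_nonneg _).trans (h 0 (zero_mem_disc hρ))
  exact this.trans (mul_le_mul_of_nonneg_left (mem_disc.1 hx).le hK)

/-- Solution of `φ'' = q φ` on a disc where `q` is small. -/
lemma exists_solution_of_small (hρ : 0 < ρ) (hρ1 : ρ ≤ 1) {q : Holo (disc ρ)} {M : ℝ}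
    (hq : ∀ x ∈ disc ρ, ‖q.fn x‖ ≤ M) (hM : M * ρ ^ 2 ≤ 1 / 2) (a b : ℂ) :
    ∃ φ : Holo (disc ρ), pd 1 (pd 1 φ) = q * φ ∧ φ.fn 0 = a ∧ (pd 1 φ).fn 0 = b := by
  have h0 := zero_mem_disc hρ
  have hM0 : 0 ≤ M := (norm_nonneg _).trans (hq 0 h0)
  choose P hP hP0 using fun f => exists_primitive hρ f 0
  -- The terms of the Picard series: a + bt, then repeatedly the double primitive of q times the
  -- previous term. Since Mρ² ≤ 1/2, each step halves the bound.
  let F : ℕ → Holo (disc ρ) := fun n => Nat.rec (algebraMap ℂ _ a + b • var _)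
    (fun _ u => P (P (q * u))) n
  have F0 : F 0 = algebraMap ℂ _ a + b • var _ := rfl
  have F1 : ∀ n, F (n + 1) = P (P (q * F n)) := fun n => rfl
  have d0 : pd 1 (F 0) = algebraMap ℂ _ b := by
    rw [F0, map_add, Derivation.map_smul, Derivation.map_algebraMap, pd_var, zero_add,
      Algebra.algebraMap_eq_smul_one]
  have d1 : ∀ n, pd 1 (F (n + 1)) = P (q * F n) := fun n => by rw [F1, hP]
  set K : ℝ := ‖a‖ + ‖b‖ with hK
  have bF : ∀ n, ∀ x ∈ disc ρ, ‖(F n).fn x‖ ≤ K * (1 / 2) ^ n := by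
    intro n
    induction n with
    | zero =>
      intro x hx
      rw [F0, fn_add, fn_algebraMap _ hx, fn_smul, fn_var hx, pow_zero, mul_one]
      refine (norm_add_le _ _).trans ?_
      rw [norm_mul, hK]
      have : ‖x‖ ≤ 1 := (mem_disc.1 hx).le.trans hρ1
      have := mul_le_mul_of_nonneg_left this (norm_nonneg b)
      linarith
    | succ n ih =>
      intro x hx
      have h1 : ∀ y ∈ disc ρ, ‖(P (q * F n)).fn y‖ ≤ M * (K * (1 / 2) ^ n) * ρ := fun y hy =>
        norm_le_of_pd hρ (hP0 _) (fun y hy => by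
          rw [hP, fn_mul, norm_mul]
          exact mul_le_mul (hq y hy) (ih y hy) (norm_nonneg _) hM0) hy
      have h2 := norm_le_of_pd hρ (f := F (n + 1)) (hP0 _) (fun y hy => by
        rw [d1]; exact h1 y hy) hx
      refine h2.trans ?_
      have : 0 ≤ K * (1 / 2) ^ n := by positivity
      rw [pow_succ]
      nlinarith
  have bF' : ∀ n, ∀ x ∈ disc ρ, ‖(pd 1 (F n)).fn x‖ ≤ (2 * M * K + ‖b‖) * (1 / 2) ^ n := by
    intro n x hx
    rcases n with _ | n
    · rw [d0, fn_algebraMap _ hx, pow_zero, mul_one]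
      have : 0 ≤ 2 * M * K := by positivity
      linarith
    · rw [d1]
      have h1 := norm_le_of_pd hρ (f := P (q * F n)) (hP0 _) (fun y hy => by
          rw [hP, fn_mul, norm_mul]
          exact mul_le_mul (hq y hy) (bF n y hy) (norm_nonneg _) hM0) hx
      refine h1.trans ?_
      have h3 : 0 ≤ M * (K * (1 / 2) ^ n) := by positivity
      have h4 : 0 ≤ ‖b‖ * (1 / 2) ^ n := by positivity
      rw [pow_succ]
      nlinarith
  have s1 : Summable fun n : ℕ => K * (1 / 2 : ℝ) ^ n := summable_geometric_two.mul_left K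
  have s2 : Summable fun n : ℕ => (2 * M * K + ‖b‖) * (1 / 2 : ℝ) ^ n :=
    summable_geometric_two.mul_left _
  let G : ℂ → ℂ := fun x => ∑' n, (F n).fn x
  let G' : ℂ → ℂ := fun x => ∑' n, (pd 1 (F n)).fn x
  have hG : DifferentiableOn ℂ G (disc ρ) := Complex.differentiableOn_tsum_of_summable_norm s1
    (fun n => (F n).differentiableOn_fn) (disc ρ).isOpen bF
  have hG' : DifferentiableOn ℂ G' (disc ρ) := Complex.differentiableOn_tsum_of_summable_norm s2
    (fun n => (pd 1 (F n)).differentiableOn_fn) (disc ρ).isOpen bF'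
  have e1 : pd 1 (ofDiff G hG) = ofDiff G' hG' := by
    apply eq_of_fn
    intro x hx
    rw [fn_pd_ofDiff _ _ hx, fn_ofDiff _ _ hx]
    have := Complex.hasSum_deriv_of_summable_norm s1
      (fun n => (F n).differentiableOn_fn) (disc ρ).isOpen bF hx
    simp only [← fn_pd_one _ hx] at this
    exact this.tsum_eq.symm
  refine ⟨ofDiff G hG, ?_, ?_, ?_⟩
  · rw [e1]
    apply eq_of_fn
    intro x hx
    rw [fn_pd_ofDiff _ _ hx, fn_mul, fn_ofDiff _ _ hx]
    have h1 := Complex.hasSum_deriv_of_summable_norm s2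
      (fun n => (pd 1 (F n)).differentiableOn_fn) (disc ρ).isOpen bF' hx
    simp only [← fn_pd_one _ hx] at h1
    have h2 : HasSum (fun n => (F n).fn x) (G x) :=
      (Summable.of_norm_bounded s1 fun n => bF n x hx).hasSum
    have h3 := h2.mul_left (q.fn x)
    have h4 : (fun n => q.fn x * (F n).fn x) = fun n => (pd 1 (pd 1 (F (n + 1)))).fn x := by
      funext n
      rw [d1, hP, fn_mul]
    rw [h4] at h3
    -- The series of second derivatives is q times the original series shifted by one place; its
    -- missing first term is (a + bt)'' = 0.
    rw [hasSum_nat_add_iff (f := fun n => (pd 1 (pd 1 (F n))).fn x) 1] at h3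
    have h5 : (pd 1 (pd 1 (F 0))).fn x = 0 := by
      rw [d0, Derivation.map_algebraMap, fn_zero]
    rw [Finset.sum_range_one, h5, add_zero] at h3
    exact h1.unique h3
  · rw [fn_ofDiff _ _ h0]
    refine (tsum_eq_single 0 fun n hn => ?_).trans ?_
    · obtain ⟨n, rfl⟩ := Nat.exists_eq_succ_of_ne_zero hn
      exact hP0 _
    · rw [F0, fn_add, fn_algebraMap _ h0, fn_smul, fn_var h0, mul_zero, add_zero]
  · rw [e1, fn_ofDiff _ _ h0]
    refine (tsum_eq_single 0 fun n hn => ?_).trans ?_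
    · obtain ⟨n, rfl⟩ := Nat.exists_eq_succ_of_ne_zero hn
      rw [Nat.succ_eq_add_one, d1]
      exact hP0 _
    · rw [d0, fn_algebraMap _ h0]

end Holo

end Functions

namespace CoordChange

/-- Restriction to a smaller disc. -/
def restrict {ρ ρ' : ℝ} (h : 0 < ρ') (hle : ρ' ≤ ρ) : CoordChange ρ ρ' where
  h := id
  pos := h
  analytic := analyticOnNhd_id
  zero := rfl
  maps _ hx := disc_mono hle hx
  κ := 1
  spec := Holo.eq_of_fn fun x hx => by
    rw [Holo.fn_mul, Holo.fn_mk _ _ hx, Holo.fn_one hx, one_pow, Holo.fn_one hx, deriv_id, one_mul]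

lemma fn_restrict {ρ ρ' : ℝ} (h : 0 < ρ') (hle : ρ' ≤ ρ) (f : Holo (disc ρ)) {x : ℂ}
    (hx : x ∈ disc ρ') : ((restrict h hle).σ f).fn x = f.fn x :=
  fn_σ _ _ hx

lemma h₁_restrict {ρ ρ' : ℝ} (h : 0 < ρ') (hle : ρ' ≤ ρ) : (restrict h hle).h₁ = 1 := by
  have := (restrict h hle).κ_sq_mul_h₁
  rwa [show (restrict h hle).κ = 1 from rfl, one_pow, one_mul] at this

/-- The inverse of a coordinate with derivative `w²`. -/
lemma exists_inverse {ρ : ℝ} (hρ : 0 < ρ) {g w : Holo (disc ρ)} (hg : Holo.pd 1 g = w ^ 2)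
    (hw : w.fn 0 ≠ 0) (hg0 : g.fn 0 = 0) :
    ∃ (ρ' : ℝ) (φ : CoordChange ρ ρ'), φ.σ g = Holo.var _ ∧ φ.κ = φ.σ w := by
  have h0 := zero_mem_disc hρ
  have hd : ∀ x ∈ disc ρ, deriv g.fn x = w.fn x ^ 2 := fun x hx => by
    rw [← Holo.fn_pd_one _ hx, hg, pow_two, pow_two, Holo.fn_mul]
  obtain ⟨h, ha, hz, -, hi⟩ := exists_local_inverse (g.analytic_fn 0 h0) hg0
    (by rw [hd 0 h0]; exact pow_ne_zero _ hw)
  have hmem : ∀ᶠ x in 𝓝 0, h x ∈ disc ρ := by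
    refine ha.continuousAt.eventually_mem ?_
    rw [hz]
    exact (disc ρ).isOpen.mem_nhds h0
  obtain ⟨ρ', hρ', -, H⟩ := exists_disc_of_eventually
    ((ha.eventually_analyticAt.and hmem).and hi) hρ
  have hA : AnalyticOnNhd ℂ h (disc ρ') := fun x hx => (H x hx).1.1
  have hM : ∀ x ∈ disc ρ', h x ∈ disc ρ := fun x hx => (H x hx).1.2
  refine ⟨ρ', ⟨h, hρ', hA, hz, hM, Holo.comp h hA hM w, ?_⟩, ?_, rfl⟩
  · apply Holo.eq_of_fn
    intro x hx
    rw [Holo.fn_mul, pow_two, Holo.fn_mul, Holo.fn_comp _ _ _ hx, Holo.fn_mk _ _ hx,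
      Holo.fn_one hx, ← pow_two, ← hd _ (hM x hx)]
    have e : deriv (fun y => g.fn (h y)) x = deriv g.fn (h x) * deriv h x :=
      deriv_comp x (g.differentiableAt_fn (hM x hx)) (hA x hx).differentiableAt
    rw [← e]
    have : (fun y => g.fn (h y)) =ᶠ[𝓝 x] id := by
      filter_upwards [(disc ρ').isOpen.mem_nhds hx] with y hy using (H y hy).2
    rw [this.deriv_eq, deriv_id]
  · apply Holo.eq_of_fn
    intro x hx
    rw [fn_σ _ _ hx, Holo.fn_var hx]
    exact (H x hx).2

end CoordChange

end TEStructure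

end

/-! ### A coordinate in which the leading coefficient of f is tʳ -/

noncomputable section

namespace TEStructure

open TopologicalSpace (Opens)

open PowerSeries

namespace Holo

variable {V : Type*} [NormedAddCommGroup V] [NormedSpace ℂ V] {U : Opens V}

lemma exp_add (f g : Holo U) : exp (f + g) = exp f * exp g := by
  apply eq_of_fn
  intro x hx
  rw [fn_mul, exp, exp, exp, fn_mk _ _ hx, fn_mk _ _ hx, fn_mk _ _ hx, fn_add, Complex.exp_add]

lemma exp_zero : exp (0 : Holo U) = 1 := by
  apply eq_of_fn
  intro x hx
  rw [exp, fn_mk _ _ hx, fn_zero, Complex.exp_zero, fn_one hx]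

lemma exp_nsmul (n : ℕ) (f : Holo U) : exp (n • f) = exp f ^ n := by
  induction n with
  | zero => rw [zero_smul, exp_zero, pow_zero]
  | succ n ih => rw [succ_nsmul, exp_add, ih, pow_succ]

lemma exp_fn_ne_zero (f : Holo U) {x : V} (hx : x ∈ U) : (exp f).fn x ≠ 0 := by
  rw [exp, fn_mk _ _ hx]
  exact Complex.exp_ne_zero _

end Holo

section

variable {S : FormalTE 2 2} {ρ : ℝ} {f b : (Holo (disc ρ))⟦X⟧} {g : ℂ⟦X⟧}

lemma HasForm.restrict (H : HasForm S ρ f b g) {ρ' : ℝ} (h : 0 < ρ') (hle : ρ' ≤ ρ) :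
    HasForm S ρ' ((CoordChange.restrict h hle).μ f) ((CoordChange.restrict h hle).μ b) g := by
  have := H.pullback (CoordChange.restrict h hle)
  rwa [CoordChange.h₁_restrict, show (CoordChange.restrict h hle).κ = 1 from rfl,
    Derivation.map_one_eq_zero, map_zero, zero_mul, zero_mul, map_zero, mul_zero, add_zero, one_pow,
    map_one, one_mul, one_mul] at this

/-- A coordinate in which a function without zeros times `t ^ r` becomes `t ^ r`, as a quadratic
differential. -/
lemma exists_quadratic_coordinate (hρ : 0 < ρ) {F : Holo (disc ρ)} {r : ℕ}
    {L y : Holo (disc ρ)} (hF : F = Holo.var _ ^ r * Holo.exp L ^ 2)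
    (hy : ∀ x ∈ disc ρ, y.fn x ≠ 0)
    (hyL : algebraMap ℂ _ (((r + 2) / 2 : ℝ) : ℂ) * y + Holo.var _ * Holo.pd 1 y
      = algebraMap ℂ _ (((r + 2) / 2 : ℝ) : ℂ) * Holo.exp L) :
    ∃ G W : Holo (disc ρ), Holo.pd 1 G = W ^ 2 ∧ W.fn 0 ≠ 0 ∧ G.fn 0 = 0 ∧
      F = G ^ r * Holo.pd 1 G ^ 2 := by
  -- The sought equation GʳG'² = F amounts to (G^((r+2)/2))' = ((r+2)/2) t^(r/2) e^L. The function y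
  -- stands for (G/t)^((r+2)/2): this removes the fractional powers of t and leaves the Euler
  -- equation `hyL`. Accordingly G = t·exp(2Z) with y = exp((r+2)Z).
  have h0 := zero_mem_disc hρ
  obtain ⟨Y, hY⟩ := Holo.exists_log hρ hy
  have hr : ((r : ℂ) + 2) ≠ 0 := by exact_mod_cast (by omega : r + 2 ≠ 0)
  set Z : Holo (disc ρ) := ((r : ℂ) + 2)⁻¹ • Y with hZ
  have hYZ : Y = (r + 2) • Z := by
    rw [hZ, ← Nat.cast_smul_eq_nsmul ℂ, smul_smul]
    push_cast
    rw [mul_inv_cancel₀ hr, one_smul]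
  have hyZ : y = Holo.exp Z ^ (r + 2) := by rw [hY, hYZ, Holo.exp_nsmul]
  have hdy : Holo.pd 1 y = (r + 2 : ℕ) * Holo.pd 1 Z * y := by
    rw [hY, Holo.pd_exp, hYZ, map_nsmul, nsmul_eq_mul]
  have e1 : y * (1 + 2 * Holo.var _ * Holo.pd 1 Z) = Holo.exp L := by
    have hc : algebraMap ℂ (Holo (disc ρ)) ((2 : ℂ) / (r + 2))
        * algebraMap ℂ _ (((r + 2) / 2 : ℝ) : ℂ) = 1 := by
      rw [← map_mul, ← map_one (algebraMap ℂ (Holo (disc ρ)))]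
      congr 1
      push_cast
      field_simp
    have hc' : algebraMap ℂ (Holo (disc ρ)) ((2 : ℂ) / (r + 2)) * ((r + 2 : ℕ) : Holo (disc ρ))
        = 2 := by
      rw [← map_natCast (algebraMap ℂ (Holo (disc ρ))), ← map_mul,
        ← map_ofNat (algebraMap ℂ (Holo (disc ρ))) 2]
      congr 1
      push_cast
      field_simp
    rw [hdy] at hyL
    linear_combination algebraMap ℂ (Holo (disc ρ)) ((2 : ℂ) / (r + 2)) * hyL
      + (Holo.exp L - y) * hc - Holo.var _ * Holo.pd 1 Z * y * hc'
  have hdZ : Holo.pd 1 (Holo.exp Z ^ 2) = 2 * Holo.pd 1 Z * Holo.exp Z ^ 2 := by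
    rw [← Holo.exp_nsmul, Holo.pd_exp, map_nsmul, nsmul_eq_mul]
    push_cast
    ring
  have hdG : Holo.pd 1 (Holo.var _ * Holo.exp Z ^ 2)
      = Holo.exp Z ^ 2 * (1 + 2 * Holo.var _ * Holo.pd 1 Z) := by
    rw [Derivation.leibniz, hdZ, Holo.pd_var, smul_eq_mul, smul_eq_mul]
    ring
  -- Since G' = exp(2Z)·exp(L)/y, half the exponent 2Z + L - Y gives its square root W = exp V.
  set V : Holo (disc ρ) := (2 : ℂ)⁻¹ • (2 • Z + L + -((r + 2) • Z)) with hV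
  have hVW : Holo.exp V ^ 2 = Holo.exp Z ^ 2 * Holo.exp L * Holo.exp (-Y) := by
    rw [← Holo.exp_nsmul, hV, ← Nat.cast_smul_eq_nsmul ℂ, smul_smul]
    push_cast
    rw [mul_inv_cancel₀ two_ne_zero, one_smul, Holo.exp_add, Holo.exp_add, Holo.exp_nsmul, hYZ]
  have hyY : y * Holo.exp (-Y) = 1 := by rw [hY, Holo.exp_mul_exp_neg]
  refine ⟨Holo.var _ * Holo.exp Z ^ 2, Holo.exp V, ?_, Holo.exp_fn_ne_zero _ h0, ?_, ?_⟩
  · rw [hdG, hVW, ← e1]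
    linear_combination -(Holo.exp Z ^ 2 * (1 + 2 * Holo.var _ * Holo.pd 1 Z)) * hyY
  · rw [Holo.fn_mul, Holo.fn_var h0, zero_mul]
  · rw [hdG, hF, ← e1, hyZ]
    ring

/-- Normalization of the leading coefficient of `f`, if it does not vanish. -/
theorem HasForm.exists_coeff_zero_eq_pow (H : HasForm S ρ f b g) (hf : coeff 0 f ≠ 0) :
    ∃ (ρ' : ℝ) (r : ℕ) (f' b' : (Holo (disc ρ'))⟦X⟧), HasForm S ρ' f' b' g ∧
      coeff 0 f' = Holo.var _ ^ r := by
  have hρ := H.1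
  obtain ⟨ρ₁, r, w, hρ₁, hle₁, hw, hfw⟩ := Holo.exists_factorization hρ hf
  obtain ⟨L, hL⟩ := Holo.exists_log hρ₁ hw
  set L' : Holo (disc ρ₁) := (2 : ℂ)⁻¹ • L with hL'
  have hLL : w = Holo.exp L' ^ 2 := by
    rw [← Holo.exp_nsmul, hL', ← Nat.cast_smul_eq_nsmul ℂ, smul_smul]
    push_cast
    rw [mul_inv_cancel₀ two_ne_zero, one_smul, hL]
  have hκ : (0 : ℝ) < (r + 2) / 2 := by positivity
  obtain ⟨y, hy⟩ := exists_euler hκ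
    (algebraMap ℂ _ (((r + 2) / 2 : ℝ) : ℂ) * Holo.exp L' : Holo (disc ρ₁))
  have h0 := zero_mem_disc hρ₁
  -- At the origin the Euler equation reduces to y(0) = exp(L')(0).
  have hy0 : y.fn 0 ≠ 0 := by
    have := congrArg (fun f => Holo.fn f 0) hy
    simp only [Holo.fn_add, Holo.fn_mul, Holo.fn_var h0, Holo.fn_algebraMap _ h0, zero_mul,
      add_zero] at this
    rw [mul_left_cancel₀ (by exact_mod_cast hκ.ne') this]
    exact Holo.exp_fn_ne_zero _ h0
  obtain ⟨ρ₂, hρ₂, hle₂, hne⟩ := exists_disc_of_eventually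
    ((y.analytic_fn 0 h0).continuousAt.eventually_ne hy0) hρ₁
  set ι := CoordChange.restrict hρ₂ hle₂ with hι
  have hιd : ∀ x, Holo.pd 1 (ι.σ x) = ι.σ (Holo.pd 1 x) := fun x => by
    rw [ι.pd_σ, hι, CoordChange.h₁_restrict, one_mul]
  have hιt : ι.σ (Holo.var _) = Holo.var _ := Holo.eq_of_fn fun x hx => by
    rw [hι, CoordChange.fn_restrict _ _ _ hx, Holo.fn_var hx, Holo.fn_var (disc_mono hle₂ hx)]
  have hιe : ι.σ (Holo.exp L') = Holo.exp (ι.σ L') := Holo.eq_of_fn fun x hx => by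
    rw [hι, CoordChange.fn_restrict _ _ _ hx, Holo.exp, Holo.exp, Holo.fn_mk _ _ hx,
      Holo.fn_mk _ _ (disc_mono hle₂ hx), CoordChange.fn_restrict _ _ _ hx]
  have H₂ := H.restrict hρ₂ (hle₂.trans hle₁)
  have hF : coeff 0 ((CoordChange.restrict hρ₂ (hle₂.trans hle₁)).μ f)
      = Holo.var _ ^ r * Holo.exp (ι.σ L') ^ 2 := by
    rw [← hιe, ← map_pow, ← hLL, ← hιt, ← map_pow, ← map_mul, CoordChange.coeff_μ]
    apply Holo.eq_of_fn
    intro x hx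
    have hx₁ := disc_mono hle₂ hx
    have e : ∀ n : ℕ, (Holo.var (disc ρ₁) ^ n).fn x = x ^ n := fun n => by
      induction n with
      | zero => rw [pow_zero, pow_zero, Holo.fn_one hx₁]
      | succ n ih => rw [pow_succ, pow_succ, Holo.fn_mul, ih, Holo.fn_var hx₁]
    rw [CoordChange.fn_restrict _ _ _ hx, hι, CoordChange.fn_restrict _ _ _ hx, Holo.fn_mul, e,
      hfw x hx₁]
  obtain ⟨G, W, hG, hW, hG0, hFG⟩ := exists_quadratic_coordinate hρ₂ (y := ι.σ y) hF
    (fun x hx => by rw [hι, CoordChange.fn_restrict _ _ _ hx]; exact hne x hx) (by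
      have := congrArg ι.σ hy
      simpa only [map_add, map_mul, AlgHom.commutes, hιt, hιe, ← hιd] using this)
  obtain ⟨ρ₃, φ, hφ, -⟩ := CoordChange.exists_inverse hρ₂ hG hW hG0
  refine ⟨ρ₃, r, _, _, H₂.pullback φ, ?_⟩
  have e : φ.h₁ * φ.σ (Holo.pd 1 G) = 1 := by rw [← φ.pd_σ, hφ, Holo.pd_var]
  rw [map_add, coeff_zero_X_mul, add_zero, coeff_C_mul, CoordChange.coeff_μ, hFG, map_mul, map_pow,
    map_pow, hφ]
  linear_combination (φ.h₁ * φ.σ (Holo.pd 1 G) + 1) * Holo.var _ ^ r * e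

end

end TEStructure

end

/-! ### Reduction of (f, b) to (1, -t/2 + c₀), (tʳ, -t/(r+2)) or (0, quadratic) -/

noncomputable section

namespace TEStructure

open TopologicalSpace (Opens)

open PowerSeries

/-- The quadratic polynomial in `t` with coefficients in `ℂ⟦z⟧`. -/
def quadForm {R : Type*} [CommRing R] [Algebra ℂ R] (t : R) (b₀ b₁ b₂ : ℂ⟦X⟧) : R⟦X⟧ :=
  cst R b₀ + cst R b₁ * C t + cst R b₂ * C t ^ 2

/-- All terms are multiples of tʳ with total factor 1 - (r + 2)μ = 0, and b has no third derivative.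
-/
lemma isCompatible_pow {R : Type*} [CommRing R] [Algebra ℂ R] {d : Derivation ℂ R R} {t : R}
    (ht : d t = 1) (r : ℕ) {μ : ℂ} (hμ : μ = 1 / (r + 2)) :
    IsCompatible d (C t ^ r) (-(C (algebraMap ℂ R μ) * C t)) := by
  have hr : ((r : ℂ) + 2) ≠ 0 := by exact_mod_cast (by omega : r + 2 ≠ 0)
  have h1 : C (algebraMap ℂ R μ) * ((r : R⟦X⟧) + 2) = 1 := by
    have : algebraMap ℂ R μ * ((r : R) + 2) = 1 := by
      rw [← map_natCast (algebraMap ℂ R) r, ← map_ofNat (algebraMap ℂ R) 2, ← map_add, ← map_mul,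
        hμ, one_div, inv_mul_cancel₀ hr, map_one]
    rw [← map_natCast C r, ← map_ofNat C 2, ← map_add, ← map_mul, this, map_one]
  have h2 : (r : R⟦X⟧) * C t ^ (r - 1) * C t = r * C t ^ r := by
    rcases r with _ | r
    · simp
    · rw [Nat.add_sub_cancel]; ring
  have h3 : derivative R (C t ^ r) = 0 := by rw [← map_pow, derivative_C]
  have h4 : liftD d (C t ^ r) = r * C t ^ (r - 1) := by
    rw [Derivation.leibniz_pow, liftD_C, ht, map_one]; simp
  rw [IsCompatible, h3, h4]
  simp [ht]
  linear_combination -C t ^ r * h1 - C (algebraMap ℂ R μ) * h2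

section

variable {S : FormalTE 2 2} {ρ : ℝ} {f b : (Holo (disc ρ))⟦X⟧} {g : ℂ⟦X⟧}

theorem HasForm.of_coeff_zero_eq_one (H : HasForm S ρ f b g) (hf : coeff 0 f = 1) :
    ∃ (c₀ : ℂ) (g' : ℂ⟦X⟧),
      HasForm S ρ 1 (quadForm (Holo.var _) (C c₀) (C (-1 / 2)) 0) g' := by
  obtain ⟨T, s', b', hT, gA, gB, hs, hb⟩ :=
    (discCalculus H.1).exists_gauge_of_coeff_zero_eq_one hf (liftD_cst _ g) H.2.1
  rw [(discCalculus H.1).eq_cst_of_liftD_eq_zero hs] at gB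
  have H' := H.gauge hT hb gA gB
  have hb' := (discCalculus H.1).eq_of_isCompatible_one hb
  rw [hb'] at H'
  obtain ⟨T, hT, gA, gB⟩ := (discCalculus H.1).exists_gauge_constant_one
    (cst _ ((discCalculus H.1).Ev s')) ((discCalculus H.1).Ev b')
  have e : ∀ c₀ : ℂ, quadForm (Holo.var (disc ρ)) (C c₀) (C (-1 / 2)) 0
      = -(half (Holo (disc ρ)) * C (Holo.var (disc ρ))) + cst _ (C c₀) := by
    intro c₀
    rw [quadForm, half_eq_C, cst_C, cst_C, neg_div, map_neg, map_neg, map_zero]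
    ring
  refine ⟨coeff 0 ((discCalculus H.1).Ev b'), (discCalculus H.1).Ev s', ?_⟩
  rw [e]
  refine H'.gauge hT ?_ gA gB
  have h2 := two_mul_half (R := Holo (disc ρ))
  simp [IsCompatible, Holo.pd_var]
  linear_combination -h2

/-- Differentiating ty = 0 gives y + ty' = 0, the homogeneous Euler equation with κ = 1. -/
lemma Holo.eq_zero_of_var_pow_mul (hρ : 0 < ρ) {x : Holo (disc ρ)} (n : ℕ)
    (h : Holo.var _ ^ n * x = 0) : x = 0 := by
  induction n with
  | zero => simpa using h
  | succ n ih =>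
    refine ih (Holo.euler_unique hρ (κ := 1) one_pos ?_)
    have h' : Holo.var _ * (Holo.var _ ^ n * x) = 0 := by rw [← h]; ring
    have := congrArg (Holo.pd (1 : ℂ)) h'
    rw [Derivation.leibniz, Holo.pd_var, map_zero, smul_eq_mul, smul_eq_mul] at this
    rw [Complex.ofReal_one, map_one]
    linear_combination this

theorem HasForm.of_coeff_zero_eq_pow (H : HasForm S ρ f b g) {r : ℕ} (hr : 1 ≤ r)
    (hf : coeff 0 f = Holo.var _ ^ r) :
    HasForm S ρ (C (Holo.var _ ^ r)) (quadForm (Holo.var _) 0 (C (-(1 / (r + 2)))) 0) g := by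
  have hρ := H.1
  have hr2 : ((r : ℂ) + 2) ≠ 0 := by exact_mod_cast (by omega : r + 2 ≠ 0)
  set μ : ℂ := 1 / (r + 2) with hμ
  have hc := isCompatible_pow (Holo.pd_var (U := disc ρ)) r hμ
  have hμ1 : algebraMap ℂ (Holo (disc ρ)) μ * ((r : Holo (disc ρ)) + 2) = 1 := by
    rw [← map_natCast (algebraMap ℂ (Holo (disc ρ))) r,
      ← map_ofNat (algebraMap ℂ (Holo (disc ρ))) 2, ← map_add, ← map_mul,
      hμ, one_div, inv_mul_cancel₀ hr2, map_one]
  -- At z⁰ compatibility reads tʳ + r tʳ⁻¹β + 2tʳβ' = 0. Dividing by 2tʳ⁻¹ leaves an Euler equation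
  -- with constant r/2 > 0, whose only solution is -t/(r+2).
  have hb₀ : coeff 0 b = -(algebraMap ℂ _ μ * Holo.var (disc ρ)) := by
    rw [← sub_eq_zero, sub_neg_eq_add]
    set β := coeff 0 b with hβ
    have h := congrArg (coeff 0) H.2.1
    have e1 : coeff 0 (half (Holo (disc ρ)) * X
        * liftD (Holo.pd 1) (liftD (Holo.pd 1) (liftD (Holo.pd 1) b))) = 0 := by
      rw [mul_comm (half _), mul_assoc, coeff_zero_X_mul]
    rw [e1] at h
    simp only [map_add, map_sub, coeff_zero_X_mul, sub_zero] at h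
    rw [mul_assoc, coeff_zero_eq_constantCoeff, map_mul, map_mul, map_mul] at h
    simp only [← coeff_zero_eq_constantCoeff, coeff_liftD, hf, ← hβ] at h
    have e2 : coeff 0 (2 : (Holo (disc ρ))⟦X⟧) = 2 := by
      rw [coeff_zero_eq_constantCoeff, map_ofNat]
    rw [e2, Derivation.leibniz_pow, Holo.pd_var, smul_eq_mul, mul_one, nsmul_eq_mul] at h
    obtain ⟨n, rfl⟩ : ∃ n, r = n + 1 := ⟨r - 1, by omega⟩
    rw [Nat.add_sub_cancel] at h
    have h3 : Holo.var _ ^ n * (Holo.var _ + ((n + 1 : ℕ) : Holo (disc ρ)) * β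
        + 2 * Holo.var _ * Holo.pd 1 β) = 0 := by
      linear_combination h
    replace h3 := Holo.eq_zero_of_var_pow_mul hρ n h3
    refine Holo.euler_unique hρ (κ := (n + 1) / 2) (by positivity) ?_
    have hd : Holo.pd 1 (β + algebraMap ℂ _ μ * Holo.var (disc ρ))
        = Holo.pd 1 β + algebraMap ℂ _ μ := by
      rw [map_add, Derivation.leibniz, Holo.pd_var, Derivation.map_algebraMap, smul_eq_mul, mul_one,
        smul_zero, add_zero]
    rw [hd]
    have e3 : algebraMap ℂ (Holo (disc ρ)) ((((n : ℝ) + 1) / 2 : ℝ) : ℂ) * 2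
        = ((n + 1 : ℕ) : Holo (disc ρ)) := by
      rw [← map_natCast (algebraMap ℂ (Holo (disc ρ))),
        ← map_ofNat (algebraMap ℂ (Holo (disc ρ))) 2, ← map_mul]
      congr 1
      push_cast
      ring
    have e4 : algebraMap ℂ (Holo (disc ρ)) (1 / 2) * 2 = 1 := by
      rw [← map_ofNat (algebraMap ℂ (Holo (disc ρ))) 2, ← map_mul]
      simp
    set η := algebraMap ℂ (Holo (disc ρ)) (1 / 2)
    set K := algebraMap ℂ (Holo (disc ρ)) ((((n : ℝ) + 1) / 2 : ℝ) : ℂ)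
    set m := algebraMap ℂ (Holo (disc ρ)) μ
    set t := Holo.var (disc ρ)
    linear_combination η * h3 + η * (β + m * t) * e3
      - (K * (β + m * t) + t * Holo.pd 1 β + m * t) * e4 + η * t * hμ1
  have := (discCalculus hρ).exists_gauge_of_coeff_zero_eq_pow r hμ hf hb₀ (liftD_cst _ g) H.2.1 hc
  obtain ⟨T, hT, gA, gB⟩ := this
  have H' := H.gauge hT hc gA gB
  have e : quadForm (Holo.var (disc ρ)) 0 (C (-μ)) 0
      = -(C (algebraMap ℂ _ μ) * C (Holo.var (disc ρ))) := by
    rw [quadForm, cst_C, map_neg, map_neg, map_zero]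
    ring
  rw [e, map_pow]
  exact H'

lemma CoordChange.pd_restrict {ρ' : ℝ} (h : 0 < ρ') (hle : ρ' ≤ ρ) (x : Holo (disc ρ)) :
    Holo.pd 1 ((CoordChange.restrict h hle).σ x)
      = (CoordChange.restrict h hle).σ (Holo.pd 1 x) := by
  rw [CoordChange.pd_σ, CoordChange.h₁_restrict, one_mul]

/-- A coordinate `G` with `G' = φ⁻²`, where `φ'' = q φ`. -/
lemma exists_projective_coordinate (hρ : 0 < ρ) (q : Holo (disc ρ)) {ν : ℂ} (hν : ν ≠ 0) (x : ℂ) :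
    ∃ (ρ' : ℝ) (h : 0 < ρ') (hle : ρ' ≤ ρ) (G φ w : Holo (disc ρ')), φ * w = 1 ∧
      Holo.pd 1 G = w ^ 2 ∧
      Holo.pd 1 (Holo.pd 1 φ) = (CoordChange.restrict h hle).σ q * φ ∧ G.fn 0 = 0 ∧ φ.fn 0 = ν ∧
      (Holo.pd 1 φ).fn 0 = x * ν := by
  have h0 := zero_mem_disc hρ
  set M : ℝ := ‖q.fn 0‖ + 1 with hM
  have hM1 : 1 ≤ M := by rw [hM]; linarith [norm_nonneg (q.fn 0)]
  have hev : ∀ᶠ y in 𝓝 (0 : ℂ), ‖q.fn y‖ < M :=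
    (q.analytic_fn 0 h0).continuousAt.norm.eventually_lt_const (by rw [hM]; linarith)
  obtain ⟨ρ₁, hρ₁, hle₁, hb⟩ := exists_disc_of_eventually hev
    (lt_min hρ (by positivity : 0 < 1 / (2 * M)))
  have hρ₁ρ : ρ₁ ≤ ρ := hle₁.trans (min_le_left _ _)
  have hρ₁M : ρ₁ ≤ 1 / (2 * M) := hle₁.trans (min_le_right _ _)
  have hMρ : M * ρ₁ ≤ 1 / 2 := by
    have := mul_le_mul_of_nonneg_left hρ₁M (by positivity : 0 ≤ M)
    refine this.trans (le_of_eq ?_)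
    field_simp
  have hρ₁1 : ρ₁ ≤ 1 := by nlinarith
  set q₁ := (CoordChange.restrict hρ₁ hρ₁ρ).σ q with hq₁
  have hq₁b : ∀ y ∈ disc ρ₁, ‖q₁.fn y‖ ≤ M := fun y hy => by
    rw [hq₁, CoordChange.fn_restrict _ _ _ hy]; exact (hb y hy).le
  have hMρ2 : M * ρ₁ ^ 2 ≤ 1 / 2 := by nlinarith
  obtain ⟨u, hu, hu0, hu1⟩ := Holo.exists_solution_of_small hρ₁ hρ₁1 hq₁b hMρ2 ν (x * ν)
  obtain ⟨v, hv, hv0, hv1⟩ := Holo.exists_solution_of_small hρ₁ hρ₁1 hq₁b hMρ2 0 ν⁻¹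
  have h01 := zero_mem_disc hρ₁
  -- The Wronskian of the two solutions is constant, equal to 1; therefore (v/u)' = u⁻², and G = v/u
  -- is the coordinate.
  have hW : Holo.pd 1 v * u - v * Holo.pd 1 u - 1 = 0 := by
    refine Holo.eq_zero_of_pd hρ₁ ?_ ?_
    · simp only [map_sub, Derivation.leibniz, smul_eq_mul, hu, hv, Derivation.map_one_eq_zero]
      ring
    · simp only [Holo.fn_sub, Holo.fn_mul, hu0, hv0, hu1, hv1, Holo.fn_one h01]
      rw [inv_mul_cancel₀ hν]; ring
  obtain ⟨ρ₂, hρ₂, hle₂, hne⟩ := exists_disc_of_eventually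
    ((u.analytic_fn 0 h01).continuousAt.eventually_ne (by rw [hu0]; exact hν)) hρ₁
  set ι := CoordChange.restrict hρ₂ hle₂ with hι
  have hιd : ∀ x, Holo.pd 1 (ι.σ x) = ι.σ (Holo.pd 1 x) := CoordChange.pd_restrict hρ₂ hle₂
  obtain ⟨w, hw⟩ := ((ι.σ u).isUnit_of_ne_zero fun y hy => by
    rw [hι, CoordChange.fn_restrict _ _ _ hy]; exact hne y hy).exists_right_inv
  have hdw : Holo.pd 1 w = -(ι.σ (Holo.pd 1 u) * w ^ 2) := by
    have := congrArg (Holo.pd (1 : ℂ)) hw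
    rw [Derivation.leibniz, Derivation.map_one_eq_zero, smul_eq_mul, smul_eq_mul, hιd] at this
    linear_combination w * this - Holo.pd 1 w * hw
  have hW' := congrArg ι.σ hW
  rw [map_sub, map_sub, map_mul, map_mul, map_one, map_zero] at hW'
  refine ⟨ρ₂, hρ₂, hle₂.trans hρ₁ρ, ι.σ v * w, ι.σ u, w, hw, ?_, ?_, ?_, ?_, ?_⟩
  · rw [Derivation.leibniz, hdw, hιd, smul_eq_mul, smul_eq_mul]
    linear_combination w ^ 2 * hW' - w * ι.σ (Holo.pd 1 v) * hw
  · rw [hιd, hιd, hu, map_mul]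
    congr 1
    apply Holo.eq_of_fn
    intro y hy
    rw [hι, CoordChange.fn_restrict _ _ _ hy, hq₁, CoordChange.fn_restrict _ _ _ (disc_mono hle₂ hy),
      CoordChange.fn_restrict _ _ _ hy]
  · rw [Holo.fn_mul, ι.fn_σ_zero, hv0, zero_mul]
  · rw [ι.fn_σ_zero, hu0]
  · rw [hιd, ι.fn_σ_zero, hu1]

lemma coeff_zero_quadForm {R : Type*} [CommRing R] [Algebra ℂ R] (t : R) (b₀ b₁ b₂ : ℂ⟦X⟧) :
    coeff 0 (quadForm t b₀ b₁ b₂) = algebraMap ℂ R (coeff 0 b₀) + algebraMap ℂ R (coeff 0 b₁) * t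
      + algebraMap ℂ R (coeff 0 b₂) * t ^ 2 := by
  rw [quadForm, ← map_pow, map_add, map_add, coeff_mul_C, coeff_mul_C, coeff_cst, coeff_cst,
    coeff_cst]

/-- Normalization of `f` to zero, with control of the leading coefficients of `b`. -/
theorem HasForm.exists_quadForm (H : HasForm S ρ f b g) (hf : coeff 0 f = 0) {ν : ℂ} (hν : ν ≠ 0)
    (x : ℂ) : ∃ (ρ' : ℝ) (b₀ b₁ b₂ g' : ℂ⟦X⟧),
      HasForm S ρ' 0 (quadForm (Holo.var _) b₀ b₁ b₂) g' ∧
      coeff 0 b₀ = (coeff 0 b).fn 0 / ν ^ 2 ∧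
      coeff 0 b₁ = (Holo.pd 1 (coeff 0 b)).fn 0 - 2 * x * (coeff 0 b).fn 0 ∧
      2 * coeff 0 b₂ = ν ^ 2 * ((Holo.pd 1 (Holo.pd 1 (coeff 0 b))).fn 0
        - 2 * (coeff 1 f).fn 0 * (coeff 0 b).fn 0 + 2 * x ^ 2 * (coeff 0 b).fn 0
        - 2 * x * (Holo.pd 1 (coeff 0 b)).fn 0) := by
  obtain ⟨ρ₁, hρ₁, hle, G, φ, w, hφw, hG, hφ, hG0, hφ0, hφ1⟩ :=
    exists_projective_coordinate H.1 (coeff 1 f) hν x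
  set ι := CoordChange.restrict hρ₁ hle with hι
  have h01 := zero_mem_disc hρ₁
  have hw0 : w.fn 0 = ν⁻¹ := by
    have := congrArg (fun f => Holo.fn f 0) hφw
    simp only [Holo.fn_mul, hφ0, Holo.fn_one h01] at this
    exact eq_inv_of_mul_eq_one_right this
  obtain ⟨ρ₂, ψ, hψG, hκ⟩ := CoordChange.exists_inverse hρ₁ hG
    (by rw [hw0]; exact inv_ne_zero hν) hG0
  have H₁ := (H.restrict hρ₁ hle).pullback ψ
  have hh : ψ.h₁ * ψ.σ w ^ 2 = 1 := by
    have := ψ.κ_sq_mul_h₁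
    rw [hκ] at this
    linear_combination this
  have hφw' : ψ.σ φ * ψ.σ w = 1 := by rw [← map_mul, hφw, map_one]
  have hdw : Holo.pd 1 w = -(Holo.pd 1 φ * w ^ 2) := by
    have := congrArg (Holo.pd (1 : ℂ)) hφw
    rw [Derivation.leibniz, Derivation.map_one_eq_zero, smul_eq_mul, smul_eq_mul] at this
    linear_combination w * this - Holo.pd 1 w * hφw
  have hdκ : Holo.pd 1 ψ.κ = -ψ.σ (Holo.pd 1 φ) := by
    rw [hκ, ψ.pd_σ, hdw, map_neg, map_mul, map_pow]
    linear_combination -ψ.σ (Holo.pd 1 φ) * hh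
  -- Here the choice φ'' = qφ, with q the z-coefficient of f, takes effect: κ''κh₁ = -h₁²q in the
  -- new coordinate, which cancels the z-coefficient of the transformed f.
  have hddκ : Holo.pd 1 (Holo.pd 1 ψ.κ) = -(ψ.h₁ * ψ.σ (ι.σ (coeff 1 f)) * ψ.σ φ) := by
    rw [hdκ, map_neg, ψ.pd_σ, hφ, map_mul]
    ring
  set β := coeff 0 b with hβ
  set β₁ := ι.σ β with hβ₁
  have hd₁ : Holo.pd 1 β₁ = ι.σ (Holo.pd 1 β) := CoordChange.pd_restrict hρ₁ hle β
  have hd₂ : Holo.pd 1 (Holo.pd 1 β₁) = ι.σ (Holo.pd 1 (Holo.pd 1 β)) := by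
    rw [hd₁]; exact CoordChange.pd_restrict hρ₁ hle _
  have hB0 : coeff 0 (C (ψ.κ ^ 2) * ψ.μ (ι.μ b)) = ψ.σ (w ^ 2 * β₁) := by
    rw [coeff_C_mul, CoordChange.coeff_μ, CoordChange.coeff_μ, hκ, map_mul, map_pow]
  have hB1 : Holo.pd 1 (ψ.σ (w ^ 2 * β₁)) = ψ.σ (Holo.pd 1 β₁ - 2 * Holo.pd 1 φ * w * β₁) := by
    have : Holo.pd 1 (w ^ 2 * β₁) = w ^ 2 * (Holo.pd 1 β₁ - 2 * Holo.pd 1 φ * w * β₁) := by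
      rw [Derivation.leibniz, Derivation.leibniz_pow, hdw]
      simp only [smul_eq_mul, nsmul_eq_mul]
      push_cast
      ring
    rw [ψ.pd_σ, this, map_mul, map_pow]
    linear_combination ψ.σ (Holo.pd 1 β₁ - 2 * Holo.pd 1 φ * w * β₁) * hh
  have hB2 : Holo.pd 1 (Holo.pd 1 (ψ.σ (w ^ 2 * β₁))) = ψ.h₁ * ψ.σ (Holo.pd 1 (Holo.pd 1 β₁)
      - 2 * ι.σ (coeff 1 f) * φ * w * β₁ + 2 * Holo.pd 1 φ ^ 2 * w ^ 2 * β₁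
      - 2 * Holo.pd 1 φ * w * Holo.pd 1 β₁) := by
    have h2 : Holo.pd 1 (2 : Holo (disc ρ₁)) = 0 := by
      simpa using (Holo.pd (1 : ℂ)).map_natCast (A := Holo (disc ρ₁)) 2
    rw [hB1, ψ.pd_σ]
    congr 2
    simp only [map_sub, Derivation.leibniz, smul_eq_mul, hφ, hdw, h2]
    ring
  obtain ⟨T, s', b', hT, gA, gB, hs, hb, hb0⟩ :=
    (discCalculus ψ.pos).exists_gauge_of_coeff_eq_zero (by
      rw [map_add, coeff_zero_X_mul, coeff_C_mul, CoordChange.coeff_μ, CoordChange.coeff_μ, hf]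
      simp) (by
      rw [map_add, show (1 : ℕ) = 0 + 1 from rfl, coeff_succ_X_mul, coeff_C_mul,
        CoordChange.coeff_μ, CoordChange.coeff_μ, hddκ, hκ, coeff_zero_C]
      linear_combination -(ψ.h₁ ^ 2 * ψ.σ (ι.σ (coeff 1 f))) * hφw') (liftD_cst _ g) H₁.2.1
  rw [(discCalculus ψ.pos).eq_cst_of_liftD_eq_zero hs] at gB
  have H₂ := H₁.gauge hT hb gA gB
  obtain ⟨b₀, b₁, b₂, hbb⟩ := (discCalculus ψ.pos).eq_of_isCompatible_zero hb
  have hq : b' = quadForm (Holo.var _) b₀ b₁ b₂ := hbb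
  rw [hq] at H₂
  -- The gauge leaves the leading term of b untouched, so the constant terms of b₀, b₁, b₂ follow
  -- from this identity and its first two derivatives at t = 0.
  have hB0' : algebraMap ℂ _ (coeff 0 b₀) + algebraMap ℂ _ (coeff 0 b₁) * Holo.var _
      + algebraMap ℂ _ (coeff 0 b₂) * Holo.var _ ^ 2 = ψ.σ (w ^ 2 * β₁) := by
    rw [← coeff_zero_quadForm, ← hq, hb0, hB0]
  have h02 := zero_mem_disc ψ.pos
  have hB1' := congrArg (Holo.pd (1 : ℂ)) hB0'
  rw [hB1] at hB1'
  have hB2' := congrArg (Holo.pd (1 : ℂ)) hB0'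
  replace hB2' := congrArg (Holo.pd (1 : ℂ)) hB2'
  rw [hB2] at hB2'
  simp only [map_add, Derivation.leibniz, Derivation.leibniz_pow, Derivation.map_algebraMap,
    smul_eq_mul, Holo.pd_var, nsmul_eq_mul, add_zero, mul_one, pow_one, mul_zero,
    Nat.cast_ofNat, Nat.add_one_sub_one, zero_add] at hB1' hB2'
  have e0 := congrArg (fun f => Holo.fn f 0) hB0'
  have e1 := congrArg (fun f => Holo.fn f 0) hB1'
  have e2 := congrArg (fun f => Holo.fn f 0) hB2'
  have hν2 : ψ.h₁.fn 0 = ν ^ 2 := by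
    have := congrArg (fun f => Holo.fn f 0) hh
    simp only [Holo.fn_mul, pow_two, Holo.fn_one h02, ψ.fn_σ_zero, hw0] at this
    field_simp at this
    exact this
  have v0 : β₁.fn 0 = β.fn 0 := ι.fn_σ_zero _
  have v1 : (Holo.pd 1 β₁).fn 0 = (Holo.pd 1 β).fn 0 := by rw [hd₁, ι.fn_σ_zero]
  have v2 : (Holo.pd 1 (Holo.pd 1 β₁)).fn 0 = (Holo.pd 1 (Holo.pd 1 β)).fn 0 := by
    rw [hd₂, ι.fn_σ_zero]
  have two : (2 : Holo (disc ρ₁)).fn 0 = 2 := by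
    have := Holo.fn_algebraMap (U := disc ρ₁) 2 h01
    rwa [map_ofNat] at this
  have two' : (2 : Holo (disc ρ₂)).fn 0 = 2 := by
    have := Holo.fn_algebraMap (U := disc ρ₂) 2 h02
    rwa [map_ofNat] at this
  simp only [Holo.fn_add, Holo.fn_sub, Holo.fn_mul, Holo.fn_var h02, Holo.fn_algebraMap _ h02,
    pow_two, mul_zero, zero_mul, add_zero, ψ.fn_σ_zero, hw0, ι.fn_σ_zero, v0, v1, v2, hν2, two, two',
    hφ0, hφ1] at e0 e1 e2
  refine ⟨ρ₂, b₀, b₁, b₂, _, H₂, ?_, ?_, ?_⟩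
  · rw [e0]; field_simp
  · rw [e1]; field_simp
  · rw [mul_comm, e2]; field_simp
end

end TEStructure

end

/-! ### Explicit matrices of the reduced pairs -/

noncomputable section

namespace TEStructure

open TopologicalSpace (Opens)

open PowerSeries

section Generic

variable {R : Type*} [CommRing R] [Algebra ℂ R] {d : Derivation ℂ R R} {t : R}

lemma liftD_quadForm (ht : d t = 1) (b₀ b₁ b₂ : ℂ⟦X⟧) :
    liftD d (quadForm t b₀ b₁ b₂) = cst R b₁ + 2 * cst R b₂ * C t := by
  simp [quadForm, ht]
  ring

lemma isCompatible_zero_quadForm (ht : d t = 1) (b₀ b₁ b₂ : ℂ⟦X⟧) :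
    IsCompatible d 0 (quadForm t b₀ b₁ b₂) := by
  simp [IsCompatible, liftD_quadForm ht, ht]

lemma isCompatible_one_quadForm (ht : d t = 1) (c₀ : ℂ) :
    IsCompatible d 1 (quadForm t (C c₀) (C (-1 / 2)) 0) := by
  have h2 : cst R (C (-1 / 2)) = -half R := by
    rw [half_eq_C, cst_C, neg_div, map_neg, map_neg]
  have := two_mul_half (R := R)
  rw [IsCompatible, liftD_quadForm ht, h2]
  simp
  linear_combination -this

lemma isCompatible_pow_quadForm (ht : d t = 1) (r : ℕ) :
    IsCompatible d (C (t ^ r)) (quadForm t 0 (C (-(1 / (r + 2)))) 0) := by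
  have e : quadForm t 0 (C (-(1 / ((r : ℂ) + 2)))) 0
      = -(C (algebraMap ℂ R (1 / (r + 2))) * C t) := by
    rw [quadForm, cst_C, map_neg, map_neg, map_zero]
    ring
  rw [e, map_pow]
  exact isCompatible_pow ht r rfl

end Generic

/-- The matrix `B` of a structure with `f = a tʳ` and `b = b₀ + b₁ t + b₂ t²`, without `-t₁`. -/
def normalB (g : ℂ⟦X⟧) (a : ℂ) (r : ℕ) (b₀ b₁ b₂ : ℂ⟦X⟧) (x : ℂ) : ZMat 2 :=
  g • C₁ + (b₀ + b₁ * k x + b₂ * k x ^ 2) • C₂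
    - (z * k (1 / 2) * (b₁ + 2 * b₂ * k x + 1)) • D
    + (z * (k (a * x ^ r) * (b₀ + b₁ * k x + b₂ * k x ^ 2) - z * b₂)) • E

section Realize

variable {U : Opens ℂ} {x : ℂ}

lemma map_eval_cst (y : U) (g : ℂ⟦X⟧) :
    PowerSeries.map (Holo.eval y : Holo U →+* ℂ) (cst _ g) = g := by
  ext n
  simp

lemma eval_var (y : U) : Holo.eval y (Holo.var U) = y := by
  rw [Holo.eval_eq_fn, Holo.fn_var y.2]

lemma realize_companionA (hx : x ∈ U) (a : ℂ) (r : ℕ) :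
    realize (companionA (C (a • Holo.var U ^ r))) x = C₂ + (z * k (a * x ^ r)) • E := by
  rw [show realize (companionA (C (a • Holo.var U ^ r))) x = _ from realize_eq _ (⟨x, hx⟩ : U)]
  ext1 i j
  fin_cases i <;> fin_cases j <;>
    simp [companionA, C₂, E, eval_var]

lemma realize_companionB (hx : x ∈ U) (g : ℂ⟦X⟧) (a : ℂ) (r : ℕ) (b₀ b₁ b₂ : ℂ⟦X⟧) :
    realize (companionB (Holo.pd 1) (cst _ g) (C (a • Holo.var U ^ r))
      (quadForm (Holo.var U) b₀ b₁ b₂)) x = normalB g a r b₀ b₁ b₂ x := by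
  have h2 := two_mul_half (R := Holo U)
  have e1 : liftD (Holo.pd 1) (diagB (Holo.pd 1) (quadForm (Holo.var U) b₀ b₁ b₂))
      = -(X * cst _ b₂) := by
    rw [liftD_diagB, liftD_quadForm Holo.pd_var]
    have : liftD (Holo.pd 1) (cst _ b₁ + 2 * cst _ b₂ * C (Holo.var U)) = 2 * cst _ b₂ := by
      have e := liftD_quadForm (Holo.pd_var (U := U)) b₁ (2 * b₂) 0
      rw [quadForm, map_mul, map_ofNat, map_zero, zero_mul, add_zero] at e
      simpa using e
    rw [this]
    linear_combination -X * cst _ b₂ * h2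
  have e2 : PowerSeries.map (Holo.eval (⟨x, hx⟩ : U) : Holo U →+* ℂ) (half (Holo U)) = k (1 / 2) := by
    rw [half_eq_C, PowerSeries.map_C]; simp
  have e3 : PowerSeries.map (Holo.eval (⟨x, hx⟩ : U) : Holo U →+* ℂ)
      (quadForm (Holo.var U) b₀ b₁ b₂) = b₀ + b₁ * k x + b₂ * k x ^ 2 := by
    simp [quadForm, map_eval_cst, eval_var]
  have e4 : PowerSeries.map (Holo.eval (⟨x, hx⟩ : U) : Holo U →+* ℂ)
      (diagB (Holo.pd 1) (quadForm (Holo.var U) b₀ b₁ b₂))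
        = -(z * k (1 / 2) * (b₁ + 2 * b₂ * k x + 1)) := by
    rw [diagB, liftD_quadForm Holo.pd_var]
    simp only [map_neg, map_mul, map_add, e2, PowerSeries.map_X, map_eval_cst, PowerSeries.map_C,
      map_one, map_ofNat, RingHom.coe_coe, eval_var]
    ring
  have e5 : PowerSeries.map (Holo.eval (⟨x, hx⟩ : U) : Holo U →+* ℂ) (C (a • Holo.var U ^ r))
      = k (a * x ^ r) := by
    simp [eval_var]
  rw [show realize (companionB (Holo.pd 1) (cst _ g) (C (a • Holo.var U ^ r))
      (quadForm (Holo.var U) b₀ b₁ b₂)) x = _ from realize_eq _ (⟨x, hx⟩ : U), companionB, e1,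
      normalB]
  ext1 i j
  fin_cases i <;> fin_cases j <;>
    simp only [RingHom.mapMatrix_apply, Matrix.map_apply, Matrix.of_apply, Matrix.cons_val', Fin.zero_eta,
      Fin.mk_one, Matrix.cons_val_zero, Matrix.cons_val_one, Matrix.cons_val_fin_one, map_add,
      map_sub, map_mul, map_neg, e3, e4, e5, map_eval_cst, PowerSeries.map_X, C₁, C₂, D, E,
      Matrix.add_apply, Matrix.sub_apply, Matrix.smul_apply, smul_eq_mul, Matrix.one_apply] <;>
    simp <;> ring

end Realize

/-- Recognition of normal forms. -/
theorem HasForm.exists_normalForm {S : FormalTE 2 2} {ρ : ℝ} {a : ℂ} {r : ℕ} {b₀ b₁ b₂ : ℂ⟦X⟧}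
    {c α : ℂ} (H : HasForm S ρ (C (a • Holo.var _ ^ r)) (quadForm (Holo.var _) b₀ b₁ b₂)
      (C c + C α * X))
    (hc : IsCompatible (Holo.pd 1) (C (a • Holo.var ⊤ ^ r)) (quadForm (Holo.var ⊤) b₀ b₁ b₂))
    (hN : NormalForm (fun _ => C₁) (fun t => C₂ + (z * k (a * t 1 ^ r)) • E)
      fun t => normalB (C c + C α * X) a r b₀ b₁ b₂ (t 1) - k (t 0) • 1) :
    ∃ N : FormalTE 2 2, IsNormalForm N ∧ LiesOverN2 N ∧ FormallyIsomorphic S N := by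
  obtain ⟨hρ, hc', H⟩ := H
  have hT : (0 : ℂ) ∈ (⊤ : Opens ℂ) := trivial
  refine ⟨ofOneVar hT (companionA (C (a • Holo.var ⊤ ^ r)))
    (companionB (Holo.pd 1) (cst _ (C c + C α * X)) (C (a • Holo.var ⊤ ^ r))
      (quadForm (Holo.var ⊤) b₀ b₁ b₂)) (isFlat_companion (liftD_cst _ _) hc), ?_,
    liesOverN2_of_companion, H.trans (formallyIsomorphic_of_realize_eq ?_ ?_)⟩
  · rw [IsNormalForm]
    convert hN using 1
    · funext t
      exact ofOneVar_A_zero (U := ⊤) trivial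
    · funext t
      rw [ofOneVar_A_one, realize_companionA (U := ⊤) trivial]
    · funext t
      rw [ofOneVar_B (U := ⊤) trivial, realize_companionB (U := ⊤) trivial]
  · filter_upwards [(disc ρ).isOpen.mem_nhds (zero_mem_disc hρ)] with x hx
    rw [realize_companionA hx, realize_companionA (U := ⊤) trivial]
  · filter_upwards [(disc ρ).isOpen.mem_nhds (zero_mem_disc hρ)] with x hx
    rw [realize_companionB hx, realize_companionB (U := ⊤) trivial]

end TEStructure

end

/-! ### Matching with the list of normal forms -/

noncomputable section

namespace TEStructure

open TopologicalSpace (Opens)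

open PowerSeries

lemma normalB_eq {c α a : ℂ} {r : ℕ} {b₀ b₁ b₂ β δ ε : ℂ⟦X⟧} {t : Base 2}
    (hβ : b₀ + b₁ * k (t 1) + b₂ * k (t 1) ^ 2 = β)
    (hδ : z * k (1 / 2) * (b₁ + 2 * b₂ * k (t 1) + 1) = δ)
    (hε : z * (k (a * t 1 ^ r) * (b₀ + b₁ * k (t 1) + b₂ * k (t 1) ^ 2) - z * b₂) = ε) :
    normalB (C c + C α * X) a r b₀ b₁ b₂ (t 1) - k (t 0) • 1
      = scalarPart c α t + β • C₂ - δ • D + ε • E := by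
  have h : k (-(t 0) + c) = C c - k (t 0) := by rw [k, map_add, map_neg]; ring
  have h' : C c - k (t 0) + k α * z = (C c + C α * X) - k (t 0) := by ring
  rw [normalB, hε, hδ, hβ, scalarPart, h, h', sub_smul, C₁]
  abel

lemma add_smul_congr_sub {P : ZMat 2} {β β' δ δ' ε ε' : ℂ⟦X⟧} (hβ : β = β') (hδ : δ = δ')
    (hε : ε = -ε') : P + β • C₂ - δ • D + ε • E = P + β' • C₂ - δ' • D - ε' • E := by
  rw [hβ, hδ, hε, neg_smul, sub_eq_add_neg _ (ε' • E)]

lemma add_smul_congr_zero {P : ZMat 2} {β β' δ δ' ε : ℂ⟦X⟧} (hβ : β = β') (hδ : δ = δ')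
    (hε : ε = 0) : P + β • C₂ - δ • D + ε • E = P + β' • C₂ - δ' • D := by
  rw [hβ, hδ, hε, zero_smul, add_zero]

lemma NormalForm.congr {A₁ A₂ A₂' B B' : Base 2 → ZMat 2} (h : NormalForm A₁ A₂ B)
    (hA : ∀ t, A₂' t = A₂ t) (hB : ∀ t, B' t = B t) : NormalForm A₁ A₂' B' := by
  rwa [funext hA, funext hB]

lemma k_div_two (c : ℂ) : k (c / 2) = k (1 / 2) * k c := by
  rw [k, k, k, ← map_mul]; congr 1; ring

lemma k_half_mul_two : k (1 / 2) * 2 = 1 := by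
  rw [← map_ofNat C 2, ← map_mul]; simp

section

set_option linter.unusedSimpArgs false

variable {S : FormalTE 2 2} {ρ : ℝ} {f b : (Holo (disc ρ))⟦X⟧} {g : ℂ⟦X⟧}

theorem HasForm.exists_normalForm_i {c₀ : ℂ}
    (H : HasForm S ρ 1 (quadForm (Holo.var _) (C c₀) (C (-1 / 2)) 0) g) :
    ∃ N : FormalTE 2 2, IsNormalForm N ∧ LiesOverN2 N ∧ FormallyIsomorphic S N := by
  have e : ∀ U : Opens ℂ, (1 : (Holo U)⟦X⟧) = C ((1 : ℂ) • Holo.var U ^ 0) := fun U => by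
    rw [pow_zero, one_smul, map_one]
  have H' := H.scalar
  rw [e] at H'
  refine H'.exists_normalForm ?_ ((NormalForm.i (coeff 0 g) (coeff 1 g) c₀).congr (fun t => ?_)
    fun t => ?_)
  · rw [← e]; exact isCompatible_one_quadForm Holo.pd_var c₀
  · simp
  · have h1 : k (-(t 1) / 2 + c₀) = k c₀ + k (-1 / 2) * k (t 1) := by
      rw [← map_mul, ← map_add]; congr 1; ring
    have h2 : k (1 / 4) = k (1 / 2) * (k (-1 / 2) + 1) := by
      rw [← map_one C, ← map_add, ← map_mul]; congr 1; norm_num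
    rw [normalB_eq (β := k (-(t 1) / 2 + c₀)) (δ := z * k (1 / 4))
      (ε := z * k (-(t 1) / 2 + c₀))]
    · rw [h1]; ring
    · rw [h2]; ring
    · rw [h1]; simp

theorem HasForm.exists_normalForm_ii {r : ℕ} (hr : 1 ≤ r)
    (H : HasForm S ρ (C (Holo.var _ ^ r)) (quadForm (Holo.var _) 0 (C (-(1 / (r + 2)))) 0) g) :
    ∃ N : FormalTE 2 2, IsNormalForm N ∧ LiesOverN2 N ∧ FormallyIsomorphic S N := by
  have hr2 : ((r : ℂ) + 2) ≠ 0 := by exact_mod_cast (by omega : r + 2 ≠ 0)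
  have e : ∀ U : Opens ℂ, (C (Holo.var U ^ r) : (Holo U)⟦X⟧) = C ((1 : ℂ) • Holo.var U ^ r) :=
    fun U => by rw [one_smul]
  have H' := H.scalar
  rw [e] at H'
  refine H'.exists_normalForm ?_ ((NormalForm.ii (coeff 0 g) (coeff 1 g) r hr).congr (fun t => ?_)
    fun t => ?_)
  · rw [← e]; exact isCompatible_pow_quadForm Holo.pd_var r
  · simp
  · have h1 : k (t 1 / (r + 2)) = -(k (-(1 / (r + 2))) * k (t 1)) := by
      rw [← map_mul, ← map_neg]; congr 1; ring
    have h2 : k ((r + 1) / (2 * (r + 2))) = k (1 / 2) * (k (-(1 / (r + 2))) + 1) := by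
      rw [← map_one C, ← map_add, ← map_mul]; congr 1; field_simp; ring
    have h3 : k (t 1 ^ (r + 1) / (r + 2)) = -(k (t 1 ^ r) * (k (-(1 / (r + 2))) * k (t 1))) := by
      rw [← map_mul, ← map_mul, ← map_neg]; congr 1; field_simp; ring
    rw [normalB_eq (β := -k (t 1 / (r + 2))) (δ := z * k ((r + 1) / (2 * (r + 2))))
      (ε := -(z * k (t 1 ^ (r + 1) / (r + 2))))]
    · rw [neg_smul, neg_smul, ← sub_eq_add_neg, ← sub_eq_add_neg]
    · rw [h1]; ring
    · rw [h2]; ring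
    · rw [h3, one_mul]; ring

lemma HasForm.exists_normalForm_iii {b₀ b₁ b₂ : ℂ⟦X⟧} {B : Base 2 → ZMat 2}
    (H : HasForm S ρ 0 (quadForm (Holo.var _) b₀ b₁ b₂) g)
    (hN : NormalForm (fun _ => C₁) (fun _ => C₂) B)
    (hB : ∀ t, scalarPart (coeff 0 g) (coeff 1 g) t + (b₀ + b₁ * k (t 1) + b₂ * k (t 1) ^ 2) • C₂
      - (z * k (1 / 2) * (b₁ + 2 * b₂ * k (t 1) + 1)) • D + (-(z ^ 2 * b₂)) • E = B t) :
    ∃ N : FormalTE 2 2, IsNormalForm N ∧ LiesOverN2 N ∧ FormallyIsomorphic S N := by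
  -- Zero is written as 0·t⁰ to fit the shape a·tʳ required for recognition.
  have e : ∀ U : Opens ℂ, (0 : (Holo U)⟦X⟧) = C ((0 : ℂ) • Holo.var U ^ 0) := fun U => by simp
  have H' := H.scalar
  rw [e] at H'
  refine H'.exists_normalForm ?_ (hN.congr (fun t => ?_) fun t => ?_)
  · rw [← e]; exact isCompatible_zero_quadForm Holo.pd_var _ _ _
  · simp
  · rw [normalB_eq rfl rfl rfl, ← hB]
    congr 2
    rw [zero_mul, k, map_zero]
    ring

/-- The only possible resonant degree is -1 - λ, which is a natural number only if λ is a negative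
integer. For θ the same is applied to -λ. -/
lemma eq_zero_of_resonance {lam : ℂ} {e : ℂ⟦X⟧}
    (h : ∀ n : ℕ, (n : ℂ) + (1 + lam) ≠ 0 → coeff n e = 0) (hl : ∀ n : ℕ, 1 ≤ n → lam ≠ -n) :
    e = 0 := by
  ext n
  refine h n fun h0 => hl (n + 1) (by omega) ?_
  push_cast
  linear_combination h0

/-- For λ = -N the single resonant degree of e is N - 1; the factor X moves it to N. -/
lemma X_mul_eq_of_resonance {lam : ℂ} {e : ℂ⟦X⟧}
    (h : ∀ n : ℕ, (n : ℂ) + (1 + lam) ≠ 0 → coeff n e = 0) {N : ℕ} (hN : 1 ≤ N)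
    (hl : lam = -N) : X * e = C (coeff (N - 1) e) * X ^ N := by
  obtain ⟨M, rfl⟩ : ∃ M, N = M + 1 := ⟨N - 1, by omega⟩
  ext n
  rw [coeff_C_mul, coeff_X_pow, Nat.add_sub_cancel]
  rcases n with _ | n
  · simp
  · rw [coeff_succ_X_mul]
    by_cases hn : n = M
    · simp [hn]
    · rw [if_neg (by omega), mul_zero]
      refine h n fun h0 => hn ?_
      rw [hl] at h0
      push_cast at h0
      have : (n : ℂ) = M := by linear_combination h0
      exact_mod_cast this

/-- Scaling of the coordinate. -/
lemma HasForm.scale {b₀ b₁ b₂ : ℂ⟦X⟧} (H : HasForm S ρ 0 (quadForm (Holo.var _) b₀ b₁ b₂) g)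
    {a : ℂ} (ha : a ≠ 0) :
    ∃ ρ', HasForm S ρ' 0 (quadForm (Holo.var _) (C a * b₀) b₁ (C a⁻¹ * b₂)) g := by
  have h0 := zero_mem_disc H.1
  obtain ⟨w, hw⟩ := IsAlgClosed.exists_pow_nat_eq a two_pos
  obtain ⟨ρ', φ, hφ, hκ⟩ := CoordChange.exists_inverse H.1 (g := a • Holo.var (disc ρ))
    (w := algebraMap ℂ _ w) (by
      rw [Derivation.map_smul, Holo.pd_var, ← map_pow, hw, Algebra.algebraMap_eq_smul_one]) (by
      rw [Holo.fn_algebraMap _ h0]; rintro rfl; apply ha; rw [← hw]; simp) (by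
      rw [Holo.fn_smul, Holo.fn_var h0, mul_zero])
  have hv : φ.σ (Holo.var _) = a⁻¹ • Holo.var _ := by
    rw [← hφ, map_smul, smul_smul, inv_mul_cancel₀ ha, one_smul]
  rw [AlgHom.commutes] at hκ
  have hμ : φ.μ (C (Holo.var _)) = C (algebraMap ℂ _ a⁻¹) * C (Holo.var _) := by
    rw [CoordChange.μ, PowerSeries.map_C, RingHom.coe_coe, hv, ← map_mul, Algebra.smul_def]
  have hC : C (algebraMap ℂ (Holo (disc ρ')) a) * C (algebraMap ℂ (Holo (disc ρ')) a⁻¹) = 1 := by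
    rw [← map_mul, ← map_mul, mul_inv_cancel₀ ha, map_one, map_one]
  refine ⟨ρ', ?_⟩
  have H' := H.pullback φ
  have e : C (φ.κ ^ 2) * φ.μ (quadForm (Holo.var (disc ρ)) b₀ b₁ b₂)
      = quadForm (Holo.var (disc ρ')) (C a * b₀) b₁ (C a⁻¹ * b₂) := by
    rw [hκ, ← map_pow, hw, quadForm, quadForm, map_add, map_add, map_mul, map_mul, map_pow, hμ,
      CoordChange.μ_cst, CoordChange.μ_cst, CoordChange.μ_cst, map_mul, map_mul, cst_C, cst_C]
    linear_combination (cst _ b₁ * C (Holo.var _)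
      + cst _ b₂ * C (Holo.var _) ^ 2 * C (algebraMap ℂ _ a⁻¹)) * hC
  rw [e, hκ, Derivation.map_algebraMap, map_zero, map_zero] at H'
  simpa using H'

/-- The case of a leading term `ε + λ t`. -/
theorem HasForm.exists_normalForm_of_linear {b₀ b₁ b₂ : ℂ⟦X⟧} {ε lam : ℂ}
    (H : HasForm S ρ 0 (quadForm (Holo.var _) b₀ b₁ b₂) g) (h₀ : coeff 0 b₀ = ε)
    (h₁ : coeff 0 b₁ = lam) (h₂ : coeff 0 b₂ = 0)
    (hε : ε = 0 ∨ ε = 1 ∧ ∀ n : ℕ, 1 ≤ n → lam ≠ -n) :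
    ∃ N : FormalTE 2 2, IsNormalForm N ∧ LiesOverN2 N ∧ FormallyIsomorphic S N := by
  obtain ⟨e, θ, T, hT, he, hθ, gA, gB⟩ :=
    (discCalculus H.1).exists_gauge_linear (cst _ g) ε lam h₀ h₁ h₂
  have H' : HasForm S ρ 0 (quadForm (Holo.var _) (C ε + X * e) (C lam) (X * θ)) g :=
    H.gauge hT (isCompatible_zero_quadForm Holo.pd_var _ _ _) gA gB
  have hθ' : ∀ n : ℕ, (n : ℂ) + (1 + -lam) ≠ 0 → coeff n θ = 0 := hθ
  have h2 := k_half_mul_two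
  -- For a positive integer λ only θ can survive (forms iii.5 to iii.7), for a negative one only e
  -- (iii.8, iii.9), and otherwise neither (iii.3, iii.4).
  by_cases hpos : ∃ n : ℕ, 1 ≤ n ∧ lam = n
  · obtain ⟨n, hn, rfl⟩ := hpos
    have he0 : e = 0 := eq_zero_of_resonance he fun m hm h => by
      have : ((n + m : ℕ) : ℂ) = 0 := by push_cast; rw [h]; ring
      have := Nat.cast_eq_zero.1 this
      omega
    rw [he0, mul_zero, add_zero, X_mul_eq_of_resonance hθ' hn rfl] at H'
    set γ := coeff (n - 1) θ
    rcases hε with rfl | ⟨rfl, -⟩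
    · by_cases hγ : γ = 0
      · refine H'.exists_normalForm_iii (NormalForm.iii7 (coeff 0 g) (coeff 1 g) n hn) fun t => ?_
        rw [hγ]
        refine add_smul_congr_zero ?_ ?_ ?_
        · simp only [k, map_mul, map_add, map_neg, map_zero, map_one, map_ofNat, map_pow]; ring
        · rw [k_div_two (n + 1)]; simp only [k, map_mul, map_add, map_neg, map_zero, map_one, map_ofNat, map_pow]; ring
        · simp only [k, map_mul, map_add, map_neg, map_zero, map_one, map_ofNat, map_pow]; ring
      -- Scaling by γ divides the quadratic coefficient γzⁿ by γ. This is possible only because ε =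
      -- 0, as otherwise ε would be scaled too.
      · obtain ⟨ρ', H''⟩ := H'.scale hγ
        have e1 : C γ⁻¹ * (C γ * X ^ n) = (X : ℂ⟦X⟧) ^ n := by
          rw [← mul_assoc, ← map_mul, inv_mul_cancel₀ hγ, map_one, one_mul]
        rw [e1] at H''
        refine H''.exists_normalForm_iii (NormalForm.iii6 (coeff 0 g) (coeff 1 g) n hn) fun t => ?_
        refine add_smul_congr_sub ?_ ?_ ?_
        · simp only [k, map_mul, map_add, map_neg, map_zero, map_one, map_ofNat, map_pow]; ring
        · simp only [k, map_mul, map_add, map_neg, map_zero, map_one, map_ofNat, map_pow]; ring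
        · ring
    · refine H'.exists_normalForm_iii (NormalForm.iii5 (coeff 0 g) (coeff 1 g) γ n hn) fun t => ?_
      refine add_smul_congr_sub ?_ ?_ ?_
      · simp only [k, map_mul, map_add, map_neg, map_zero, map_one, map_ofNat, map_pow]; ring
      · simp only [k, map_mul, map_add, map_neg, map_zero, map_one, map_ofNat, map_pow]; ring
      · simp only [k, map_mul, map_add, map_neg, map_zero, map_one, map_ofNat, map_pow]; ring
  by_cases hneg : ∃ n : ℕ, 1 ≤ n ∧ lam = -n
  · obtain ⟨n, hn, rfl⟩ := hneg
    obtain rfl : ε = 0 := hε.resolve_right fun h => h.2 n hn rfl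
    have hθ0 : θ = 0 := eq_zero_of_resonance hθ' fun m hm h => hpos ⟨n, hn, by
      have : ((n + m : ℕ) : ℂ) = 0 := by push_cast; linear_combination h
      have := Nat.cast_eq_zero.1 this
      omega⟩
    rw [hθ0, mul_zero, map_zero, zero_add, X_mul_eq_of_resonance he hn rfl] at H'
    set γ := coeff (n - 1) e
    by_cases hγ : γ = 0
    · refine H'.exists_normalForm_iii (NormalForm.iii9 (coeff 0 g) (coeff 1 g) n hn) fun t => ?_
      rw [hγ]
      refine add_smul_congr_zero ?_ ?_ ?_
      · simp only [k, map_mul, map_add, map_neg, map_zero, map_one, map_ofNat, map_pow]; ring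
      · rw [k_div_two (-n + 1)]; simp only [k, map_mul, map_add, map_neg, map_zero, map_one, map_ofNat, map_pow]; ring
      · ring
    -- Scaling by γ⁻¹ makes the constant coefficient γzⁿ equal to zⁿ and leaves λ unchanged.
    · obtain ⟨ρ', H''⟩ := H'.scale (inv_ne_zero hγ)
      have e1 : C γ⁻¹ * (C γ * X ^ n) = (X : ℂ⟦X⟧) ^ n := by
        rw [← mul_assoc, ← map_mul, inv_mul_cancel₀ hγ, map_one, one_mul]
      rw [e1] at H''
      refine H''.exists_normalForm_iii (NormalForm.iii8 (coeff 0 g) (coeff 1 g) n hn) fun t => ?_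
      refine add_smul_congr_zero ?_ ?_ ?_
      · simp only [k, map_mul, map_add, map_neg, map_zero, map_one, map_ofNat, map_pow]; ring
      · rw [k_div_two (-n + 1)]; simp only [k, map_mul, map_add, map_neg, map_zero, map_one, map_ofNat, map_pow]; ring
      · ring
  have hlam : ∀ n : ℤ, n ≠ 0 → lam ≠ n := by
    intro n hn h
    rcases Int.lt_or_gt_of_ne hn with h' | h'
    · refine hneg ⟨n.natAbs, by omega, ?_⟩
      rw [h, ← Int.cast_natCast, ← Int.cast_neg]
      congr 1
      omega
    · refine hpos ⟨n.natAbs, by omega, ?_⟩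
      rw [h, ← Int.cast_natCast]
      congr 1
      omega
  have he0 : e = 0 := eq_zero_of_resonance he fun m hm h => hneg ⟨m, hm, h⟩
  have hθ0 : θ = 0 := eq_zero_of_resonance hθ' fun m hm h => hpos ⟨m, hm, neg_injective h⟩
  rw [he0, hθ0, mul_zero, add_zero] at H'
  rcases hε with rfl | ⟨rfl, -⟩
  · refine H'.exists_normalForm_iii (NormalForm.iii3 (coeff 0 g) (coeff 1 g) lam hlam) fun t => ?_
    refine add_smul_congr_zero ?_ ?_ ?_
    · simp only [k, map_mul, map_add, map_neg, map_zero, map_one, map_ofNat, map_pow]; ring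
    · rw [k_div_two (lam + 1)]; simp only [k, map_mul, map_add, map_neg, map_zero, map_one, map_ofNat, map_pow]; ring
    · ring
  · refine H'.exists_normalForm_iii (NormalForm.iii4 (coeff 0 g) (coeff 1 g) lam hlam) fun t => ?_
    refine add_smul_congr_zero ?_ ?_ ?_
    · simp only [k, map_mul, map_add, map_neg, map_zero, map_one, map_ofNat, map_pow]; ring
    · rw [k_div_two (lam + 1)]; simp only [k, map_mul, map_add, map_neg, map_zero, map_one, map_ofNat, map_pow]; ring
    · ring

/-- The case of a leading term `t²`. -/
theorem HasForm.exists_normalForm_of_square {b₀ b₁ b₂ : ℂ⟦X⟧}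
    (H : HasForm S ρ 0 (quadForm (Holo.var _) b₀ b₁ b₂) g) (h₀ : coeff 0 b₀ = 0)
    (h₁ : coeff 0 b₁ = 0) (h₂ : coeff 0 b₂ = 1) :
    ∃ N : FormalTE 2 2, IsNormalForm N ∧ LiesOverN2 N ∧ FormallyIsomorphic S N := by
  obtain ⟨T, hT, gA, gB⟩ := (discCalculus H.1).exists_gauge_square (cst _ g) h₀ h₁ h₂
  have H' : HasForm S ρ 0 (quadForm (Holo.var _) 0 0 1) g :=
    H.gauge hT (isCompatible_zero_quadForm Holo.pd_var _ _ _) gA gB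
  refine H'.exists_normalForm_iii (NormalForm.iii2 (coeff 0 g) (coeff 1 g)) fun t => ?_
  have e : k (1 / 2) * (0 + 2 * 1 * k (t 1) + 1) = k (t 1) + k (1 / 2) := by
    linear_combination k (t 1) * k_half_mul_two
  rw [mul_assoc, e]
  refine add_smul_congr_sub ?_ ?_ ?_
  · simp only [k, map_mul, map_add, map_neg, map_zero, map_one, map_ofNat, map_pow]; ring
  · simp only [k, map_add]
  · ring

/-- Every structure given by `f`, `b` and a scalar part has a normal form. -/
theorem HasForm.exists_normalForm_any (H : HasForm S ρ f b g) :
    ∃ N : FormalTE 2 2, IsNormalForm N ∧ LiesOverN2 N ∧ FormallyIsomorphic S N := by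
  by_cases hf : coeff 0 f = 0
  swap
  · obtain ⟨ρ', r, f', b', H', hf'⟩ := H.exists_coeff_zero_eq_pow hf
    rcases Nat.eq_zero_or_pos r with rfl | hr
    · obtain ⟨c₀, g', H''⟩ := H'.of_coeff_zero_eq_one (by rw [hf', pow_zero])
      exact H''.exists_normalForm_i
    · exact (H'.of_coeff_zero_eq_pow hr hf').exists_normalForm_ii hr
  set β := (coeff 0 b).fn 0 with hβ
  set β' := (Holo.pd 1 (coeff 0 b)).fn 0 with hβ'
  set B₂ := (Holo.pd 1 (Holo.pd 1 (coeff 0 b))).fn 0 - 2 * (coeff 1 f).fn 0 * β with hB₂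
  -- The parameters ν and x are the Möbius freedom fixing 0, entering through the initial values
  -- φ(0) = ν and φ'(0) = xν.
  have key : ∀ ν : ℂ, ν ≠ 0 → ∀ x : ℂ, ∃ (ρ' : ℝ) (b₀ b₁ b₂ g' : ℂ⟦X⟧),
      HasForm S ρ' 0 (quadForm (Holo.var _) b₀ b₁ b₂) g' ∧ coeff 0 b₀ = β / ν ^ 2 ∧
      coeff 0 b₁ = β' - 2 * x * β ∧
      2 * coeff 0 b₂ = ν ^ 2 * (B₂ + 2 * x ^ 2 * β - 2 * x * β') := fun ν hν x =>
    H.exists_quadForm hf hν x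
  have two : (2 : ℂ) ≠ 0 := two_ne_zero
  by_cases h0 : β = 0
  · by_cases h1 : β' = 0
    · by_cases h2 : B₂ = 0
      · obtain ⟨ρ', b₀, b₁, b₂, g', H', e₀, e₁, e₂⟩ := key 1 one_ne_zero 0
        rw [h0] at e₀ e₁ e₂
        rw [h1] at e₁ e₂
        rw [h2] at e₂
        -- The zero field counts as λt with λ = 0, and iii.3 with λ = 0 coincides with iii.1.
        exact H'.exists_normalForm_of_linear (ε := 0) (lam := 0) (by simpa using e₀)
          (by simpa using e₁) (by simpa using e₂) (Or.inl rfl)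
      -- A double zero at 0: ν² = 2/B₂ normalises the coefficient of t² to 1.
      · obtain ⟨ν, hν⟩ := IsAlgClosed.exists_pow_nat_eq (2 / B₂) two_pos
        have hν0 : ν ≠ 0 := by
          rintro rfl
          rw [zero_pow two_pos.ne'] at hν
          exact div_ne_zero two h2 hν.symm
        obtain ⟨ρ', b₀, b₁, b₂, g', H', e₀, e₁, e₂⟩ := key ν hν0 0
        rw [h0] at e₀ e₁ e₂
        rw [h1] at e₁ e₂
        rw [hν] at e₂
        refine H'.exists_normalForm_of_square (by simpa using e₀) (by simpa using e₁) ?_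
        refine mul_left_cancel₀ two ?_
        rw [e₂]
        field_simp
        ring
    -- A simple zero at 0: this x solves B₂ - 2xβ' = 0 and so removes the t² term, while λ = β' is
    -- unaffected.
    · obtain ⟨ρ', b₀, b₁, b₂, g', H', e₀, e₁, e₂⟩ := key 1 one_ne_zero (B₂ / (2 * β'))
      rw [h0] at e₀ e₁ e₂
      refine H'.exists_normalForm_of_linear (ε := 0) (lam := β') (by simpa using e₀)
        (by simpa using e₁) ?_ (Or.inl rfl)
      refine mul_left_cancel₀ two ?_
      rw [e₂]
      field_simp
      ring
  · obtain ⟨ν, hν⟩ := IsAlgClosed.exists_pow_nat_eq β two_pos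
    have hν0 : ν ≠ 0 := by
      rintro rfl
      exact h0 (by rw [← hν]; simp)
    -- For β ≠ 0 the t² term disappears when 2βx² - 2β'x + B₂ = 0, and λ = β' - 2xβ is then a square
    -- root δ of the discriminant β'² - 2βB₂. The choice between the two roots allows the negative
    -- integers to be avoided.
    obtain ⟨δ, hδ, hδn⟩ : ∃ δ : ℂ, δ ^ 2 = β' ^ 2 - 2 * β * B₂ ∧ ∀ n : ℕ, 1 ≤ n → δ ≠ -n := by
      obtain ⟨δ, hδ⟩ := IsAlgClosed.exists_pow_nat_eq (β' ^ 2 - 2 * β * B₂) two_pos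
      by_cases h : ∃ n : ℕ, 1 ≤ n ∧ δ = -n
      · obtain ⟨n, hn, rfl⟩ := h
        refine ⟨n, by rw [← hδ]; ring, fun m hm h => ?_⟩
        have : ((n + m : ℕ) : ℂ) = 0 := by push_cast; rw [h]; ring
        have := Nat.cast_eq_zero.1 this
        omega
      · exact ⟨δ, hδ, fun n hn h' => h ⟨n, hn, h'⟩⟩
    obtain ⟨ρ', b₀, b₁, b₂, g', H', e₀, e₁, e₂⟩ := key ν hν0 ((β' - δ) / (2 * β))
    refine H'.exists_normalForm_of_linear (ε := 1) (lam := δ) ?_ ?_ ?_ (Or.inr ⟨rfl, hδn⟩)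
    · rw [e₀, hν, div_self h0]
    · rw [e₁]; field_simp; ring
    · refine mul_left_cancel₀ two ?_
      have : B₂ + 2 * ((β' - δ) / (2 * β)) ^ 2 * β - 2 * ((β' - δ) / (2 * β)) * β' = 0 := by
        field_simp
        linear_combination hδ
      rw [e₂, this]
      ring

end

end TEStructure

end

noncomputable section

namespace TEStructure

open TopologicalSpace (Opens)

/-! ### Local primitives in the first of two complex variables -/

section AnalyticIntegral

variable {V : Type*} [NormedAddCommGroup V] [NormedSpace ℂ V]

/-- Averages of an analytic function over a family of contractions are analytic. -/
theorem analyticAt_integral_comp {f : V → ℂ} {y : V} (hf : AnalyticAt ℂ f y)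
    {L : ℝ → V →L[ℂ] V} (hL : Continuous L) (hL1 : ∀ s ∈ Set.uIoc (0 : ℝ) 1, ‖L s‖ ≤ 1) :
    AnalyticAt ℂ (fun x => ∫ s in (0 : ℝ)..1, f (y + L s (x - y))) y := by
  obtain ⟨p, r, hp⟩ := hf
  -- The power series of f is integrated term by term; as ‖L s‖ ≤ 1, the averaged terms obey the
  -- bounds of the original ones and the radius does not decrease.
  let Q : ∀ n, ℝ → ContinuousMultilinearMap ℂ (fun _ : Fin n => V) ℂ := fun n s =>
    (p n).compContinuousLinearMap fun _ => L s
  have hQ : ∀ n, Continuous (Q n) := fun n => by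
    have h := (ContinuousMultilinearMap.compContinuousLinearMapLRight (E := fun _ => V) (p n)).cont
    exact h.comp (continuous_pi fun _ => hL)
  have hQn : ∀ n, ∀ s ∈ Set.uIoc (0 : ℝ) 1, ‖Q n s‖ ≤ ‖p n‖ := fun n s hs => by
    refine (ContinuousMultilinearMap.norm_compContinuousLinearMap_le _ _).trans ?_
    rw [Finset.prod_const]
    exact mul_le_of_le_one_right (norm_nonneg _) (pow_le_one₀ (norm_nonneg _) (hL1 s hs))
  let q : FormalMultilinearSeries ℂ V ℂ := fun n => ∫ s in (0 : ℝ)..1, Q n s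
  have hq : ∀ n (v : Fin n → V), q n v = ∫ s in (0 : ℝ)..1, p n fun i => L s (v i) := fun n v =>
    ((ContinuousMultilinearMap.apply ℂ (fun _ : Fin n => V) ℂ v).intervalIntegral_comp_comm
      ((hQ n).intervalIntegrable 0 1)).symm
  refine ⟨q, r, ?_, hp.r_pos, ?_⟩
  · refine hp.r_le.trans (FormalMultilinearSeries.radius_le_of_le fun n => ?_)
    have := intervalIntegral.norm_integral_le_of_norm_le_const (hQn n)
    simpa using this
  · intro w hw
    have hwr : ((‖w‖₊ : NNReal) : ENNReal) < p.radius := by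
      refine lt_of_lt_of_le ?_ hp.r_le
      simpa [enorm] using hw
    have hs := p.summable_norm_mul_pow hwr
    simp only [hq, add_sub_cancel_left]
    refine intervalIntegral.hasSum_integral_of_dominated_convergence
      (fun n _ => ‖p n‖ * (‖w‖₊ : ℝ) ^ n) (fun n => ?_) (fun n => ?_) ?_ ?_ ?_
    · refine Continuous.aestronglyMeasurable ?_
      exact (ContinuousMultilinearMap.apply ℂ (fun _ : Fin n => V) ℂ fun _ => w).continuous.comp
        (hQ n)
    · refine Eventually.of_forall fun s hs => ?_
      have h1 := (Q n s).le_opNorm fun _ => w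
      rw [Finset.prod_const, Finset.card_univ, Fintype.card_fin] at h1
      exact h1.trans (mul_le_mul_of_nonneg_right (hQn n s hs) (by positivity))
    · exact Eventually.of_forall fun _ _ => hs
    · exact intervalIntegrable_const
    · refine Eventually.of_forall fun s hs => hp.hasSum ?_
      have h1 : ‖L s w‖ ≤ ‖w‖ := by
        simpa using (L s).le_of_opNorm_le (hL1 s hs) w
      have h2 : (‖L s w‖₊ : ENNReal) ≤ ‖w‖₊ := by exact_mod_cast h1
      have h3 : (‖w‖₊ : ENNReal) < r := by simpa [enorm] using hw
      simpa [enorm] using h2.trans_lt h3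

end AnalyticIntegral

/-- The retraction `(x₁, x₂) ↦ (s x₁, x₂)`. -/
def shrink (s : ℝ) : Base 2 →L[ℂ] Base 2 :=
  ContinuousLinearMap.pi ![(s : ℂ) • ContinuousLinearMap.proj 0, ContinuousLinearMap.proj 1]

lemma shrink_apply (s : ℝ) (v : Base 2) : shrink s v = ![s * v 0, v 1] := by
  funext i
  fin_cases i <;> simp [shrink]

lemma norm_shrink_le {s : ℝ} (hs : s ∈ Set.uIoc (0 : ℝ) 1) : ‖shrink s‖ ≤ 1 := by
  rw [Set.uIoc_of_le zero_le_one] at hs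
  refine ContinuousLinearMap.opNorm_le_bound _ zero_le_one fun v => ?_
  rw [one_mul, shrink_apply, pi_norm_le_iff_of_nonneg (norm_nonneg _)]
  intro i
  fin_cases i
  · simp only [Fin.zero_eta, Matrix.cons_val_zero, norm_mul, Complex.norm_real]
    rw [Real.norm_of_nonneg hs.1.le]
    exact (mul_le_of_le_one_left (norm_nonneg _) hs.2).trans (norm_le_pi_norm v 0)
  · exact norm_le_pi_norm v 1

lemma continuous_shrink : Continuous shrink := by
  have : shrink = fun s : ℝ => (s : ℂ) • ContinuousLinearMap.pi (R := ℂ)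
      ![ContinuousLinearMap.proj (R := ℂ) (φ := fun _ : Fin 2 => ℂ) 0, 0]
      + ContinuousLinearMap.pi ![0, ContinuousLinearMap.proj (R := ℂ) (φ := fun _ : Fin 2 => ℂ) 1] := by
    funext s
    ext v i
    fin_cases i <;> simp [shrink]
  rw [this]
  fun_prop

/-- The open bidisc around the origin. -/
def bidisc (ρ : ℝ) : Opens (Base 2) := ⟨Metric.ball 0 ρ, Metric.isOpen_ball⟩

lemma mem_bidisc {ρ : ℝ} {t : Base 2} : t ∈ bidisc ρ ↔ ‖t 0‖ < ρ ∧ ‖t 1‖ < ρ := by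
  change t ∈ Metric.ball 0 ρ ↔ _
  rw [mem_ball_zero_iff]
  constructor
  · exact fun h => ⟨(norm_le_pi_norm t 0).trans_lt h, (norm_le_pi_norm t 1).trans_lt h⟩
  · rintro ⟨h0, h1⟩
    rw [pi_norm_lt_iff ((norm_nonneg _).trans_lt h0)]
    intro i
    fin_cases i
    · exact h0
    · exact h1

lemma vec_eq (t : Base 2) : (![t 0, t 1] : Base 2) = t := by
  funext i; fin_cases i <;> rfl

lemma hasDerivAt_vec (x c : ℂ) :
    HasDerivAt (fun s : ℂ => (![s, c] : Base 2)) (Pi.single 0 1) x := by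
  rw [hasDerivAt_pi]
  intro i
  fin_cases i
  · exact hasDerivAt_id x
  · exact hasDerivAt_const x c

lemma hasDerivAt_slice {G : Base 2 → ℂ} {x c : ℂ} (hG : DifferentiableAt ℂ G ![x, c]) :
    HasDerivAt (fun s : ℂ => G ![s, c]) (fderiv ℂ G ![x, c] (Pi.single 0 1)) x :=
  hG.hasFDerivAt.comp_hasDerivAt (f := fun s : ℂ => (![s, c] : Base 2)) x (hasDerivAt_vec x c)

lemma analyticAt_vec_left (c x : ℂ) : AnalyticAt ℂ (fun s : ℂ => (![s, c] : Base 2)) x := by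
  rw [analyticAt_pi_iff]
  intro i
  fin_cases i
  · exact analyticAt_id
  · exact analyticAt_const

lemma analyticAt_vec_right (c x : ℂ) : AnalyticAt ℂ (fun s : ℂ => (![c, s] : Base 2)) x := by
  rw [analyticAt_pi_iff]
  intro i
  fin_cases i
  · exact analyticAt_const
  · exact analyticAt_id

/-- Local primitives with respect to the first variable. -/
theorem exists_local_primitive {f : Base 2 → ℂ} {y : Base 2} (hf : AnalyticAt ℂ f y) :
    ∃ G : Base 2 → ℂ, ∃ ε > 0, (∀ t ∈ Metric.ball y ε, AnalyticAt ℂ G t) ∧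
      ∀ t ∈ Metric.ball y ε, fderiv ℂ G t (Pi.single 0 1) = f t := by
  -- The integral of f along the horizontal segment from first coordinate y₁ to t₁, with the second
  -- coordinate of t kept fixed; written as an average, it is jointly analytic at y.
  let G : Base 2 → ℂ := fun t => (t 0 - y 0) * ∫ s in (0 : ℝ)..1, f (y + shrink s (t - y))
  have hG : AnalyticAt ℂ G y :=
    ((analyticOnNhd_apply 0 Set.univ y trivial).sub analyticAt_const).mul
      (analyticAt_integral_comp hf continuous_shrink fun s hs => norm_shrink_le hs)
  obtain ⟨ε, hε, h⟩ := Metric.eventually_nhds_iff_ball.1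
    (hf.eventually_analyticAt.and hG.eventually_analyticAt)
  refine ⟨G, ε, hε, fun t ht => (h t ht).2, fun t ht => ?_⟩
  have ht' : ‖t 0 - y 0‖ < ε ∧ ‖t 1 - y 1‖ < ε := by
    have h1 := mem_bidisc (ρ := ε) (t := t - y)
    have h2 : t - y ∈ bidisc ε := by
      change t - y ∈ Metric.ball 0 ε
      rwa [mem_ball_zero_iff, ← dist_eq_norm]
    exact h1.1 h2
  have hmem : ∀ x : ℂ, ‖x - y 0‖ < ε → (![x, t 1] : Base 2) ∈ Metric.ball y ε := fun x hx => by
    have h2 : (![x, t 1] : Base 2) - y ∈ bidisc ε := mem_bidisc.2 ⟨hx, ht'.2⟩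
    change _ ∈ Metric.ball 0 ε at h2
    rwa [mem_ball_zero_iff, ← dist_eq_norm] at h2
  have hd : DifferentiableOn ℂ (fun x => f ![x, t 1]) (Metric.ball (y 0) ε) := fun x hx =>
    (AnalyticAt.comp (f := fun s : ℂ => (![s, t 1] : Base 2))
      (h _ (hmem x (by rwa [← dist_eq_norm]))).1 (analyticAt_vec_left (t 1) x)).differentiableAt.differentiableWithinAt
  obtain ⟨P, -, hP⟩ := hd.isExactOn_ball.with_val_at (y 0) 0
  -- On each horizontal line G is compared with a one-variable primitive P, which identifies its
  -- derivative.
  have key : ∀ x ∈ Metric.ball (y 0) ε, G ![x, t 1] = P x - P (y 0) := by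
    intro x hx
    have hx' : ‖x - y 0‖ < ε := by rwa [← dist_eq_norm]
    have hb : ∀ s ∈ Set.uIcc (0 : ℝ) 1, y 0 + s * (x - y 0) ∈ Metric.ball (y 0) ε := by
      intro s hs
      rw [Set.uIcc_of_le zero_le_one] at hs
      rw [Metric.mem_ball, dist_eq_norm, add_sub_cancel_left, norm_mul, Complex.norm_real,
        Real.norm_of_nonneg hs.1]
      exact (mul_le_of_le_one_left (norm_nonneg _) hs.2).trans_lt hx'
    have h1 : ∀ s ∈ Set.uIcc (0 : ℝ) 1, HasDerivAt (fun s : ℝ => P (y 0 + s * (x - y 0)))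
        ((x - y 0) * f ![y 0 + s * (x - y 0), t 1]) s := by
      intro s hs
      have e1 : HasDerivAt (fun s : ℝ => y 0 + (s : ℂ) * (x - y 0)) (x - y 0) s := by
        simpa using ((Complex.ofRealCLM.hasDerivAt (x := s)).mul_const (x - y 0)).const_add (y 0)
      have := (hP _ (hb s hs)).comp s e1
      rwa [mul_comm] at this
    have h2 : ContinuousOn (fun s : ℝ => (x - y 0) * f ![y 0 + s * (x - y 0), t 1])
        (Set.uIcc (0 : ℝ) 1) := by
      refine continuousOn_const.mul ?_
      refine hd.continuousOn.comp (f := fun s : ℝ => y 0 + (s : ℂ) * (x - y 0)) ?_ hb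
      fun_prop
    have h3 := intervalIntegral.integral_eq_sub_of_hasDerivAt h1 h2.intervalIntegrable
    rw [intervalIntegral.integral_const_mul] at h3
    simp only [G]
    have e : ∀ s : ℝ, y + shrink s (![x, t 1] - y) = ![y 0 + s * (x - y 0), t 1] := fun s => by
      rw [shrink_apply]; funext i; fin_cases i <;> simp
    simp only [e]
    rw [Matrix.cons_val_zero, h3]
    simp
  have ht0 : t 0 ∈ Metric.ball (y 0) ε := by
    rw [Metric.mem_ball, dist_eq_norm]; exact ht'.1
  have h4 := hasDerivAt_slice (G := G) (x := t 0) (c := t 1)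
    (by rw [vec_eq]; exact (h t ht).2.differentiableAt)
  have h5 : HasDerivAt (fun s : ℂ => G ![s, t 1]) (f ![t 0, t 1]) (t 0) := by
    refine ((hP (t 0) ht0).sub_const (P (y 0))).congr_of_eventuallyEq ?_
    filter_upwards [Metric.isOpen_ball.mem_nhds ht0] with x hx using key x hx
  have := h4.unique h5
  rwa [vec_eq] at this

end TEStructure

end

noncomputable section

namespace TEStructure

open TopologicalSpace (Opens)

/-! ### Global primitives on a bidisc -/

section Bidisc

variable {ρ : ℝ}

lemma zero_mem_bidisc (hρ : 0 < ρ) : (0 : Base 2) ∈ bidisc ρ := by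
  simp [mem_bidisc, hρ]

lemma vec_mem_bidisc {a b : ℂ} (ha : a ∈ disc ρ) (hb : b ∈ disc ρ) :
    (![a, b] : Base 2) ∈ bidisc ρ := mem_bidisc.2 ⟨mem_disc.1 ha, mem_disc.1 hb⟩

lemma fst_mem_disc {t : Base 2} (ht : t ∈ bidisc ρ) : t 0 ∈ disc ρ := mem_disc.2 (mem_bidisc.1 ht).1

lemma snd_mem_disc {t : Base 2} (ht : t ∈ bidisc ρ) : t 1 ∈ disc ρ := mem_disc.2 (mem_bidisc.1 ht).2

lemma analyticOnNhd_vec_left (c : ℂ) (s : Set ℂ) :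
    AnalyticOnNhd ℂ (fun s : ℂ => (![s, c] : Base 2)) s := fun x _ => analyticAt_vec_left c x

lemma analyticOnNhd_vec_right (c : ℂ) (s : Set ℂ) :
    AnalyticOnNhd ℂ (fun s : ℂ => (![c, s] : Base 2)) s := fun x _ => analyticAt_vec_right c x

/-- The restriction to a line on which the second coordinate is constant. -/
def slice {c : ℂ} (hc : c ∈ disc ρ) : Holo (bidisc ρ) →ₐ[ℂ] Holo (disc ρ) :=
  Holo.comp (fun s : ℂ => (![s, c] : Base 2)) (analyticOnNhd_vec_left c _)
    fun _ hx => vec_mem_bidisc hx hc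

lemma fn_slice {c : ℂ} (hc : c ∈ disc ρ) (f : Holo (bidisc ρ)) {x : ℂ} (hx : x ∈ disc ρ) :
    (slice hc f).fn x = f.fn ![x, c] := Holo.fn_comp _ _ f hx

lemma pd_slice {c : ℂ} (hc : c ∈ disc ρ) (f : Holo (bidisc ρ)) :
    Holo.pd 1 (slice hc f) = slice hc (Holo.pd (Pi.single 0 1) f) := by
  apply Holo.eq_of_fn
  intro x hx
  rw [fn_slice _ _ hx, Holo.fn_pd _ _ (vec_mem_bidisc hx hc), slice, Holo.fn_pd_comp _ _ _ _ hx,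
    (hasDerivAt_vec x c).hasFDerivAt.fderiv]
  simp

/-- The restriction to the line on which the first coordinate vanishes. -/
def atZero (hρ : 0 < ρ) : Holo (bidisc ρ) →ₐ[ℂ] Holo (disc ρ) :=
  Holo.comp (fun s : ℂ => (![0, s] : Base 2)) (analyticOnNhd_vec_right 0 _)
    fun _ hx => vec_mem_bidisc (zero_mem_disc hρ) hx

lemma fn_atZero (hρ : 0 < ρ) (f : Holo (bidisc ρ)) {x : ℂ} (hx : x ∈ disc ρ) :
    (atZero hρ f).fn x = f.fn ![0, x] := Holo.fn_comp _ _ f hx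

/-- A function of the second coordinate as a function on the bidisc. -/
def ofSnd (ρ : ℝ) : Holo (disc ρ) →ₐ[ℂ] Holo (bidisc ρ) :=
  Holo.comp (fun t : Base 2 => t 1) (analyticOnNhd_apply 1 _) fun _ h => snd_mem_disc h

lemma fn_ofSnd (f : Holo (disc ρ)) {t : Base 2} (ht : t ∈ bidisc ρ) :
    (ofSnd ρ f).fn t = f.fn (t 1) := Holo.fn_comp _ _ f ht

lemma pd_ofSnd (f : Holo (disc ρ)) (v : Base 2) :
    Holo.pd v (ofSnd ρ f) = v 1 • ofSnd ρ (Holo.pd 1 f) := by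
  apply Holo.eq_of_fn
  intro x hx
  rw [ofSnd, Holo.fn_pd_comp _ _ _ _ hx, fderiv_apply_base, Holo.fn_smul,
    Holo.fn_comp _ _ _ hx, Holo.fn_pd _ _ (snd_mem_disc hx), ← smul_eq_mul, ← map_smul,
    smul_eq_mul, mul_one]

lemma ofSnd_injective (hρ : 0 < ρ) : Function.Injective (ofSnd ρ) := by
  intro f g h
  apply Holo.eq_of_fn
  intro x hx
  have hm := vec_mem_bidisc (zero_mem_disc hρ) hx
  have := congrArg (fun F => Holo.fn F ![0, x]) h
  simp only [fn_ofSnd _ hm] at this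
  simpa using this

/-- Functions which do not depend on the first coordinate. -/
lemma eq_ofSnd_of_pd (hρ : 0 < ρ) {f : Holo (bidisc ρ)} (h : Holo.pd (Pi.single 0 1) f = 0) :
    f = ofSnd ρ (atZero hρ f) := by
  apply Holo.eq_of_fn
  intro t ht
  have h1 := snd_mem_disc ht
  have h0 := zero_mem_disc hρ
  rw [fn_ofSnd _ ht, fn_atZero _ _ h1, ← sub_eq_zero]
  have e : slice h1 f - algebraMap ℂ _ (f.fn ![0, t 1]) = 0 := by
    refine Holo.eq_zero_of_pd hρ ?_ ?_
    · rw [map_sub, pd_slice, h, map_zero, Derivation.map_algebraMap, sub_zero]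
    · rw [Holo.fn_sub, fn_slice _ _ h0, Holo.fn_algebraMap _ h0, sub_self]
  have := congrArg (fun F => Holo.fn F (t 0)) e
  simpa only [Holo.fn_sub, fn_slice _ _ (fst_mem_disc ht), Holo.fn_algebraMap _ (fst_mem_disc ht),
    Holo.fn_zero, vec_eq] using this

/-- Primitives with respect to the first variable. -/
theorem exists_primitive_bidisc (hρ : 0 < ρ) (f : Holo (bidisc ρ)) :
    ∃ g : Holo (bidisc ρ), Holo.pd (Pi.single 0 1) g = f := by
  classical
  have hP : ∀ c : ℂ, ∃ P : Holo (disc ρ), P.fn 0 = 0 ∧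
      ∀ hc : c ∈ disc ρ, Holo.pd 1 P = slice hc f := fun c => by
    by_cases hc : c ∈ disc ρ
    · obtain ⟨P, h1, h2⟩ := exists_primitive hρ (slice hc f) 0
      exact ⟨P, h2, fun _ => h1⟩
    · exact ⟨0, Holo.fn_zero _, fun h => absurd h hc⟩
  choose P hP0 hP1 using hP
  -- On each horizontal line F is the primitive vanishing at first coordinate 0. It has the right
  -- derivative in the first variable; joint analyticity is what has to be shown.
  let F : Base 2 → ℂ := fun t => (P (t 1)).fn (t 0)
  have hF : ∀ x ∈ disc ρ, ∀ c ∈ disc ρ, HasDerivAt (fun s => F ![s, c]) (f.fn ![x, c]) x := by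
    intro x hx c hc
    have h1 := ((P c).differentiableAt_fn hx).hasDerivAt
    rw [← Holo.fn_pd_one _ hx, hP1 c hc, fn_slice _ _ hx] at h1
    exact h1
  -- Near y the function F differs from an analytic local primitive G by a function of the second
  -- variable alone. Hence analyticity of F in that variable at a single nearby first coordinate a
  -- gives joint analyticity at every nearby point with second coordinate y₂.
  have key : ∀ y ∈ bidisc ρ, ∃ ε > 0, ∀ a, ‖a - y 0‖ < ε → AnalyticAt ℂ (fun s => F ![a, s]) (y 1) →
      ∀ b, ‖b - y 0‖ < ε → AnalyticAt ℂ F ![b, y 1] := by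
    intro y hy
    obtain ⟨G, ε₁, hε₁, hG, hG'⟩ := exists_local_primitive (f.analytic_fn y hy)
    obtain ⟨ε₂, hε₂, hb⟩ := Metric.isOpen_iff.1 (bidisc ρ).isOpen y hy
    have hε : 0 < min ε₁ ε₂ := lt_min hε₁ hε₂
    set ε := min ε₁ ε₂ with hεdef
    have mem : ∀ a c : ℂ, ‖a - y 0‖ < ε → ‖c - y 1‖ < ε → (![a, c] : Base 2) ∈ Metric.ball y ε := by
      intro a c ha hc
      have h2 : (![a, c] : Base 2) - y ∈ bidisc ε := mem_bidisc.2 ⟨ha, hc⟩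
      change _ ∈ Metric.ball 0 ε at h2
      rwa [mem_ball_zero_iff, ← dist_eq_norm] at h2
    have mem₁ : ∀ t ∈ Metric.ball y ε, t ∈ Metric.ball y ε₁ := fun t ht =>
      Metric.ball_subset_ball (min_le_left _ _) ht
    have mem₂ : ∀ t ∈ Metric.ball y ε, t ∈ bidisc ρ := fun t ht =>
      hb (Metric.ball_subset_ball (min_le_right _ _) ht)
    refine ⟨ε, hε, fun a ha hA b hb => ?_⟩
    have y1 : ‖y 1 - y 1‖ < ε := by simpa using hε
    have const : ∀ c, ‖c - y 1‖ < ε → ∀ x, ‖x - y 0‖ < ε →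
        F ![x, c] - G ![x, c] = F ![a, c] - G ![a, c] := by
      intro c hc x hx
      have hd : ∀ x ∈ Metric.ball (y 0) ε,
          HasDerivAt (fun s => F ![s, c] - G ![s, c]) 0 x := by
        intro x hx
        have hm := mem x c (by rwa [← dist_eq_norm]) hc
        have h1 := hF x (fst_mem_disc (mem₂ _ hm)) c (snd_mem_disc (mem₂ _ hm))
        have h2 := hasDerivAt_slice (hG _ (mem₁ _ hm)).differentiableAt
        rw [hG' _ (mem₁ _ hm)] at h2
        have h3 := h1.fun_sub h2
        rwa [sub_self] at h3
      refine Metric.isOpen_ball.is_const_of_deriv_eq_zero (convex_ball (y 0) ε).isPreconnected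
        (f := fun s => F ![s, c] - G ![s, c])
        (fun x hx => (hd x hx).differentiableAt.differentiableWithinAt)
        (fun x hx => (hd x hx).deriv) ?_ ?_
      · rwa [Metric.mem_ball, dist_eq_norm]
      · rwa [Metric.mem_ball, dist_eq_norm]
    have hc : AnalyticAt ℂ (fun s => F ![a, s] - G ![a, s]) (y 1) :=
      hA.sub (AnalyticAt.comp (f := fun s : ℂ => (![a, s] : Base 2))
        (hG _ (mem₁ _ (mem a _ ha y1))) (analyticAt_vec_right a (y 1)))
    have hm := mem b (y 1) hb y1
    have h3 : AnalyticAt ℂ (fun t : Base 2 => G t + (F ![a, t 1] - G ![a, t 1])) ![b, y 1] :=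
      (hG _ (mem₁ _ hm)).add (AnalyticAt.comp (g := fun s => F ![a, s] - G ![a, s])
        (f := fun t : Base 2 => t 1) hc (analyticOnNhd_apply 1 Set.univ _ trivial))
    refine h3.congr ?_
    filter_upwards [Metric.isOpen_ball.mem_nhds hm] with t ht
    have ht' : ‖t 0 - y 0‖ < ε ∧ ‖t 1 - y 1‖ < ε := by
      have h2 : t - y ∈ bidisc ε := by
        change t - y ∈ Metric.ball 0 ε
        rwa [mem_ball_zero_iff, ← dist_eq_norm]
      exact mem_bidisc.1 h2
    have := const (t 1) ht'.2 (t 0) ht'.1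
    rw [vec_eq] at this
    linear_combination -this
  have hA : ∀ c ∈ disc ρ, ∀ x ∈ disc ρ, AnalyticAt ℂ (fun s => F ![x, s]) c := by
    intro c hc x hx
    have step : ∀ y ∈ disc ρ, ∃ ε > 0, ∀ a, ‖a - y‖ < ε → AnalyticAt ℂ (fun s => F ![a, s]) c →
        ∀ b, ‖b - y‖ < ε → AnalyticAt ℂ (fun s => F ![b, s]) c := by
      intro y hy
      obtain ⟨ε, hε, h⟩ := key ![y, c] (vec_mem_bidisc hy hc)
      exact ⟨ε, hε, fun a ha hA b hb => AnalyticAt.comp (f := fun s : ℂ => (![b, s] : Base 2))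
        (h a ha hA b hb) (analyticAt_vec_right b c)⟩
    have hconn : IsPreconnected ((disc ρ : Opens ℂ) : Set ℂ) := (convex_ball (0 : ℂ) ρ).isPreconnected
    -- Analyticity in the second variable spreads from first coordinate 0, where F vanishes
    -- identically, through the connected disc.
    refine hconn.induction₂' (fun a b => AnalyticAt ℂ (fun s => F ![a, s]) c →
      AnalyticAt ℂ (fun s => F ![b, s]) c) (fun y hy => ?_) (fun a b d _ _ _ h1 h2 h3 => h2 (h1 h3))
      (zero_mem_disc hρ) hx ?_
    · obtain ⟨ε, hε, h⟩ := step y hy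
      refine nhdsWithin_le_nhds ?_
      filter_upwards [Metric.ball_mem_nhds y hε] with b hb
      rw [Metric.mem_ball, dist_eq_norm] at hb
      exact ⟨fun hA => h y (by simpa using hε) hA b hb, fun hA => h b hb hA y (by simpa using hε)⟩
    · have e : (fun s => F ![0, s]) = fun _ => 0 := by
        funext s
        exact hP0 s
      rw [e]
      exact analyticAt_const
  have hFa : AnalyticOnNhd ℂ F (bidisc ρ) := by
    intro y hy
    obtain ⟨ε, hε, h⟩ := key y hy
    have := h (y 0) (by simpa using hε) (hA _ (snd_mem_disc hy) _ (fst_mem_disc hy)) (y 0)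
      (by simpa using hε)
    rwa [vec_eq] at this
  refine ⟨Holo.mk F hFa, Holo.eq_of_fn fun t ht => ?_⟩
  have e : (Holo.mk F hFa).fn =ᶠ[𝓝 t] F := by
    filter_upwards [(bidisc ρ).isOpen.mem_nhds ht] with y hy using Holo.fn_mk _ _ hy
  rw [Holo.fn_pd _ _ ht, e.fderiv_eq]
  have h1 := hasDerivAt_slice (G := F) (x := t 0) (c := t 1)
    (by rw [vec_eq]; exact (hFa t ht).differentiableAt)
  have := h1.unique (hF _ (fst_mem_disc ht) _ (snd_mem_disc ht))
  rwa [vec_eq] at this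

end Bidisc

end TEStructure

end

noncomputable section

namespace TEStructure

open TopologicalSpace (Opens)

/-! ### Gauging A₁ to the identity and A₂ to companion form -/

section Reduction

set_option linter.unusedSectionVars false

open PowerSeries Matrix

variable {R : Type*} [CommRing R] [Algebra ℂ R] {d d₀ d₁ : Derivation ℂ R R}

lemma IsGauge.comp {T T' A A' A'' : Matrix (Fin 2) (Fin 2) R⟦X⟧} (h : IsGauge d T A A')
    (h' : IsGauge d T' A' A'') : IsGauge d (T * T') A A'' := by
  unfold IsGauge at *
  have p1 := congrArg (· * T') h
  have p2 := congrArg (T * ·) h'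
  simp only [mul_add, add_mul, smul_mul_assoc, mul_smul_comm, ← mul_assoc] at p1 p2
  rw [map_derivation_mul, smul_add, ← mul_assoc]
  linear_combination (norm := abel) p1 + p2

lemma IsZGauge.comp {T T' B B' B'' : Matrix (Fin 2) (Fin 2) R⟦X⟧} (h : IsZGauge T B B')
    (h' : IsZGauge T' B' B'') : IsZGauge (T * T') B B'' := by
  unfold IsZGauge at *
  have p1 := congrArg (· * T') h
  have p2 := congrArg (T * ·) h'
  simp only [mul_add, add_mul, smul_mul_assoc, mul_smul_comm, ← mul_assoc] at p1 p2
  rw [map_derivation_mul, smul_add, ← mul_assoc]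
  linear_combination (norm := abel) p1 + p2

lemma exists_isGauge {T : Matrix (Fin 2) (Fin 2) R⟦X⟧} (hT : IsUnit T.det)
    (d : Derivation ℂ R R) (A : Matrix (Fin 2) (Fin 2) R⟦X⟧) : ∃ A', IsGauge d T A A' :=
  ⟨T⁻¹ * ((X : R⟦X⟧) • T.map (liftD d) + A * T), by
    rw [IsGauge, ← mul_assoc, Matrix.mul_nonsing_inv _ hT, one_mul]⟩

lemma exists_isZGauge {T : Matrix (Fin 2) (Fin 2) R⟦X⟧} (hT : IsUnit T.det)
    (B : Matrix (Fin 2) (Fin 2) R⟦X⟧) : ∃ B', IsZGauge T B B' :=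
  ⟨T⁻¹ * ((X : R⟦X⟧) ^ 2 • T.map (derivative R) + B * T), by
    rw [IsZGauge, ← mul_assoc, Matrix.mul_nonsing_inv _ hT, one_mul]⟩

/-- Again conjugation of the curvature; commutation of the two derivations lets the mixed derivative
of T cancel. -/
lemma IsFlatPair.gauge (hd : ∀ r, d₀ (d₁ r) = d₁ (d₀ r))
    {T A₀ A₁ A₀' A₁' : Matrix (Fin 2) (Fin 2) R⟦X⟧} (hT : IsUnit T.det)
    (h₀ : IsGauge d₀ T A₀ A₀') (h₁ : IsGauge d₁ T A₁ A₁') (h : IsFlatPair d₀ d₁ A₀ A₁) :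
    IsFlatPair d₀ d₁ A₀' A₁' := by
  refine eq_zero_of_mul_eq_zero hT ?_
  have e1 := congrArg (fun M => (X : R⟦X⟧) • M.map (liftD d₁)) h₀
  have e2 := congrArg (fun M => (X : R⟦X⟧) • M.map (liftD d₀)) h₁
  have hc : (T.map (liftD d₁)).map (liftD d₀) = (T.map (liftD d₀)).map (liftD d₁) := by
    ext1 i j; simp [liftD_comm hd]
  simp only [map_derivation_add, map_derivation_mul, map_derivation_smul, hc, liftD_X,
    zero_smul, zero_add, smul_add] at e1 e2
  unfold IsFlatPair at h
  unfold IsGauge at h₀ h₁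
  generalize T.map (liftD d₀) = T0 at *
  generalize T.map (liftD d₁) = T1 at *
  generalize A₀.map (liftD d₁) = B0 at *
  generalize A₁.map (liftD d₀) = B1 at *
  generalize A₀'.map (liftD d₁) = B0' at *
  generalize A₁'.map (liftD d₀) = B1' at *
  generalize T0.map (liftD d₁) = T3 at *
  have h' := congrArg (· * T) h
  have p1 := congrArg (· * A₁') h₀
  have p2 := congrArg (· * A₀') h₁
  have p3 := congrArg (A₀ * ·) h₁
  have p4 := congrArg (A₁ * ·) h₀
  simp only [mul_add, add_mul, sub_mul, mul_sub, smul_smul, smul_mul_assoc,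
    mul_smul_comm, ← mul_assoc, zero_mul] at *
  linear_combination (norm := abel) h' + e1 - e2 - p1 + p2 - p3 + p4

/-- The flatness conditions of a structure over a surface. -/
structure IsFlatTriple (d₀ d₁ : Derivation ℂ R R) (A₀ A₁ B : Matrix (Fin 2) (Fin 2) R⟦X⟧) :
    Prop where
  pair : IsFlatPair d₀ d₁ A₀ A₁
  flat₀ : IsFlat d₀ A₀ B
  flat₁ : IsFlat d₁ A₁ B

lemma IsFlatTriple.exists_gauge (hd : ∀ r, d₀ (d₁ r) = d₁ (d₀ r))
    {A₀ A₁ B T A₀' : Matrix (Fin 2) (Fin 2) R⟦X⟧} (h : IsFlatTriple d₀ d₁ A₀ A₁ B)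
    (hT : IsUnit T.det) (h₀ : IsGauge d₀ T A₀ A₀') :
    ∃ A₁' B', IsGauge d₁ T A₁ A₁' ∧ IsZGauge T B B' ∧ IsFlatTriple d₀ d₁ A₀' A₁' B' := by
  obtain ⟨A₁', h₁⟩ := exists_isGauge hT d₁ A₁
  obtain ⟨B', hB⟩ := exists_isZGauge hT B
  exact ⟨A₁', B', h₁, hB, h.pair.gauge hd hT h₀ h₁, h.flat₀.gauge hT h₀ hB, h.flat₁.gauge hT h₁ hB⟩

variable (R) in
/-- The coefficient of `z⁰` of a matrix. -/
def constMat : Matrix (Fin 2) (Fin 2) R⟦X⟧ →+* Matrix (Fin 2) (Fin 2) R :=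
  (constantCoeff (R := R)).mapMatrix

lemma constMat_apply (M : Matrix (Fin 2) (Fin 2) R⟦X⟧) (i j : Fin 2) :
    constMat R M i j = constantCoeff (M i j) := rfl

lemma constMat_X_smul (M : Matrix (Fin 2) (Fin 2) R⟦X⟧) : constMat R ((X : R⟦X⟧) • M) = 0 := by
  ext i j
  simp [constMat_apply]

lemma IsGauge.constMat {T A A' : Matrix (Fin 2) (Fin 2) R⟦X⟧} (h : IsGauge d T A A') :
    constMat R A * TEStructure.constMat R T = TEStructure.constMat R T * TEStructure.constMat R A' := by
  have := congrArg (TEStructure.constMat R) h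
  rwa [map_add, constMat_X_smul, zero_add, map_mul, map_mul] at this

lemma map_coeff_one_mul (M N : Matrix (Fin 2) (Fin 2) R⟦X⟧) :
    (M * N).map (coeff 1) = M.map (coeff 1) * constMat R N + constMat R M * N.map (coeff 1) := by
  ext i j
  simp [Matrix.mul_apply, coeff_one_mul, constMat_apply]
  ring

lemma map_coeff_one_X_smul (M : Matrix (Fin 2) (Fin 2) R⟦X⟧) :
    ((X : R⟦X⟧) • M).map (coeff 1) = constMat R M := by
  ext i j
  simp only [Matrix.map_apply, Matrix.smul_apply, smul_eq_mul, constMat_apply]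
  rw [show (1 : ℕ) = 0 + 1 from rfl, coeff_succ_X_mul, coeff_zero_eq_constantCoeff_apply]

lemma constMat_map_liftD (d : Derivation ℂ R R) (M : Matrix (Fin 2) (Fin 2) R⟦X⟧) :
    constMat R (M.map (liftD d)) = (constMat R M).map d := by
  ext i j
  simp only [constMat_apply, Matrix.map_apply, ← coeff_zero_eq_constantCoeff_apply, coeff_liftD]

/-- A matrix without `z`. -/
def liftMat (G : Matrix (Fin 2) (Fin 2) R) : Matrix (Fin 2) (Fin 2) R⟦X⟧ :=
  (C : R →+* R⟦X⟧).mapMatrix G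

lemma constMat_liftMat (G : Matrix (Fin 2) (Fin 2) R) : constMat R (liftMat G) = G := by
  ext i j
  simp [constMat_apply, liftMat]

lemma map_coeff_one_liftMat (G : Matrix (Fin 2) (Fin 2) R) : (liftMat G).map (coeff 1) = 0 := by
  ext i j
  simp [liftMat]

lemma isUnit_det_liftMat {G : Matrix (Fin 2) (Fin 2) R} (hG : IsUnit G.det) :
    IsUnit (liftMat G).det := by
  rw [liftMat, ← RingHom.map_det]
  exact hG.map _

lemma isUnit_det_of_constMat {T : Matrix (Fin 2) (Fin 2) R⟦X⟧} (h : IsUnit (constMat R T).det) :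
    IsUnit T.det := by
  rw [PowerSeries.isUnit_iff_constantCoeff, RingHom.map_det]
  exact h

variable (R) in
/-- The standard nilpotent matrix. -/
def nilMat : Matrix (Fin 2) (Fin 2) R := !![0, 0; 1, 0]

lemma eq_of_isUnit_of_mul_eq {G M M' : Matrix (Fin 2) (Fin 2) R} (hG : IsUnit G.det)
    (h : G * M = G * M') : M = M' :=
  ((Matrix.isUnit_iff_isUnit_det G).2 hG).mul_left_cancel h

/-- Adapting the frame to the nilpotent endomorphism. -/
lemma IsFlatTriple.exists_gauge_nilMat (hd : ∀ r, d₀ (d₁ r) = d₁ (d₀ r))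
    {A₀ A₁ B : Matrix (Fin 2) (Fin 2) R⟦X⟧} (h : IsFlatTriple d₀ d₁ A₀ A₁ B)
    {G : Matrix (Fin 2) (Fin 2) R} (hG : IsUnit G.det) (h₀ : constMat R A₀ = 1)
    (h₁ : constMat R A₁ * G = G * nilMat R) :
    ∃ T A₀' A₁' B', IsUnit T.det ∧ IsGauge d₀ T A₀ A₀' ∧ IsGauge d₁ T A₁ A₁' ∧ IsZGauge T B B' ∧
      IsFlatTriple d₀ d₁ A₀' A₁' B' ∧ constMat R A₀' = 1 ∧ constMat R A₁' = nilMat R := by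
  have hT := isUnit_det_liftMat hG
  obtain ⟨A₀', g₀⟩ := exists_isGauge hT d₀ A₀
  obtain ⟨A₁', B', g₁, gB, h'⟩ := h.exists_gauge hd hT g₀
  refine ⟨_, A₀', A₁', B', hT, g₀, g₁, gB, h', ?_, ?_⟩
  · have := g₀.constMat
    rw [constMat_liftMat, h₀, one_mul] at this
    exact eq_of_isUnit_of_mul_eq hG (by rw [← this, mul_one])
  · have := g₁.constMat
    rw [constMat_liftMat, h₁] at this
    exact (eq_of_isUnit_of_mul_eq hG this).symm

/-- Removing the terms of order `z` of `A₀ - 1`. -/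
lemma IsFlatTriple.exists_gauge_coeff_one (hd : ∀ r, d₀ (d₁ r) = d₁ (d₀ r))
    (hprim : ∀ f, ∃ g, d₀ g = f) (hexp : ∀ f, ∃ u, IsUnit u ∧ d₀ u = f * u)
    {A₀ A₁ B : Matrix (Fin 2) (Fin 2) R⟦X⟧} (h : IsFlatTriple d₀ d₁ A₀ A₁ B)
    (h₀ : constMat R A₀ = 1) (h₁ : constMat R A₁ = nilMat R) :
    ∃ T A₀' A₁' B', IsUnit T.det ∧ IsGauge d₀ T A₀ A₀' ∧ IsGauge d₁ T A₁ A₁' ∧ IsZGauge T B B' ∧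
      IsFlatTriple d₀ d₁ A₀' A₁' B' ∧ constMat R A₀' = 1 ∧ constMat R A₁' = nilMat R ∧
      A₀'.map (coeff 1) = 0 := by
  obtain ⟨m, m', n, n', hM⟩ : ∃ m m' n n', A₀.map (coeff 1) = !![m, m'; n, n'] :=
    ⟨_, _, _, _, Matrix.eta_fin_two _⟩
  -- This is the z-coefficient of flatness: the leading terms are constant, so no derivative
  -- contributes, and since A₀ begins with the identity the z-coefficient of A₁ drops out of the
  -- commutator.
  have hcomm : A₀.map (coeff 1) * nilMat R = nilMat R * A₀.map (coeff 1) := by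
    have e := congrArg (fun M => M.map (coeff 1 : R⟦X⟧ →ₗ[R] R)) h.pair
    have add : ∀ M N : Matrix (Fin 2) (Fin 2) R⟦X⟧, (M + N).map (coeff 1 : R⟦X⟧ →ₗ[R] R)
        = M.map (coeff 1) + N.map (coeff 1) := fun M N => by ext i j; simp
    have sub : ∀ M N : Matrix (Fin 2) (Fin 2) R⟦X⟧, (M - N).map (coeff 1 : R⟦X⟧ →ₗ[R] R)
        = M.map (coeff 1) - N.map (coeff 1) := fun M N => by ext i j; simp
    simp only [add, sub, map_coeff_one_X_smul, map_coeff_one_mul, constMat_map_liftD, h₀, h₁,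
      mul_one, one_mul] at e
    have z0 : (1 : Matrix (Fin 2) (Fin 2) R).map d₁ = 0 := by
      ext i j; by_cases hij : i = j <;> simp [hij]
    have z1 : (nilMat R).map d₀ = 0 := by
      ext i j; fin_cases i <;> fin_cases j <;> simp [nilMat]
    have z2 : (0 : Matrix (Fin 2) (Fin 2) R⟦X⟧).map (coeff 1 : R⟦X⟧ →ₗ[R] R) = 0 := by
      ext i j; simp
    rw [z0, z1, z2] at e
    rw [← sub_eq_zero, ← e]
    abel
  rw [hM] at hcomm
  have c00 := congrFun (congrFun hcomm 0) 0
  have c10 := congrFun (congrFun hcomm 1) 0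
  simp [nilMat, Matrix.mul_apply, Fin.sum_univ_two] at c00 c10
  obtain ⟨u, hu, hdu⟩ := hexp (-m)
  obtain ⟨q, hq⟩ := hprim (-n)
  -- Commuting with the nilpotent matrix, the z-coefficient of A₀ has the form m + nC₂. The equation
  -- d₀G = -(m + nC₂)G is therefore solvable inside the commutative algebra generated by C₂, so the
  -- leading term of A₁ is preserved.
  set G : Matrix (Fin 2) (Fin 2) R := !![u, 0; u * q, u] with hGdef
  have hG : IsUnit G.det := by
    rw [hGdef, Matrix.det_fin_two_of, zero_mul, sub_zero]
    exact hu.mul hu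
  have hGM : G.map d₀ + A₀.map (coeff 1) * G = 0 := by
    rw [hM, c00, c10, hGdef]
    ext i j
    fin_cases i <;> fin_cases j <;> simp [hdu, hq] <;> ring
  have hGn : nilMat R * G = G * nilMat R := by
    rw [hGdef, nilMat]
    ext i j
    fin_cases i <;> fin_cases j <;> simp
  have hT := isUnit_det_liftMat hG
  obtain ⟨A₀', g₀⟩ := exists_isGauge hT d₀ A₀
  obtain ⟨A₁', B', g₁, gB, h'⟩ := h.exists_gauge hd hT g₀
  refine ⟨_, A₀', A₁', B', hT, g₀, g₁, gB, h', ?_, ?_, ?_⟩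
  · have := g₀.constMat
    rw [constMat_liftMat, h₀, one_mul] at this
    exact eq_of_isUnit_of_mul_eq hG (by rw [← this, mul_one])
  · have := g₁.constMat
    rw [constMat_liftMat, h₁, hGn] at this
    exact (eq_of_isUnit_of_mul_eq hG this).symm
  · have e := congrArg (fun M => M.map (coeff 1 : R⟦X⟧ →ₗ[R] R)) g₀
    have add : ∀ M N : Matrix (Fin 2) (Fin 2) R⟦X⟧, (M + N).map (coeff 1 : R⟦X⟧ →ₗ[R] R)
        = M.map (coeff 1) + N.map (coeff 1) := fun M N => by ext i j; simp
    simp only [add, map_coeff_one_X_smul, map_coeff_one_mul, constMat_map_liftD, constMat_liftMat,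
      map_coeff_one_liftMat, mul_zero, zero_mul, add_zero, zero_add] at e
    rw [hGM] at e
    exact eq_of_isUnit_of_mul_eq hG (by rw [← e, mul_zero])

/-- Solving the equation in the direction of `d₀` when `A₀ - 1` is divisible by `z²`. -/
lemma exists_gauge_one (hprim : ∀ f, ∃ g, d₀ g = f) {A₀ : Matrix (Fin 2) (Fin 2) R⟦X⟧}
    (h₀ : constMat R A₀ = 1) (h₁ : A₀.map (coeff 1) = 0) :
    ∃ T, constMat R T = 1 ∧ IsGauge d₀ T A₀ 1 := by
  choose prim hprim using hprim
  have hM : ∀ i j, ∃ m, A₀ i j = (1 : Matrix (Fin 2) (Fin 2) R⟦X⟧) i j + X ^ 2 * m := by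
    intro i j
    have c0 := congrFun (congrFun h₀ i) j
    have c1 := congrFun (congrFun h₁ i) j
    rw [constMat_apply] at c0
    simp only [Matrix.map_apply, Matrix.zero_apply] at c1
    obtain ⟨m, hm⟩ : X ^ 2 ∣ A₀ i j - (1 : Matrix (Fin 2) (Fin 2) R⟦X⟧) i j := by
      rw [PowerSeries.X_pow_dvd_iff]
      intro n hn
      interval_cases n
      · by_cases hij : i = j
        · subst hij; simp at c0; simp [c0]
        · simp [hij] at c0; simp [c0, hij]
      · by_cases hij : i = j
        · subst hij; simp [c1, coeff_one]
        · simp [c1, hij]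
    exact ⟨m, by rw [← hm]; ring⟩
  choose M hM using hM
  -- With A₀ = 1 + z²M the gauge equation is d₀T = -zMT, contracting after integration.
  obtain ⟨u, hu⟩ := exists_fixedPoint (R := R) (ι := Fin 2 × Fin 2)
    (fun u p => (1 : Matrix (Fin 2) (Fin 2) R⟦X⟧) p.1 p.2
      - X * coeffwise (fun _ => prim) (M p.1 0 * u (0, p.2) + M p.1 1 * u (1, p.2)))
    (fun k u v huv p => (Cong.refl _ _).sub (Cong.X_mul (Cong.coeffwise _
      (((huv _).const_mul _).add ((huv _).const_mul _)))))
  have hu' : ∀ i j, (1 : Matrix (Fin 2) (Fin 2) R⟦X⟧) i j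
      - X * coeffwise (fun _ => prim) (M i 0 * u (0, j) + M i 1 * u (1, j)) = u (i, j) :=
    fun i j => congrFun hu (i, j)
  have hd : ∀ i j, liftD d₀ (u (i, j)) = -(X * (M i 0 * u (0, j) + M i 1 * u (1, j))) := by
    intro i j
    have e := congrArg (liftD d₀) (hu' i j)
    have e1 : liftD d₀ ((1 : Matrix (Fin 2) (Fin 2) R⟦X⟧) i j) = 0 := by
      rw [Matrix.one_apply]; split_ifs <;> simp
    have e2 : ∀ x, liftD d₀ (coeffwise (fun _ => prim) x) = x := fun x => by
      ext n; simp [hprim]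
    rw [map_sub, liftD_X_mul, e2, e1, zero_sub] at e
    exact e.symm
  refine ⟨Matrix.of fun i j => u (i, j), ?_, ?_⟩
  · ext i j
    rw [constMat_apply, Matrix.of_apply, ← hu' i j, Matrix.one_apply, Matrix.one_apply]
    split_ifs <;> simp
  · rw [IsGauge, mul_one]
    ext1 i j
    simp only [Matrix.add_apply, Matrix.smul_apply, Matrix.map_apply, Matrix.of_apply,
      smul_eq_mul, Matrix.mul_apply, Fin.sum_univ_two, hM, hd]
    fin_cases i <;> simp [Matrix.one_apply] <;> ring

/-- The structure becomes trivial in the direction of `d₀`. -/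
theorem IsFlatTriple.exists_gauge_one (hd : ∀ r, d₀ (d₁ r) = d₁ (d₀ r))
    (hprim : ∀ f, ∃ g, d₀ g = f) (hexp : ∀ f, ∃ u, IsUnit u ∧ d₀ u = f * u)
    {A₀ A₁ B : Matrix (Fin 2) (Fin 2) R⟦X⟧} (h : IsFlatTriple d₀ d₁ A₀ A₁ B)
    {G : Matrix (Fin 2) (Fin 2) R} (hG : IsUnit G.det) (h₀ : constMat R A₀ = 1)
    (h₁ : constMat R A₁ * G = G * nilMat R) :
    ∃ T A₁' B', IsUnit T.det ∧ IsGauge d₀ T A₀ 1 ∧ IsGauge d₁ T A₁ A₁' ∧ IsZGauge T B B' ∧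
      IsFlatTriple d₀ d₁ 1 A₁' B' ∧ constMat R A₁' = nilMat R := by
  obtain ⟨T₁, A₀', A₁', B', hT₁, g₀, g₁, gB, h', k₀, k₁⟩ := h.exists_gauge_nilMat hd hG h₀ h₁
  obtain ⟨T₂, A₀'', A₁'', B'', hT₂, g₀', g₁', gB', h'', k₀', k₁', k₂⟩ :=
    h'.exists_gauge_coeff_one hd hprim hexp k₀ k₁
  obtain ⟨T₃, c₃, g₀''⟩ := TEStructure.exists_gauge_one hprim k₀' k₂
  have hT₃ : IsUnit T₃.det := isUnit_det_of_constMat (by rw [c₃, Matrix.det_one]; exact isUnit_one)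
  obtain ⟨A, β, g₁'', gB'', h'''⟩ := h''.exists_gauge hd hT₃ g₀''
  refine ⟨T₁ * T₂ * T₃, A, β, ?_, (g₀.comp g₀').comp g₀'', (g₁.comp g₁').comp g₁'',
    (gB.comp gB').comp gB'', h''', ?_⟩
  · rw [Matrix.det_mul, Matrix.det_mul]
    exact (hT₁.mul hT₂).mul hT₃
  · have := g₁''.constMat
    rw [c₃, mul_one, one_mul, k₁'] at this
    exact this.symm

/-- Invertible solutions of scalar linear equations. -/
lemma exists_unit_solution (hprim : ∀ f, ∃ g, d g = f) (hexp : ∀ f, ∃ u, IsUnit u ∧ d u = f * u)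
    (h : R⟦X⟧) : ∃ u, IsUnit u ∧ liftD d u = h * u := by
  obtain ⟨h', hh⟩ := exists_eq_C_add_X_mul h
  obtain ⟨v, hv, hdv⟩ := hexp (coeff 0 h)
  choose prim hprim using hprim
  -- The solution is a product: v handles the z⁰ part of h, and w, congruent to 1 modulo z, handles
  -- the rest.
  obtain ⟨w, hw⟩ := exists_fixedPoint_single (R := R)
    (fun w => 1 + X * coeffwise (fun _ => prim) (h' * w))
    (fun k x y hxy => (Cong.refl _ _).add (Cong.X_mul (Cong.coeffwise _ (hxy.const_mul _))))
  have e2 : ∀ x, liftD d (coeffwise (fun _ => prim) x) = x := fun x => by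
    ext n; simp [hprim]
  have hdw : liftD d w = X * (h' * w) := by
    conv_lhs => rw [← hw]
    rw [map_add, liftD_X_mul, e2]
    simp
  refine ⟨C v * w, (hv.map _).mul ?_, ?_⟩
  · rw [PowerSeries.isUnit_iff_constantCoeff, ← hw]
    simp
  · rw [Derivation.leibniz, liftD_C, hdw, hdv, smul_eq_mul, smul_eq_mul, map_mul]
    linear_combination -(C v * w) * hh

/-- A structure with nilpotent leading term is given by a companion matrix. -/
theorem exists_gauge_companionA (hprim : ∀ f, ∃ g, d g = f)
    (hexp : ∀ f, ∃ u, IsUnit u ∧ d u = f * u) {A : Matrix (Fin 2) (Fin 2) R⟦X⟧}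
    (h : constMat R A = nilMat R) :
    ∃ T f, IsUnit T.det ∧ IsGauge d T A (companionA f) := by
  obtain ⟨p, q, v, r, rfl⟩ : ∃ p q v r, A = !![p, q; v, r] := ⟨_, _, _, _, Matrix.eta_fin_two A⟩
  have c00 := congrFun (congrFun h 0) 0
  have c01 := congrFun (congrFun h 0) 1
  have c10 := congrFun (congrFun h 1) 0
  have c11 := congrFun (congrFun h 1) 1
  simp [constMat_apply, nilMat] at c00 c01 c10 c11
  obtain ⟨a, rfl⟩ := PowerSeries.X_dvd_iff.2 c00
  obtain ⟨b, rfl⟩ := PowerSeries.X_dvd_iff.2 c01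
  obtain ⟨s, rfl⟩ := PowerSeries.X_dvd_iff.2 c11
  have hv : IsUnit v := by
    rw [PowerSeries.isUnit_iff_constantCoeff, c10]; exact isUnit_one
  obtain ⟨v', hv'⟩ := hv.exists_right_inv
  -- The scaling u of the cyclic vector makes the transformed matrix trace-free; v' is the inverse
  -- of v.
  obtain ⟨u, hu, hdu⟩ := exists_unit_solution hprim hexp (-(half R * (liftD d v * v' + a + s)))
  obtain ⟨u', hu'⟩ := hu.exists_right_inv
  have h2 := two_mul_half (R := R)
  have key : 2 * liftD d u * v = -(u * (liftD d v + (a + s) * v)) := by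
    rw [hdu]
    linear_combination -(u * (liftD d v * v' + a + s) * v) * h2 - u * liftD d v * hv'
  -- The first column is u times the first basis vector, and the second column is its covariant
  -- derivative.
  refine ⟨!![u, X * liftD d u + u * (X * a); 0, u * v],
    u' * (X * liftD d (liftD d u) + 2 * X * a * liftD d u + X * u * liftD d a + X * u * a ^ 2
      + b * u * v), ?_, ?_⟩
  · rw [Matrix.det_fin_two_of, mul_zero, sub_zero]
    exact hu.mul (hu.mul hv)
  · rw [IsGauge, companionA]
    ext1 i j
    fin_cases i <;> fin_cases j <;> simp
    · ring
    · linear_combination -(X * (X * liftD d (liftD d u) + 2 * X * a * liftD d u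
        + X * u * liftD d a + X * u * a ^ 2 + b * u * v)) * hu'
    · ring
    · linear_combination X * key

end Reduction

end TEStructure

end

/-! ### From a structure over 𝒩₂ to data in one variable -/

noncomputable section

namespace TEStructure

open TopologicalSpace (Opens)

open PowerSeries

section Lift

variable {m r : ℕ} {W : Opens (Base m)}

/-- The matrix over `(Holo W)⟦z⟧` given by a function with holomorphic coefficients. -/
def liftHolo (M : Base m → ZMat r)
    (h : ∀ a b n, AnalyticOnNhd ℂ (fun t => coeff n (M t a b)) W) :
    Matrix (Fin r) (Fin r) (Holo W)⟦X⟧ :=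
  Matrix.of fun a b => PowerSeries.mk fun n => Holo.mk _ (h a b n)

lemma realize_liftHolo {M : Base m → ZMat r}
    (h : ∀ a b n, AnalyticOnNhd ℂ (fun t => coeff n (M t a b)) W) {t : Base m} (ht : t ∈ W) :
    realize (liftHolo M h) t = M t := by
  ext a b n
  rw [coeff_realize, liftHolo, Matrix.of_apply, coeff_mk, Holo.fn_mk _ _ ht]

lemma eq_of_realize {M M' : Matrix (Fin r) (Fin r) (Holo W)⟦X⟧}
    (h : ∀ t ∈ W, realize M t = realize M' t) : M = M' := by
  ext a b n
  refine Holo.eq_of_fn fun t ht => ?_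
  rw [← coeff_realize, ← coeff_realize, h t ht]

lemma realize_add (M M' : Matrix (Fin r) (Fin r) (Holo W)⟦X⟧) (t : Base m) :
    realize (M + M') t = realize M t + realize M' t := by
  ext a b n
  simp [coeff_realize, Holo.fn_add]

lemma realize_sub (M M' : Matrix (Fin r) (Fin r) (Holo W)⟦X⟧) (t : Base m) :
    realize (M - M') t = realize M t - realize M' t := by
  ext a b n
  simp [coeff_realize, Holo.fn_sub]

lemma realize_zero (t : Base m) :
    realize (0 : Matrix (Fin r) (Fin r) (Holo W)⟦X⟧) t = 0 := by
  ext a b n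
  simp [coeff_realize, Holo.fn_zero]

lemma realize_mul (M M' : Matrix (Fin r) (Fin r) (Holo W)⟦X⟧) {t : Base m} (ht : t ∈ W) :
    realize (M * M') t = realize M t * realize M' t := by
  have := fun M : Matrix (Fin r) (Fin r) (Holo W)⟦X⟧ => realize_eq M (⟨t, ht⟩ : W)
  simp only at this
  rw [this, this, this, map_mul]

lemma realize_X_pow_smul (n : ℕ) (M : Matrix (Fin r) (Fin r) (Holo W)⟦X⟧) {t : Base m}
    (ht : t ∈ W) : realize ((X : (Holo W)⟦X⟧) ^ n • M) t = z ^ n • realize M t := by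
  have := fun M : Matrix (Fin r) (Fin r) (Holo W)⟦X⟧ => realize_eq M (⟨t, ht⟩ : W)
  simp only at this
  rw [this, this, mapMatrix_smul, map_pow, PowerSeries.map_X]

lemma realize_X_smul (M : Matrix (Fin r) (Fin r) (Holo W)⟦X⟧) {t : Base m}
    (ht : t ∈ W) : realize ((X : (Holo W)⟦X⟧) • M) t = z • realize M t := by
  simpa using realize_X_pow_smul 1 M ht

lemma realize_map_liftD_liftHolo {M : Base m → ZMat r}
    (h : ∀ a b n, AnalyticOnNhd ℂ (fun t => coeff n (M t a b)) W) (i : Fin m) {t : Base m}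
    (ht : t ∈ W) :
    realize ((liftHolo M h).map (liftD (Holo.pd (Pi.single i 1)))) t = pdMat i M t := by
  have e : realize (liftHolo M h) =ᶠ[𝓝 t] M := by
    filter_upwards [W.isOpen.mem_nhds ht] with s hs using realize_liftHolo h hs
  rw [← pdMat_congr e]
  exact (pdMat_realize (liftHolo M h) i (⟨t, ht⟩ : W)).symm

lemma realize_map_derivative_liftHolo {M : Base m → ZMat r}
    (h : ∀ a b n, AnalyticOnNhd ℂ (fun t => coeff n (M t a b)) W) {t : Base m} (ht : t ∈ W) :
    realize ((liftHolo M h).map (derivative (Holo W))) t = dz (M t) := by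
  rw [← realize_liftHolo h ht]
  exact (dz_realize (liftHolo M h) (⟨t, ht⟩ : W)).symm

end Lift

lemma constMat_fn {W : Opens (Base 2)} (M : Matrix (Fin 2) (Fin 2) (Holo W)⟦X⟧) (t : Base 2)
    (i j : Fin 2) : (constMat _ M i j).fn t = coeffZero (realize M t) i j := by
  rw [constMat_apply, ← coeff_zero_eq_constantCoeff_apply, ← coeff_realize, coeffZero,
    Matrix.map_apply, coeff_zero_eq_constantCoeff_apply]

/-- The frame `e, N e`. -/
def frameMat {R : Type*} [CommRing R] (N : Matrix (Fin 2) (Fin 2) R) (e₀ e₁ : R) :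
    Matrix (Fin 2) (Fin 2) R :=
  !![e₀, N 0 0 * e₀ + N 0 1 * e₁; e₁, N 1 0 * e₀ + N 1 1 * e₁]

lemma mul_frameMat {R : Type*} [CommRing R] {N : Matrix (Fin 2) (Fin 2) R} (hN : N * N = 0)
    (e₀ e₁ : R) : N * frameMat N e₀ e₁ = frameMat N e₀ e₁ * nilMat R := by
  have h : ∀ i j, N i 0 * N 0 j + N i 1 * N 1 j = 0 := fun i j => by
    simpa [Matrix.mul_apply, Fin.sum_univ_two] using congrFun (congrFun hN i) j
  ext i j
  fin_cases i <;> fin_cases j <;>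
    simp only [frameMat, nilMat, Matrix.mul_apply, Fin.sum_univ_two] <;> simp
  · linear_combination e₀ * h 0 0 + e₁ * h 0 1
  · linear_combination e₀ * h 1 0 + e₁ * h 1 1

/-- Local data on a bidisc of a structure over `𝒩₂`. -/
theorem LiesOverN2.exists_lift {S : FormalTE 2 2} (hS : LiesOverN2 S) :
    ∃ (ρ : ℝ) (_ : 0 < ρ) (A₀ A₁ B : Matrix (Fin 2) (Fin 2) (Holo (bidisc ρ))⟦X⟧)
      (G : Matrix (Fin 2) (Fin 2) (Holo (bidisc ρ))),
      (∀ t ∈ bidisc ρ, S.A 0 t = realize A₀ t) ∧ (∀ t ∈ bidisc ρ, S.A 1 t = realize A₁ t) ∧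
      (∀ t ∈ bidisc ρ, S.B t = realize B t) ∧
      IsFlatTriple (Holo.pd (Pi.single 0 1)) (Holo.pd (Pi.single 1 1)) A₀ A₁ B ∧
      IsUnit G.det ∧ constMat _ A₀ = 1 ∧ constMat _ A₁ * G = G * nilMat _ := by
  obtain ⟨⟨ζ, -, hζ⟩, hN⟩ := hS
  have hhiggs : ∀ (t : Base 2) (Y : Base 2), higgs S t Y
      = Y 0 • coeffZero (S.A 0 t) + Y 1 • coeffZero (S.A 1 t) := fun t Y => by
    rw [higgs, Fin.sum_univ_two]
  have hN' : ∀ᶠ t in 𝓝 (0 : Base 2), coeffZero (S.A 0 t) = 1 ∧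
      coeffZero (S.A 1 t) * coeffZero (S.A 1 t) = 0 := by
    filter_upwards [hN] with t ht
    obtain ⟨h1, h2⟩ := ht
    constructor
    · simpa [hhiggs, n2Unit] using h2
    · have := h1 ![0, 1] ![0, 1]
      simp only [hhiggs, n2Mul] at this
      simpa using this.symm
  have hb := hζ.self_of_nhds
  have h0 := hN'.self_of_nhds.1
  set N₀ := coeffZero (S.A 1 0) with hN₀
  -- The constant vector ζ(0) serves as e: by the unfolding condition e and C_{∂₂}e are independent
  -- at 0, and by continuity also nearby.
  have hdet : (frameMat N₀ (ζ 0 0) (ζ 0 1)).det ≠ 0 := by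
    have e : (fun Y : Base 2 => (higgs S 0 Y).mulVec (ζ 0))
        = fun Y => (frameMat N₀ (ζ 0 0) (ζ 0 1)).mulVec Y := by
      funext Y
      rw [hhiggs, h0]
      funext i
      fin_cases i <;> simp [frameMat, Matrix.mulVec, dotProduct, Fin.sum_univ_two] <;> ring
    rw [e] at hb
    have h1 := (Matrix.mulVec_injective_iff_isUnit).1 hb.1
    exact ((Matrix.isUnit_iff_isUnit_det _).1 h1).ne_zero
  have an : ∀ i, ∀ᶠ t in 𝓝 (0 : Base 2), ∀ a b n, AnalyticAt ℂ (fun s => coeff n (S.A i s a b)) t :=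
    fun i => (S.holoA i).eventually_analyticAt
  have hcont : ∀ᶠ t in 𝓝 (0 : Base 2),
      (frameMat (coeffZero (S.A 1 t)) (ζ 0 0) (ζ 0 1)).det ≠ 0 := by
    have hc : ∀ a b, ContinuousAt (fun t => coeffZero (S.A 1 t) a b) 0 := fun a b => by
      have := ((an 1).self_of_nhds a b 0).continuousAt
      simpa [coeffZero] using this
    refine ContinuousAt.eventually_ne ?_ hdet
    simp only [frameMat, Matrix.det_fin_two_of]
    have c00 := hc 0 0
    have c01 := hc 0 1
    have c10 := hc 1 0
    have c11 := hc 1 1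
    fun_prop
  obtain ⟨ρ, hρ, h⟩ := Metric.eventually_nhds_iff_ball.1
    ((an 0).and ((an 1).and (S.holoB.eventually_analyticAt.and ((S.flatA 0 1).and
      ((S.flatB 0).and ((S.flatB 1).and (hN'.and hcont)))))))
  have h' : ∀ t ∈ bidisc ρ, _ := h
  have a0 : ∀ a b n, AnalyticOnNhd ℂ (fun t => coeff n (S.A 0 t a b)) (bidisc ρ) :=
    fun a b n t ht => (h' t ht).1 a b n
  have a1 : ∀ a b n, AnalyticOnNhd ℂ (fun t => coeff n (S.A 1 t a b)) (bidisc ρ) :=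
    fun a b n t ht => (h' t ht).2.1 a b n
  have aB : ∀ a b n, AnalyticOnNhd ℂ (fun t => coeff n (S.B t a b)) (bidisc ρ) :=
    fun a b n t ht => (h' t ht).2.2.1 a b n
  have c0 : constMat _ (liftHolo (S.A 0) a0) = 1 := by
    ext i j
    refine Holo.eq_of_fn fun t ht => ?_
    rw [constMat_fn, realize_liftHolo a0 ht, (h' t ht).2.2.2.2.2.2.1.1, Matrix.one_apply,
      Matrix.one_apply]
    split_ifs
    · rw [Holo.fn_one ht]
    · rw [Holo.fn_zero]
  have c1 : constMat _ (liftHolo (S.A 1) a1) * constMat _ (liftHolo (S.A 1) a1) = 0 := by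
    ext i j
    refine Holo.eq_of_fn fun t ht => ?_
    have e := congrFun (congrFun (h' t ht).2.2.2.2.2.2.1.2 i) j
    rw [Matrix.mul_apply, Fin.sum_univ_two] at e ⊢
    rw [Holo.fn_add, Holo.fn_mul, Holo.fn_mul]
    simp only [constMat_fn, realize_liftHolo a1 ht]
    rw [e, Matrix.zero_apply, Matrix.zero_apply, Holo.fn_zero]
  refine ⟨ρ, hρ, liftHolo (S.A 0) a0, liftHolo (S.A 1) a1, liftHolo S.B aB,
    frameMat (constMat _ (liftHolo (S.A 1) a1)) (algebraMap ℂ _ (ζ 0 0)) (algebraMap ℂ _ (ζ 0 1)),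
    fun t ht => (realize_liftHolo a0 ht).symm, fun t ht => (realize_liftHolo a1 ht).symm,
    fun t ht => (realize_liftHolo aB ht).symm, ⟨?_, ?_, ?_⟩, ?_, c0, mul_frameMat c1 _ _⟩
  · refine eq_of_realize fun t ht => ?_
    rw [realize_add, realize_sub, realize_sub, realize_X_smul _ ht, realize_X_smul _ ht,
      realize_mul _ _ ht, realize_mul _ _ ht, realize_map_liftD_liftHolo a1 _ ht,
      realize_map_liftD_liftHolo a0 _ ht, realize_liftHolo a0 ht, realize_liftHolo a1 ht,
      realize_zero]
    exact (h' t ht).2.2.2.1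
  · refine eq_of_realize fun t ht => ?_
    rw [realize_add, realize_add, realize_sub, realize_sub, realize_X_smul _ ht,
      realize_X_smul _ ht, realize_X_pow_smul _ _ ht,
      realize_mul _ _ ht, realize_mul _ _ ht, realize_map_liftD_liftHolo aB _ ht,
      realize_map_derivative_liftHolo a0 ht, realize_liftHolo a0 ht, realize_liftHolo aB ht,
      realize_zero]
    exact (h' t ht).2.2.2.2.1
  · refine eq_of_realize fun t ht => ?_
    rw [realize_add, realize_add, realize_sub, realize_sub, realize_X_smul _ ht,
      realize_X_smul _ ht, realize_X_pow_smul _ _ ht,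
      realize_mul _ _ ht, realize_mul _ _ ht, realize_map_liftD_liftHolo aB _ ht,
      realize_map_derivative_liftHolo a1 ht, realize_liftHolo a1 ht, realize_liftHolo aB ht,
      realize_zero]
    exact (h' t ht).2.2.2.2.2.1
  · refine Holo.isUnit_of_ne_zero _ fun t ht => ?_
    have e := (h' t ht).2.2.2.2.2.2.2
    simp only [frameMat, Matrix.det_fin_two_of] at e ⊢
    simpa only [Holo.fn_sub, Holo.fn_mul, Holo.fn_add, Holo.fn_algebraMap _ ht, constMat_fn,
      realize_liftHolo a1 ht] using e

section Descend

variable {R R' : Type*} [CommRing R] [Algebra ℂ R] [CommRing R'] [Algebra ℂ R']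
  {d : Derivation ℂ R R} {d₀ d₁ : Derivation ℂ R' R'} {σ : R →ₐ[ℂ] R'} {τ : R'}

lemma exists_map_eq (hσ : ∀ f, d₀ f = 0 → ∃ g, σ g = f) {x : R'⟦X⟧} (hx : liftD d₀ x = 0) :
    ∃ y, PowerSeries.map (σ : R →+* R') y = x := by
  have : ∀ n, ∃ g, σ g = coeff n x := fun n => hσ _ (by rw [← coeff_liftD, hx, map_zero])
  choose g hg using this
  exact ⟨PowerSeries.mk g, by ext n; simp [hg]⟩

lemma exists_mapMatrix_eq (hσ : ∀ f, d₀ f = 0 → ∃ g, σ g = f)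
    {M : Matrix (Fin 2) (Fin 2) R'⟦X⟧} (hM : ∀ i j, liftD d₀ (M i j) = 0) :
    ∃ M', (PowerSeries.map (σ : R →+* R')).mapMatrix M' = M := by
  choose M' hM' using fun i j => exists_map_eq hσ (hM i j)
  exact ⟨Matrix.of M', by ext1 i j; simp [hM']⟩

lemma IsFlat.of_mapMatrix (hσ : Function.Injective σ) {A B : Matrix (Fin 2) (Fin 2) R⟦X⟧}
    (h₁ : ∀ f, d₁ (σ f) = σ (d f))
    (h : IsFlat d₁ ((PowerSeries.map (σ : R →+* R')).mapMatrix A)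
      ((PowerSeries.map (σ : R →+* R')).mapMatrix B)) : IsFlat d A B := by
  set μ := PowerSeries.map (σ : R →+* R') with hμ
  have hinj : Function.Injective
      (μ.mapMatrix : Matrix (Fin 2) (Fin 2) R⟦X⟧ →+* Matrix (Fin 2) (Fin 2) R'⟦X⟧) := by
    intro M M' e
    ext i j n
    have := congrArg (coeff n) (congrFun (congrFun e i) j)
    simp only [RingHom.mapMatrix_apply, Matrix.map_apply, hμ, coeff_map] at this
    exact hσ this
  apply hinj
  have e1 : (μ.mapMatrix B).map (liftD d₁) = μ.mapMatrix (B.map (liftD d)) := by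
    ext i j n; simp [hμ, h₁]
  have e2 : (μ.mapMatrix A).map (derivative R') = μ.mapMatrix (A.map (derivative R)) := by
    ext i j n; simp [hμ, coeff_derivative]
  rw [IsFlat, e1, e2] at h
  rw [map_zero, ← h]
  simp only [map_add, map_sub, map_mul, mapMatrix_smul, map_pow]
  rw [hμ, PowerSeries.map_X]

/-- A structure with `A₀ = 1` comes from a structure in one variable. -/
theorem IsFlatTriple.exists_descend (hinj : Function.Injective σ)
    (hσ : ∀ f, d₀ f = 0 → ∃ g, σ g = f) (hd₁ : ∀ f, d₁ (σ f) = σ (d f))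
    (hτ₀ : d₀ τ = 1) (hτ₁ : d₁ τ = 0) {A₁ B : Matrix (Fin 2) (Fin 2) R'⟦X⟧}
    (h : IsFlatTriple d₀ d₁ 1 A₁ B) (hA₁ : constMat R' A₁ = nilMat R') :
    ∃ A β : Matrix (Fin 2) (Fin 2) R⟦X⟧, IsFlat d A β ∧ constMat R A = nilMat R ∧
      A₁ = (PowerSeries.map (σ : R →+* R')).mapMatrix A ∧
      B = (PowerSeries.map (σ : R →+* R')).mapMatrix β - C τ • 1 := by
  have one₁ : (1 : Matrix (Fin 2) (Fin 2) R'⟦X⟧).map (liftD d₁) = 0 := by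
    ext1 i j; rw [Matrix.map_apply, Matrix.one_apply]; split_ifs <;> simp
  have one₂ : (1 : Matrix (Fin 2) (Fin 2) R'⟦X⟧).map (derivative R') = 0 := by
    ext1 i j; rw [Matrix.map_apply, Matrix.one_apply]; split_ifs <;> simp
  -- With A₀ = 1 the commutators vanish: the flat pair says z d₀A₁ = 0, and flatness of B in this
  -- direction says d₀B = -1.
  have hA : ∀ i j, liftD d₀ (A₁ i j) = 0 := fun i j => by
    have := congrFun (congrFun h.pair i) j
    rw [one₁, one_mul, mul_one, sub_self, smul_zero, sub_zero, add_zero] at this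
    exact X_mul_cancel (by simpa using this)
  have hB : ∀ i j, liftD d₀ ((B + C τ • 1 : Matrix (Fin 2) (Fin 2) R'⟦X⟧) i j) = 0 := fun i j => by
    have e := congrFun (congrFun h.flat₀ i) j
    rw [one₂, one_mul, mul_one, sub_self, smul_zero, sub_zero, add_zero, ← smul_add] at e
    have e' : liftD d₀ (B i j) + (1 : Matrix (Fin 2) (Fin 2) R'⟦X⟧) i j = 0 :=
      X_mul_cancel (by simpa using e)
    rw [← e', Matrix.add_apply, map_add, Matrix.smul_apply, Matrix.one_apply]
    split_ifs <;> simp [hτ₀]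
  obtain ⟨A, rfl⟩ := exists_mapMatrix_eq hσ hA
  obtain ⟨β, hβ⟩ := exists_mapMatrix_eq hσ hB
  refine ⟨A, β, ?_, ?_, rfl, by rw [hβ, add_sub_cancel_right]⟩
  · refine IsFlat.of_mapMatrix hinj hd₁ ?_
    have := h.flat₁.sub_smul_one (τ := -τ) (by rw [map_neg, hτ₁, neg_zero])
    rw [hβ]
    rwa [map_neg, neg_smul, sub_neg_eq_add] at this
  · ext i j
    apply hinj
    have e := congrFun (congrFun hA₁ i) j
    rw [constMat_apply] at e ⊢
    have e1 : constantCoeff ((PowerSeries.map (σ : R →+* R')).mapMatrix A i j)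
        = σ (constantCoeff (A i j)) := by
      rw [← coeff_zero_eq_constantCoeff_apply, ← coeff_zero_eq_constantCoeff_apply]; simp
    rw [← e1, e]
    fin_cases i <;> fin_cases j <;> simp [nilMat]

end Descend

lemma pd_one_ofSnd {ρ : ℝ} (f : Holo (disc ρ)) :
    Holo.pd (Pi.single 1 1) (ofSnd ρ f) = ofSnd ρ (Holo.pd 1 f) := by
  rw [pd_ofSnd]; simp

lemma realize_ofSnd {ρ : ℝ} (M : Matrix (Fin 2) (Fin 2) (Holo (disc ρ))⟦X⟧) {t : Base 2}
    (ht : t ∈ bidisc ρ) :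
    realize ((PowerSeries.map (ofSnd ρ : Holo (disc ρ) →+* Holo (bidisc ρ))).mapMatrix M) t
      = realize M (t 1) := by
  ext a b n
  rw [coeff_realize, coeff_realize, ← fn_ofSnd _ ht]
  rfl

/-- Every structure over `𝒩₂` is isomorphic to a companion structure in one variable. -/
theorem LiesOverN2.exists_hasForm {S : FormalTE 2 2} (hS : LiesOverN2 S) :
    ∃ ρ f b g, HasForm S ρ f b g := by
  obtain ⟨ρ, hρ, A₀, A₁, B, G, eA₀, eA₁, eB, hflat, hG, h₀, h₁⟩ := hS.exists_lift
  have hprim := exists_primitive_bidisc hρ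
  have hexp : ∀ f : Holo (bidisc ρ), ∃ u, IsUnit u ∧ Holo.pd (Pi.single 0 1) u = f * u := fun f => by
    obtain ⟨g, hg⟩ := hprim f
    exact ⟨Holo.exp g, Holo.isUnit_exp g, by rw [Holo.pd_exp, hg]⟩
  obtain ⟨T, A₁', B', hT, g₀, g₁, gB, hflat', k₁⟩ :=
    hflat.exists_gauge_one (Holo.pd_comm _ _) hprim hexp hG h₀ h₁
  obtain ⟨A, β, hf, hA, rfl, rfl⟩ := hflat'.exists_descend (τ := coord 0) (d := Holo.pd 1)
    (ofSnd_injective hρ) (fun f hf => ⟨_, (eq_ofSnd_of_pd hρ hf).symm⟩) pd_one_ofSnd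
    (by rw [pd_coord]; simp) (by rw [pd_coord]; simp) k₁
  have iso : FormallyIsomorphic S (ofOneVar (zero_mem_disc hρ) A β hf) := by
    refine formallyIsomorphic_of_realize (W := bidisc ρ) (zero_mem_bidisc hρ) isBiholoGerm_id hT
      (A := ![A₀, A₁]) (B := B) (c := fun i j => if i = j then 1 else 0)
      (A' := ![1, (PowerSeries.map (ofSnd ρ : Holo (disc ρ) →+* Holo (bidisc ρ))).mapMatrix A])
      (h := id) (fun i j t ht => ?_) (fun j t ht => ?_) eB (fun j t ht => ?_)
      (fun t ht => ?_) (fun i => ?_) gB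
    · have e : pd i (fun s : Base 2 => id s j) t = if i = j then 1 else 0 := by
        rw [pd]
        simp only [id]
        rw [fderiv_apply_base, Pi.single_apply]
        simp only [eq_comm]
      rw [e]
      split_ifs
      · exact Holo.fn_one ht
      · exact Holo.fn_zero t
    · fin_cases j
      · exact eA₀ t ht
      · exact eA₁ t ht
    · fin_cases j
      · refine (ofOneVar_A_zero (snd_mem_disc ht)).trans ?_
        have : realize (1 : Matrix (Fin 2) (Fin 2) (Holo (bidisc ρ))⟦X⟧) t = 1 := by
          rw [show realize (1 : Matrix (Fin 2) (Fin 2) (Holo (bidisc ρ))⟦X⟧) t = _ from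
            realize_eq _ (⟨t, ht⟩ : bidisc ρ), map_one]
        exact this.symm
      · exact (ofOneVar_A_one t).trans (realize_ofSnd A ht).symm
    · rw [ofOneVar_B (snd_mem_disc ht), realize_sub, realize_ofSnd _ ht]
      congr 1
      rw [show realize (C (coord 0 : Holo (bidisc ρ)) •
          (1 : Matrix (Fin 2) (Fin 2) (Holo (bidisc ρ))⟦X⟧)) t = _ from
        realize_eq _ (⟨t, ht⟩ : bidisc ρ), mapMatrix_smul, map_one, PowerSeries.map_C,
        RingHom.coe_coe, Holo.eval_eq_fn, coord, Holo.fn_mk _ _ ht]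
    · fin_cases i
      · simpa using g₀
      · simpa using g₁
  have hprim' : ∀ f : Holo (disc ρ), ∃ g, Holo.pd 1 g = f := fun f =>
    (exists_primitive hρ f 0).imp fun _ h => h.1
  have hexp' : ∀ f : Holo (disc ρ), ∃ u, IsUnit u ∧ Holo.pd 1 u = f * u := fun f => by
    obtain ⟨g, hg⟩ := hprim' f
    exact ⟨Holo.exp g, Holo.isUnit_exp g, by rw [Holo.pd_exp, hg]⟩
  obtain ⟨T', f, hT', gA⟩ := exists_gauge_companionA hprim' hexp' hA
  obtain ⟨β', gβ⟩ := exists_isZGauge hT' β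
  obtain ⟨s, b, hs, hc, rfl⟩ := eq_companionB_of_isFlat (hf.gauge hT' gA gβ)
  have hs' := (discCalculus hρ).eq_cst_of_liftD_eq_zero hs
  rw [hs'] at gβ
  exact ⟨ρ, f, b, _, hρ, hc, iso.trans (formallyIsomorphic_of_gauge hT' gA gβ)⟩

end TEStructure

end

theorem theorem3p1 (S : TEStructure.FormalTE 2 2) (hS : TEStructure.LiesOverN2 S) :
    ∃ N : TEStructure.FormalTE 2 2,
      TEStructure.IsNormalForm N ∧ TEStructure.LiesOverN2 N ∧
        TEStructure.FormallyIsomorphic S N := by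
  obtain ⟨_, _, _, _, H⟩ := hS.exists_hasForm
  exact H.exists_normalForm_any
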